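/- Let $\mathcal R(s)=\int_{0\swarrow 1}\frac{x^{-s}e^{\pi i x^2}}{e^{\pi i x}-e^{-\pi i x}}\,dx$ be Riemann's auxiliary function, an entire function; the path is the line $\{\frac12+re^{\pi i/4}:r\in\mathbb R\}$ described from upper right to lower left, and $x^{-s}$ is the principal branch. Let $\varrho=\beta+i\gamma$ run through the nontrivial zeros of $\mathcal R$, i.e. the zeros of the entire function $s\pi^{-s/2}\Gamma(s/2)\mathcal R(s)$; in the sums below every zero is repeated according to its multiplicity as a zero of this function. Define for $t\in\mathbb R$ $$u(t)=\int_0^t\sum_{\gamma>0}\frac{\beta-\frac12}{(\beta-\frac12)^2+(\gamma-x)^2}\,dx,\qquad d(t)=\int_0^t\sum_{\gamma\le 0}\Bigl(\frac{\beta-\frac12}{(\beta-\frac12)^2+(\gamma-x)^2}-\frac{\beta-\frac12}{(\beta-\frac12)^2+\gamma^2}\Bigr)dx,$$ where the terms with $\beta=\frac12$ are $0$. Let $\vartheta(t)=\operatorname{Im}\log\Gamma(\frac14+\frac{it}2)-\frac t2\log\pi$ be the Riemann–Siegel theta function (continuous, $\vartheta(0)=0$). Let $\omega\colon\mathbb R\to\mathbb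 R$ be the real analytic function such that $\mathcal R(\frac12+it)=e^{-i\omega(t)}g(t)$ for all $t\in\mathbb R$ with some real analytic $g\colon\mathbb R\to\mathbb R$, and $\omega(0)=-\arg\mathcal R(\frac12)$ (principal argument). Then $\omega$, $u$ and $d$ are well defined (there is exactly one such $\omega$; for every real $x$ both sums converge absolutely, and as functions of $x$ they are integrable on bounded intervals), and there is a real constant $B$ such that for all $t\in\mathbb R$ $$\omega(t)=\vartheta(t)+u(t)+d(t)-Bt+\arctan(2t)+\omega(0).$$ -/

import Mathlib

namespace RiemannAux

noncomputable section

open Complex MeasureTheory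

/-- The integrand `x ^ (-s) e ^ (π i x ^ 2) / (e ^ (π i x) - e ^ (-π i x))` of the auxiliary
function, with the principal branch of the power. -/
def integrand (s x : ℂ) : ℂ :=
  x ^ (-s) * exp (Real.pi * I * x ^ 2) / (exp (Real.pi * I * x) - exp (-(Real.pi * I * x)))

/-- The line of slope one through `1 / 2`; it avoids the branch cut of the principal power. -/
def line (r : ℝ) : ℂ := 1 / 2 + r * exp (Real.pi / 4 * I)

/-- Riemann's auxiliary function: the integral of `integrand s` along `0 ↙ 1`, that is, along
`line` run through from upper right to lower left (whence the minus sign). -/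
def auxR (s : ℂ) : ℂ := -∫ r : ℝ, integrand s (line r) * exp (Real.pi / 4 * I)

/-- `F s = s π ^ (-s / 2) Γ(s / 2) R(s)`. The values at `0, -2, -4, …` are irrelevant: only the
orders of vanishing of the (meromorphic) function `F` are used below. -/
def auxF (s : ℂ) : ℂ := s * (Real.pi : ℂ) ^ (-s / 2) * Gamma (s / 2) * auxR s

/-- The multiplicity of `ρ` as a zero of `F`, i.e. as a nontrivial zero of `R`. -/
def mult (ρ : ℂ) : ℤ := (meromorphicOrderAt auxF ρ).untop₀

/-- The nontrivial zeros `β + iγ` of `R` with `γ > 0`. -/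
def upperZeros : Set ℂ := {ρ | 0 < mult ρ ∧ 0 < ρ.im}

/-- The nontrivial zeros `β + iγ` of `R` with `γ ≤ 0`. -/
def lowerZeros : Set ℂ := {ρ | 0 < mult ρ ∧ ρ.im ≤ 0}

/-- `(β - 1/2) / ((β - 1/2) ^ 2 + (γ - x) ^ 2)` for `ρ = β + iγ`. -/
def kern (ρ : ℂ) (x : ℝ) : ℝ := (ρ.re - 1 / 2) / ((ρ.re - 1 / 2) ^ 2 + (ρ.im - x) ^ 2)

/-- The contribution to `u'(x)` of a zero `ρ` with `γ > 0`, counted with multiplicity. -/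
def upTerm (x : ℝ) (ρ : upperZeros) : ℝ := mult ρ * kern ρ x

/-- The contribution to `d'(x)` of a zero `ρ` with `γ ≤ 0`, counted with multiplicity. -/
def downTerm (x : ℝ) (ρ : lowerZeros) : ℝ := mult ρ * (kern ρ x - kern ρ 0)

/-- The function `u`. -/
def u (t : ℝ) : ℝ := ∫ x in (0 : ℝ)..t, ∑' ρ, upTerm x ρ

/-- The function `d`. -/
def d (t : ℝ) : ℝ := ∫ x in (0 : ℝ)..t, ∑' ρ, downTerm x ρ

/-- The Riemann–Siegel theta function `Im log Γ(1/4 + it/2) - (t/2) log π`, where `log Γ` is the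
branch on the right half plane that is real on the positive axis. -/
def theta (t : ℝ) : ℝ :=
  (∫ x in (0 : ℝ)..t, (digamma (1 / 4 + x / 2 * I)).re / 2) - t / 2 * Real.log Real.pi

/-- `ω` is minus the phase of `t ↦ R(1/2 + it)`, normalized at `t = 0` by the principal argument. -/
def IsPhase (ω : ℝ → ℝ) : Prop :=
  AnalyticOnNhd ℝ ω Set.univ ∧ ω 0 = -arg (auxR (1 / 2)) ∧
    ∃ g : ℝ → ℝ, AnalyticOnNhd ℝ g Set.univ ∧
      ∀ t : ℝ, auxR (1 / 2 + t * I) = exp (-(I * ω t)) * g t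

theorem gamma_arg_ne (x : ℝ) (m : ℕ) : (1 / 4 + x / 2 * I : ℂ) ≠ -m := by
  intro h
  have := congrArg re h
  simp at this
  have hm : (0 : ℝ) ≤ m := m.cast_nonneg
  linarith

theorem continuous_digamma_line : Continuous fun x : ℝ => digamma (1 / 4 + x / 2 * I) := by
  rw [continuous_iff_continuousAt]
  intro x
  have hpos : (1 / 4 + x / 2 * I : ℂ) ∈ {s : ℂ | 0 < s.re} := by simp
  have hopen : IsOpen {s : ℂ | 0 < s.re} := isOpen_lt continuous_const continuous_re
  have hne : ∀ s ∈ {s : ℂ | 0 < s.re}, ∀ m : ℕ, s ≠ -m := by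
    intro s hs m h
    have := congrArg re h
    simp at this
    have hm : (0 : ℝ) ≤ m := m.cast_nonneg
    have hs' : 0 < s.re := hs
    linarith
  have hd : DifferentiableOn ℂ Gamma {s : ℂ | 0 < s.re} := fun s hs =>
    (differentiableAt_Gamma s (hne s hs)).differentiableWithinAt
  have hc : ContinuousAt digamma (1 / 4 + x / 2 * I : ℂ) := by
    rw [digamma_def]
    have h1 := (hd.deriv hopen).continuousOn.continuousAt (hopen.mem_nhds hpos)
    have h2 := hd.continuousOn.continuousAt (hopen.mem_nhds hpos)
    exact h1.div h2 (Gamma_ne_zero (hne _ hpos))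
  exact ContinuousAt.comp (f := fun x : ℝ => (1 / 4 + x / 2 * I : ℂ)) hc (by fun_prop)

/-- `theta` is the continuous argument of `π ^ (-it/2) Γ(1/4 + it/2)` that vanishes at `0`. -/
theorem theta_spec : Continuous theta ∧ theta 0 = 0 ∧ ∀ t : ℝ,
    (Real.pi : ℂ) ^ (-(t / 2 * I)) * Gamma (1 / 4 + t / 2 * I) =
      ‖Gamma (1 / 4 + t / 2 * I)‖ * exp (theta t * I) := by
  have hcont := continuous_digamma_line
  have hre : Continuous fun x : ℝ => (digamma (1 / 4 + x / 2 * I)).re / 2 := by fun_prop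
  have him : Continuous fun x : ℝ => (digamma (1 / 4 + x / 2 * I)).im / 2 := by fun_prop
  have hth : ∀ t : ℝ, HasDerivAt theta ((digamma (1 / 4 + t / 2 * I)).re / 2
      - 1 / 2 * Real.log Real.pi) t := by
    intro t
    have h1 := intervalIntegral.integral_hasDerivAt_right (hre.intervalIntegrable 0 t)
      (hre.stronglyMeasurableAtFilter _ _) hre.continuousAt
    have h2 := ((hasDerivAt_id t).div_const 2).mul_const (Real.log Real.pi)
    exact h1.sub h2
  have hL : ∀ t : ℝ, HasDerivAt (fun t : ℝ => ∫ x in (0 : ℝ)..t,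
      (digamma (1 / 4 + x / 2 * I)).im / 2) ((digamma (1 / 4 + t / 2 * I)).im / 2) t :=
    fun t => intervalIntegral.integral_hasDerivAt_right (him.intervalIntegrable 0 t)
      (him.stronglyMeasurableAtFilter _ _) him.continuousAt
  refine ⟨continuous_iff_continuousAt.2 fun t => (hth t).continuousAt, by simp [theta], ?_⟩
  set L : ℝ → ℝ := fun t : ℝ => ∫ x in (0 : ℝ)..t, (digamma (1 / 4 + x / 2 * I)).im / 2 with hLdef
  have hpi : (Real.pi : ℂ) ≠ 0 := ofReal_ne_zero.2 Real.pi_ne_zero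
  have hpow : ∀ t : ℝ, (Real.pi : ℂ) ^ (-(t / 2 * I)) =
      exp (((-(t / 2 * Real.log Real.pi) : ℝ) : ℂ) * I) := by
    intro t
    rw [cpow_def_of_ne_zero hpi, ← ofReal_log Real.pi_pos.le]
    congr 1
    push_cast
    ring
  have key : ∀ t : ℝ, HasDerivAt (fun t : ℝ => Gamma (1 / 4 + t / 2 * I) *
      exp (-(t / 2 * Real.log Real.pi) * I + L t - theta t * I)) 0 t := by
    intro t
    have e1 : HasDerivAt (fun t : ℝ => (1 / 4 + t / 2 * I : ℂ)) (1 / 2 * I) t :=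
      (((hasDerivAt_id t).ofReal_comp.div_const 2).mul_const I).const_add _
    have e2 : HasDerivAt (fun t : ℝ => Gamma (1 / 4 + t / 2 * I))
        (deriv Gamma (1 / 4 + t / 2 * I) * (1 / 2 * I)) t :=
      (differentiableAt_Gamma _ (gamma_arg_ne t)).hasDerivAt.comp t e1
    have e3 : HasDerivAt (fun t : ℝ => (-(t / 2 * Real.log Real.pi) * I + L t - theta t * I : ℂ))
        (-(1 / 2 * Real.log Real.pi) * I + ((digamma (1 / 4 + t / 2 * I)).im / 2 : ℝ) -
          ((digamma (1 / 4 + t / 2 * I)).re / 2 - 1 / 2 * Real.log Real.pi : ℝ) * I) t :=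
      (((((hasDerivAt_id t).ofReal_comp.div_const 2).mul_const _).neg.mul_const I).add
        (hL t).ofReal_comp).sub ((hth t).ofReal_comp.mul_const I)
    refine (e2.mul e3.cexp).congr_deriv ?_
    have hG := Gamma_ne_zero (gamma_arg_ne t)
    have hd : deriv Gamma (1 / 4 + t / 2 * I) =
        Gamma (1 / 4 + t / 2 * I) * digamma (1 / 4 + t / 2 * I) := by
      rw [digamma_def, logDeriv_apply, mul_div_cancel₀ _ hG]
    rw [hd]
    generalize digamma (1 / 4 + t / 2 * I) = z
    conv_lhs => rw [← re_add_im z]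
    push_cast
    simp only [add_re, ofReal_re, mul_re, I_re, ofReal_im, I_im, add_im, mul_im]
    ring_nf
    rw [I_sq]
    ring
  intro t
  have hc := is_const_of_deriv_eq_zero (fun t => (key t).differentiableAt)
    (fun t => (key t).deriv) t 0
  have h0 : L 0 = 0 := by simp [hLdef]
  have h0' : theta 0 = 0 := by simp [theta]
  have hq : (1 / 4 : ℂ) = ((1 / 4 : ℝ) : ℂ) := by push_cast; rfl
  simp only [h0, h0', ofReal_zero, zero_div, zero_mul, neg_zero, add_zero, sub_zero, exp_zero,
    mul_one] at hc
  have hG0 : Gamma (1 / 4 : ℂ) = (Real.Gamma (1 / 4) : ℂ) := by rw [hq, Gamma_ofReal]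
  have hpos : 0 < Real.Gamma (1 / 4) := Real.Gamma_pos_of_pos (by norm_num)
  have main : (Real.pi : ℂ) ^ (-(t / 2 * I)) * Gamma (1 / 4 + t / 2 * I) =
      ((Real.Gamma (1 / 4) * Real.exp (-L t) : ℝ) : ℂ) * exp (theta t * I) := by
    rw [hpow, ofReal_mul, ← hG0, ← hc, ofReal_exp, mul_comm (exp _), mul_assoc, mul_assoc,
      ← exp_add, ← exp_add]
    congr 2
    push_cast
    ring
  have hn : ‖Gamma (1 / 4 + t / 2 * I)‖ = Real.Gamma (1 / 4) * Real.exp (-L t) := by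
    have := congrArg norm main
    rwa [hpow, norm_mul, norm_mul, norm_exp_ofReal_mul_I, norm_exp_ofReal_mul_I, one_mul, mul_one,
      norm_real, Real.norm_of_nonneg (mul_nonneg hpos.le (Real.exp_pos _).le)] at this
  rw [main, hn]

end

end RiemannAux

namespace RiemannAux
noncomputable section
open Complex MeasureTheory Set Filter Topology

/-! The identity is the integrated real part of a logarithmic derivative. For Re s < -1 the path of
R may pass through 0. Folding it there and inserting the partial fractions of the cosecant turns R
into a Mellin transform that can be evaluated term by term. The result, continued to all s
(`mul_auxR_eq`), is s R(s) = π^(s/2) Γ(s/2)⁻¹ e^(πis/4) G(s), where G = `auxG` is entire: G(s) = -1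
- is ∫₀^∞ (1 - iy)^(s/2-1) ∑ (-1)^n e^(-πn²y) dy. The nontrivial zeros of R are therefore exactly
the zeros of G, with multiplicity (`mult_eq`).

Three properties of G carry the proof. It grows at most like exp(C|s|^(3/2)) (`norm_auxG_le`), so ∑
m/|ρ - 1/2|² converges and G'/G(s) - G'/G(1/2) = ∑ m (1/(s - ρ) - 1/(1/2 - ρ))
(`logDeriv_sub_eq_tsum`). It is polynomially bounded for Re s ≤ -2 (`norm_auxG_le_of_re_le`), so its
zeros there satisfy the Blaschke condition of a half plane (`summable_order_blaschke`). It has no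
zeros with large real part and nonnegative imaginary part (`exists_auxG_ne_zero`). The last two
facts give ∑ m |β - 1/2|/|ρ - 1/2|² < ∞ over γ > 0, so the counterterms at x = 0 can be dropped from
the sum for u, though they stay in the sum for d.

Off the zeros on the critical line, ω' = -Re R'/R(1/2 + it). The factorization splits this into
θ'(t), the derivative of arctan(2t) (from the factor s) and -Re G'/G. The last is a sum over zeros,
because Re 1/(1/2 + ix - ρ) is minus the kernel in u and d. Continuity carries the equality of
derivatives across the zeros, and both sides agree at t = 0. The constant is B = Re G'/G(1/2) +
∑_{γ>0} m (β - 1/2)/|ρ - 1/2|². -/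

/-! ### Integrals depending holomorphically on a parameter -/

/-- A parameter integral `∫ exp (s λ) g` is holomorphic where a little more than absolute
convergence holds. -/
theorem differentiableAt_integral_exp {μ : Measure ℝ} {l g : ℝ → ℂ}
    (hl : AEStronglyMeasurable l μ) (hg : AEStronglyMeasurable g μ) {s₀ : ℂ} {ε : ℝ} (hε : 0 < ε)
    (h : Integrable (fun y => Real.exp ((s₀ * l y).re + ε * ‖l y‖) * ‖g y‖) μ) :
    DifferentiableAt ℂ (fun s : ℂ => ∫ y, exp (s * l y) * g y ∂μ) s₀ := by
  have hm : ∀ s : ℂ, AEStronglyMeasurable (fun y => exp (s * l y) * g y) μ := fun s =>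
    (continuous_exp.comp_aestronglyMeasurable (hl.const_mul s)).mul hg
  have hb : ∀ s : ℂ, ∀ y, ‖s - s₀‖ ≤ ε / 2 →
      ‖exp (s * l y) * g y‖ ≤ Real.exp ((s₀ * l y).re + ε / 2 * ‖l y‖) * ‖g y‖ := by
    intro s y hs
    rw [norm_mul, norm_exp]
    gcongr
    have : s * l y = s₀ * l y + (s - s₀) * l y := by ring
    rw [this, add_re]
    gcongr
    refine (re_le_norm _).trans ?_
    rw [norm_mul]
    gcongr
  refine (hasDerivAt_integral_of_dominated_loc_of_deriv_le
    (F' := fun s y => l y * (exp (s * l y) * g y))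
    (bound := fun y => 2 / ε * (Real.exp ((s₀ * l y).re + ε * ‖l y‖) * ‖g y‖))
    (Metric.ball_mem_nhds s₀ (half_pos hε)) (Eventually.of_forall hm) ?_ (hl.mul (hm s₀)) ?_
    (h.const_mul _) ?_).2.differentiableAt
  · refine h.mono' (hm s₀) (Eventually.of_forall fun y => (hb s₀ y (by simp; positivity)).trans ?_)
    gcongr
    linarith
  · refine Eventually.of_forall fun y s hs => ?_
    rw [Metric.mem_ball, dist_eq_norm] at hs
    rw [norm_mul]
    -- One half of the margin ε pays for |s - s₀|, the other half for the factor `l y` brought down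
    -- by differentiation.
    have h1 : ‖l y‖ ≤ 2 / ε * Real.exp (ε / 2 * ‖l y‖) := by
      rw [div_mul_eq_mul_div, le_div_iff₀ hε]
      linarith [Real.add_one_le_exp (ε / 2 * ‖l y‖)]
    calc ‖l y‖ * ‖exp (s * l y) * g y‖ ≤ (2 / ε * Real.exp (ε / 2 * ‖l y‖)) *
          (Real.exp ((s₀ * l y).re + ε / 2 * ‖l y‖) * ‖g y‖) := by
          gcongr
          exact hb s y hs.le
      _ = 2 / ε * ((Real.exp (ε / 2 * ‖l y‖) * Real.exp ((s₀ * l y).re + ε / 2 * ‖l y‖)) *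
          ‖g y‖) := by ring
      _ = _ := by rw [← Real.exp_add]; ring_nf
  · refine Eventually.of_forall fun y s _ => ?_
    have := (((hasDerivAt_id s).mul_const (l y)).cexp).mul_const (g y)
    simp only [id, one_mul] at this
    exact this.congr_deriv (by ring)

/-- A parameter integral `∫ exp (s λ) g` is entire when all exponential moments are finite. -/
theorem differentiable_integral_exp {μ : Measure ℝ} {l g : ℝ → ℂ}
    (hl : AEStronglyMeasurable l μ) (hg : AEStronglyMeasurable g μ)
    (h : ∀ c : ℝ, Integrable (fun y => Real.exp (c * ‖l y‖) * ‖g y‖) μ) :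
    Differentiable ℂ fun s : ℂ => ∫ y, exp (s * l y) * g y ∂μ := by
  intro s₀
  refine differentiableAt_integral_exp hl hg one_pos ((h (‖s₀‖ + 1)).mono' ?_ ?_)
  · have h1 : AEStronglyMeasurable (fun y => (s₀ * l y).re + 1 * ‖l y‖) μ :=
      (continuous_re.comp_aestronglyMeasurable (hl.const_mul s₀)).add (hl.norm.const_mul 1)
    exact (Real.continuous_exp.comp_aestronglyMeasurable h1).mul hg.norm
  · refine Eventually.of_forall fun y => ?_
    rw [Real.norm_of_nonneg (by positivity), add_mul]
    gcongr
    exact (re_le_norm _).trans (norm_mul _ _).le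

/-! ### The path of integration and the entire function R -/

/-- The unit vector of slope one. -/
abbrev diag : ℂ := exp (Real.pi / 4 * I)

theorem diag_eq : diag = (√2 / 2 : ℝ) + (√2 / 2 : ℝ) * I := by
  have : (Real.pi / 4 * I : ℂ) = ((Real.pi / 4 : ℝ) : ℂ) * I := by push_cast; rfl
  rw [diag, this, exp_mul_I, ← ofReal_cos, ← ofReal_sin, Real.cos_pi_div_four,
    Real.sin_pi_div_four]

theorem diag_sq : diag ^ 2 = I := by
  rw [diag, ← exp_nat_mul]
  convert exp_pi_div_two_mul_I using 2
  push_cast; ring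

theorem diag_re : diag.re = √2 / 2 := by rw [diag_eq]; simp
theorem diag_im : diag.im = √2 / 2 := by rw [diag_eq]; simp
theorem norm_diag : ‖diag‖ = 1 := by
  have : (Real.pi / 4 * I : ℂ) = ((Real.pi / 4 : ℝ) : ℂ) * I := by push_cast; rfl
  rw [diag, this, norm_exp_ofReal_mul_I]

theorem diag_ne_zero : diag ≠ 0 := exp_ne_zero _

theorem line_re (r : ℝ) : (line r).re = 1 / 2 + r * (√2 / 2) := by
  simp [line, ← diag_re]
theorem line_im (r : ℝ) : (line r).im = r * (√2 / 2) := by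
  simp [line, ← diag_im]

/-- The denominator of the integrand. -/
theorem denom_eq (x : ℂ) : exp (Real.pi * I * x) - exp (-(Real.pi * I * x)) =
    2 * I * sin (Real.pi * x) := by
  rw [show Real.pi * I * x = (Real.pi * x) * I by ring, sin, neg_mul]
  linear_combination (exp (Real.pi * x * I) - exp (-(Real.pi * x * I))) * I_sq

theorem normSq_sin (a b : ℝ) : ‖sin (a + b * I)‖ ^ 2 = Real.sin a ^ 2 + Real.sinh b ^ 2 := by
  rw [sin_add_mul_I, ← normSq_eq_norm_sq, normSq_apply]
  simp only [← ofReal_sin, ← ofReal_cos, ← ofReal_sinh, ← ofReal_cosh, ← ofReal_mul]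
  simp only [add_re, ofReal_re, mul_re, I_re, ofReal_im, I_im, add_im, mul_im]
  have h1 := Real.sin_sq_add_cos_sq a
  have h2 := Real.cosh_sq b
  ring_nf
  rw [h2, show Real.cos a ^ 2 = 1 - Real.sin a ^ 2 by linarith]
  ring

theorem sq_le_sinh_sq (b : ℝ) : b ^ 2 ≤ Real.sinh b ^ 2 := by
  rw [sq_le_sq]
  rw [Real.abs_sinh]
  exact Real.self_le_sinh_iff.2 (abs_nonneg b)

theorem norm_denom_ge_im (x : ℂ) : 2 * Real.pi * |x.im| ≤
    ‖exp (Real.pi * I * x) - exp (-(Real.pi * I * x))‖ := by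
  rw [denom_eq, norm_mul, norm_mul, norm_I, mul_one, Complex.norm_two, mul_assoc]
  gcongr
  have := normSq_sin (Real.pi * x.re) (Real.pi * x.im)
  have hx : ((Real.pi * x.re : ℝ) : ℂ) + (Real.pi * x.im : ℝ) * I = Real.pi * x := by
    conv_rhs => rw [← re_add_im x]
    push_cast; ring
  rw [hx] at this
  refine abs_le_of_sq_le_sq' ?_ (norm_nonneg _) |>.2
  rw [this, mul_pow, sq_abs, ← mul_pow]
  nlinarith [sq_le_sinh_sq (Real.pi * x.im), sq_nonneg (Real.sin (Real.pi * x.re))]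

/-- Since the line has slope one, with a = πr√2/2 one gets |sin(πx)|² = cos² a + sinh² a ≥ cos² a +
a² ≥ cos² a + sin² a = 1. -/
theorem norm_denom_line (r : ℝ) : 2 ≤
    ‖exp (Real.pi * I * line r) - exp (-(Real.pi * I * line r))‖ := by
  rw [denom_eq, norm_mul, norm_mul, norm_I, mul_one, Complex.norm_two]
  have := normSq_sin (Real.pi * (line r).re) (Real.pi * (line r).im)
  have hx : ((Real.pi * (line r).re : ℝ) : ℂ) + (Real.pi * (line r).im : ℝ) * I = Real.pi * line r := by
    conv_rhs => rw [← re_add_im (line r)]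
    push_cast; ring
  rw [hx, line_re, line_im, mul_add, show Real.pi * (1 / 2) + Real.pi * (r * (√2 / 2)) =
    Real.pi * (r * (√2 / 2)) + Real.pi / 2 by ring, Real.sin_add_pi_div_two] at this
  have h1 := Real.sin_sq_add_cos_sq (Real.pi * (r * (√2 / 2)))
  have h2 := sq_le_sinh_sq (Real.pi * (r * (√2 / 2)))
  have h3 : Real.sin (Real.pi * (r * (√2 / 2))) ^ 2 ≤ (Real.pi * (r * (√2 / 2))) ^ 2 :=
    sq_le_sq.2 Real.abs_sin_le_abs
  have : 1 ≤ ‖sin (Real.pi * line r)‖ := by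
    nlinarith [norm_nonneg (sin (Real.pi * line r))]
  linarith

theorem line_ne_zero (r : ℝ) : line r ≠ 0 := by
  intro h
  have h1 := congrArg re h
  have h2 := congrArg im h
  rw [line_re, zero_re] at h1
  rw [line_im, zero_im] at h2
  linarith

theorem line_mem_slitPlane (r : ℝ) : line r ∈ slitPlane := by
  rw [mem_slitPlane_iff, line_re, line_im]
  by_cases h : r * (√2 / 2) = 0
  · left; rw [h]; norm_num
  · exact Or.inr h

theorem continuous_line : Continuous line := by unfold line; fun_prop

theorem norm_line_le (r : ℝ) : ‖line r‖ ≤ 1 / 2 + |r| := by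
  rw [line]
  refine (norm_add_le _ _).trans ?_
  rw [norm_mul, show exp (Real.pi / 4 * I) = diag from rfl, norm_diag]
  simp

theorem norm_line_ge (r : ℝ) : 1 / 4 ≤ ‖line r‖ := by
  have h : (1 / 4 : ℝ) ^ 2 ≤ ‖line r‖ ^ 2 := by
    rw [← normSq_eq_norm_sq, normSq_apply, line_re, line_im]
    nlinarith [sq_nonneg (4 * (r * (√2 / 2)) + 1)]
  exact abs_le_of_sq_le_sq' h (norm_nonneg _) |>.2

theorem norm_log_line_le (r : ℝ) : ‖log (line r)‖ ≤ |r| + 7 := by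
  have h1 := norm_le_abs_re_add_abs_im (log (line r))
  have h2 : |(log (line r)).im| ≤ Real.pi := by
    rw [log_im]; exact abs_arg_le_pi _
  have h3 : |(log (line r)).re| ≤ |r| + 3 := by
    rw [log_re]
    have hp : 0 < ‖line r‖ := norm_pos_iff.2 (line_ne_zero r)
    have := Real.log_le_sub_one_of_pos hp
    have h4 := Real.one_sub_inv_le_log_of_pos hp
    have h5 : ‖line r‖⁻¹ ≤ 4 := by
      rw [inv_le_comm₀ hp (by norm_num)]
      linarith [norm_line_ge r]
    rw [abs_le]
    constructor
    · linarith [abs_nonneg r]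
    · linarith [norm_line_le r]
  linarith [Real.pi_lt_four]

theorem integrand_line (s : ℂ) (r : ℝ) : integrand s (line r) * exp (Real.pi / 4 * I) =
    exp (s * (-log (line r))) * (integrand 0 (line r) * exp (Real.pi / 4 * I)) := by
  simp only [integrand, neg_zero, cpow_zero]
  rw [cpow_def_of_ne_zero (line_ne_zero r), show log (line r) * -s = s * -log (line r) by ring]
  ring

theorem continuous_integrand_zero_line : Continuous fun r => integrand 0 (line r) * exp (Real.pi / 4 * I) := by
  have := continuous_line
  simp only [integrand, neg_zero, cpow_zero]
  refine (Continuous.div (by fun_prop) (by fun_prop) fun r => ?_).mul continuous_const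
  rw [← norm_pos_iff]
  linarith [norm_denom_line r]

theorem norm_integrand_zero_line (r : ℝ) :
    ‖integrand 0 (line r) * exp (Real.pi / 4 * I)‖ ≤ Real.exp (Real.pi * |r| - Real.pi * r ^ 2) := by
  have h2 : (√2) ^ 2 = (2 : ℝ) := Real.sq_sqrt (by norm_num)
  rw [norm_mul, show exp (Real.pi / 4 * I) = diag from rfl, norm_diag, mul_one, integrand, neg_zero,
    cpow_zero, one_mul, norm_div, norm_exp]
  have h : (Real.pi * I * line r ^ 2).re ≤ Real.pi * |r| - Real.pi * r ^ 2 := by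
    have : (Real.pi * I * line r ^ 2).re = - (Real.pi * (r ^ 2 * (√2 ^ 2 / 2) + r * (√2 / 2))) := by
      simp only [sq, mul_re, ofReal_re, I_re, ofReal_im, I_im, mul_im, line_re, line_im]
      ring
    rw [this, h2]
    have h3 : √2 / 2 ≤ 1 := by nlinarith [Real.sqrt_nonneg 2]
    have h4 : -r * (√2 / 2) ≤ |r| := by
      calc -r * (√2 / 2) ≤ |r| * (√2 / 2) := by gcongr; exact neg_le_abs r
        _ ≤ |r| * 1 := by gcongr
        _ = _ := mul_one _
    nlinarith [Real.pi_pos]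
  calc _ ≤ Real.exp (Real.pi * |r| - Real.pi * r ^ 2) / 1 := by
        gcongr
        linarith [norm_denom_line r]
    _ = _ := div_one _

theorem integrable_exp_abs_sub_sq (A B : ℝ) :
    Integrable fun r : ℝ => Real.exp (A * |r| + B - Real.pi * r ^ 2) := by
  have h := (integrable_exp_neg_mul_sq (b := 1) one_pos).const_mul (Real.exp (A ^ 2 / 4 + B))
  refine h.mono' (by fun_prop) (Eventually.of_forall fun r => ?_)
  rw [Real.norm_eq_abs, Real.abs_exp, ← Real.exp_add]
  gcongr
  nlinarith [Real.pi_gt_three, sq_nonneg (|r| - A / 2), sq_abs r, sq_nonneg r]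

theorem differentiable_auxR : Differentiable ℂ auxR := by
  have hl : Continuous fun r => -log (line r) := by
    refine Continuous.neg ?_
    exact continuous_line.clog fun r => line_mem_slitPlane r
  have := (differentiable_integral_exp (μ := volume) hl.aestronglyMeasurable
    continuous_integrand_zero_line.aestronglyMeasurable ?_).neg
  · have he : auxR = -fun s : ℂ => ∫ r : ℝ, exp (s * -log (line r)) *
        (integrand 0 (line r) * exp (Real.pi / 4 * I)) := by
      ext s
      exact congrArg Neg.neg (integral_congr_ae (Eventually.of_forall fun r => integrand_line s r))
    rwa [he]
  · intro c
    refine (integrable_exp_abs_sub_sq (|c| + Real.pi) (|c| * 7)).mono' ?_ (Eventually.of_forall fun r => ?_)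
    · have := continuous_integrand_zero_line
      exact (by fun_prop : Continuous _).aestronglyMeasurable
    · rw [Real.norm_of_nonneg (by positivity), norm_neg]
      calc _ ≤ Real.exp (|c| * (|r| + 7)) * Real.exp (Real.pi * |r| - Real.pi * r ^ 2) := by
            gcongr
            · exact le_abs_self c
            · exact norm_log_line_le r
            · exact norm_integrand_zero_line r
        _ = _ := by rw [← Real.exp_add]; ring_nf

theorem integrable_integrand_line (s : ℂ) : Integrable fun r => integrand s (line r) := by
  have h1 : Integrable fun r => integrand s (line r) * exp (Real.pi / 4 * I) := by
    simp_rw [integrand_line s]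
    have hl : Continuous fun r => -log (line r) := by
      refine Continuous.neg ?_
      exact continuous_line.clog fun r => line_mem_slitPlane r
    have := continuous_integrand_zero_line
    refine (integrable_exp_abs_sub_sq (‖s‖ + Real.pi) (‖s‖ * 7)).mono' ?_ (Eventually.of_forall fun r => ?_)
    · exact (by fun_prop : Continuous _).aestronglyMeasurable
    · rw [norm_mul, norm_exp]
      calc _ ≤ Real.exp (‖s‖ * (|r| + 7)) * Real.exp (Real.pi * |r| - Real.pi * r ^ 2) := by
            gcongr
            · refine (re_le_norm _).trans ?_
              rw [norm_mul, norm_neg]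
              gcongr
              exact norm_log_line_le r
            · exact norm_integrand_zero_line r
        _ = _ := by rw [← Real.exp_add]; ring_nf
  refine (h1.mul_const (exp (Real.pi / 4 * I))⁻¹).congr (Eventually.of_forall fun r => ?_)
  simp

/-! ### Moving the path to the line through 0 -/

/-- Horizontal contour shift in a strip. -/
theorem integral_add_mul_I_eq {h : ℂ → ℂ} {a b : ℝ} (hab : a ≤ b)
    (hc : ContinuousOn h {z | z.im ∈ Icc a b}) (hd : DifferentiableOn ℂ h {z | z.im ∈ Ioo a b})
    {β : ℝ → ℝ} (hβ : ∀ u v : ℝ, v ∈ Icc a b → 1 ≤ |u| → ‖h (u + v * I)‖ ≤ β |u|)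
    (hβ0 : Tendsto β atTop (𝓝 0))
    (ha : Integrable fun u : ℝ => h (u + a * I)) (hb : Integrable fun u : ℝ => h (u + b * I)) :
    ∫ u : ℝ, h (u + a * I) = ∫ u : ℝ, h (u + b * I) := by
  have hrect : ∀ X : ℝ, 1 ≤ X → ‖(∫ u in (-X)..X, h (u + a * I)) - ∫ u in (-X)..X, h (u + b * I)‖ ≤
      2 * (β X * (b - a)) := by
    intro X hX
    have hX0 : -X ≤ X := by linarith
    have := integral_boundary_rect_eq_zero_of_continuousOn_of_differentiableOn h
      (-X + a * I) (X + b * I) ?_ ?_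
    · have e1 : ∀ x : ℝ, |x| = X → ‖I • ∫ v in a..b, h (x + v * I)‖ ≤ β X * (b - a) := by
        intro x hx
        rw [norm_smul, norm_I, one_mul]
        refine (intervalIntegral.norm_integral_le_of_norm_le_const (C := β X) fun v hv => ?_).trans_eq
          (by rw [abs_of_nonneg (by linarith)])
        rw [uIoc_of_le hab] at hv
        rw [← hx]
        exact hβ x v ⟨hv.1.le, hv.2⟩ (by linarith)
      have e2 := e1 X (abs_of_nonneg (by linarith))
      have e3 := e1 (-X) (by rw [abs_neg, abs_of_nonneg (by linarith)])
      simp at this e2 e3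
      have e4 : (∫ u in (-X)..X, h (u + a * I)) - ∫ u in (-X)..X, h (u + b * I) =
        I * (∫ v in a..b, h (-X + v * I)) - I * ∫ v in a..b, h (X + v * I) := by
        linear_combination this
      rw [e4]
      refine (norm_sub_le _ _).trans ?_
      rw [norm_mul, norm_mul, norm_I, one_mul, one_mul]
      linarith
    · refine hc.mono fun z hz => ?_
      rw [mem_reProdIm] at hz
      simpa [uIcc_of_le hab] using hz.2
    · refine hd.mono fun z hz => ?_
      rw [mem_reProdIm] at hz
      simpa [hab] using hz.2
  have t1 := intervalIntegral_tendsto_integral ha tendsto_neg_atTop_atBot tendsto_id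
  have t2 := intervalIntegral_tendsto_integral hb tendsto_neg_atTop_atBot tendsto_id
  have t3 := t1.sub t2
  have t4 : Tendsto (fun X : ℝ => (∫ u in (-X)..X, h (u + a * I)) - ∫ u in (-X)..X, h (u + b * I)) atTop (𝓝 0) := by
    refine squeeze_zero_norm' ((eventually_ge_atTop 1).mono fun X hX => hrect X hX) ?_
    simpa using (hβ0.mul_const (b - a)).const_mul 2
  exact sub_eq_zero.1 (tendsto_nhds_unique t3 t4)

/-- The line `line`, in coordinates along `diag`. -/
theorem line_eq_diag_mul (r : ℝ) :
    line r = diag * (((r + √2 / 4 : ℝ) : ℂ) + ((-(√2 / 4) : ℝ) : ℂ) * I) := by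
  have h2 : ((√2 : ℝ) : ℂ) ^ 2 = 2 := by
    rw [← ofReal_pow, Real.sq_sqrt (by norm_num)]; simp
  rw [line, show exp (Real.pi / 4 * I) = diag from rfl, diag_eq]
  push_cast
  linear_combination (-(1/4 : ℂ)) * h2 + ((√2:ℝ):ℂ) ^ 2 / 8 * I_sq

/-- The strip between the line through `0` and the line through `1 / 2`. -/
theorem denom_ne_zero_of_strip {z : ℂ} (hz : z.im ∈ Icc (-(√2 / 4)) 0) (h0 : z ≠ 0) :
    exp (Real.pi * I * (diag * z)) - exp (-(Real.pi * I * (diag * z))) ≠ 0 := by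
  rw [denom_eq]
  simp only [ne_eq, mul_eq_zero, OfNat.ofNat_ne_zero, I_ne_zero, or_self, false_or]
  rw [sin_eq_zero_iff]
  rintro ⟨k, hk⟩
  have hpi : (Real.pi : ℂ) ≠ 0 := ofReal_ne_zero.2 Real.pi_ne_zero
  have hk' : diag * z = k := by
    rw [mul_comm (k : ℂ)] at hk
    exact mul_left_cancel₀ hpi hk
  have h1 := congrArg re hk'
  have h2 := congrArg im hk'
  simp only [mul_re, mul_im, diag_re, diag_im, intCast_re, intCast_im] at h1 h2
  have hs : (0 : ℝ) < √2 := by positivity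
  have hs2 : √2 ^ 2 = (2 : ℝ) := Real.sq_sqrt (by norm_num)
  have h3 : z.im = -z.re := by
    have : √2 / 2 * (z.im + z.re) = 0 := by linarith
    have := (mul_eq_zero.1 this).resolve_left (by positivity)
    linarith
  have h4 : (k : ℝ) = -√2 * z.im := by rw [← h1, h3]; ring
  have hk0 : (0 : ℝ) ≤ k := by rw [h4]; nlinarith [hz.2]
  have hk1 : (k : ℝ) < 1 := by rw [h4]; nlinarith [hz.1]
  have : k = 0 := by
    have a1 : (0 : ℤ) ≤ k := by exact_mod_cast hk0
    have a2 : k < (1 : ℤ) := by exact_mod_cast hk1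
    omega
  rw [this, Int.cast_zero] at hk'
  exact h0 ((mul_eq_zero.1 hk').resolve_left diag_ne_zero)

/-- The closed lower half plane, rotated by π/4, meets the nonpositive real axis only at 0. -/
theorem diag_mul_mem_slitPlane {z : ℂ} (hz : z.im ≤ 0) (h0 : z ≠ 0) : diag * z ∈ slitPlane := by
  rw [mem_slitPlane_iff]
  by_contra! h
  have h1 := h.1
  have h2 := h.2
  simp only [mul_re, mul_im, diag_re, diag_im] at h1 h2
  have hs : (0 : ℝ) < √2 := by positivity
  have h3 : z.im = -z.re := by
    have : √2 / 2 * (z.im + z.re) = 0 := by linarith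
    have := (mul_eq_zero.1 this).resolve_left (by positivity)
    linarith
  rw [h3] at h1
  have : z.re = 0 := by nlinarith
  exact h0 (Complex.ext this (by rw [h3, this]; simp))

theorem norm_cpow_neg_le (s x : ℂ) (hx : x ≠ 0) :
    ‖x ^ (-s)‖ ≤ ‖x‖ ^ (-s.re) * Real.exp (Real.pi * |s.im|) := by
  rw [norm_cpow_of_ne_zero hx, neg_re, neg_im, div_eq_mul_inv, ← Real.exp_neg]
  gcongr
  have : |arg x * s.im| ≤ Real.pi * |s.im| := by
    rw [abs_mul]; gcongr; exact abs_arg_le_pi x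
  linarith [le_abs_self (arg x * s.im)]

theorem norm_exp_diag_sq (z : ℂ) : ‖exp (Real.pi * I * (diag * z) ^ 2)‖ =
    Real.exp (-Real.pi * (z.re ^ 2 - z.im ^ 2)) := by
  rw [norm_exp, mul_pow, diag_sq]
  congr 1
  rw [show Real.pi * I * (I * z ^ 2) = -(Real.pi * z ^ 2 : ℂ) by linear_combination Real.pi * z ^ 2 * I_sq]
  simp [sq]

theorem denom_isBigO : (fun x : ℂ => x) =O[𝓝 0]
    fun x => exp (Real.pi * I * x) - exp (-(Real.pi * I * x)) := by
  have h : HasDerivAt (fun x : ℂ => exp (Real.pi * I * x) - exp (-(Real.pi * I * x)))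
      (2 * Real.pi * I) 0 := by
    have h1 := ((hasDerivAt_id (0 : ℂ)).const_mul (Real.pi * I : ℂ))
    have := h1.cexp.sub h1.neg.cexp
    refine this.congr_deriv ?_
    simp; ring
  have := (h.isTheta_sub (by simp [Real.pi_ne_zero])).isBigO_symm.comp_tendsto
    (k := fun x : ℂ => (x, (0 : ℂ))) (tendsto_id.prodMk tendsto_const_pure)
  simpa [Function.comp_def] using this

theorem integrand_zero_right (s : ℂ) : integrand s 0 = 0 := by
  simp [integrand]

/-- The simple zero of the denominator at 0 is outweighed by the power, which has size |x|^(-Re s)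
with -Re s > 1. The limit 0 agrees with the value that division by zero assigns there. -/
theorem continuousAt_integrand_zero {s : ℂ} (hs : s.re < -1) : ContinuousAt (integrand s) 0 := by
  rw [ContinuousAt, integrand_zero_right]
  obtain ⟨C, hC⟩ := denom_isBigO.bound
  have hexp : Tendsto (fun x : ℂ => ‖exp (Real.pi * I * x ^ 2)‖) (𝓝 0) (𝓝 1) := by
    have : Continuous fun x : ℂ => ‖exp (Real.pi * I * x ^ 2)‖ := by fun_prop
    simpa using this.tendsto 0
  have hpow : Tendsto (fun x : ℂ => ‖x‖ ^ (-s.re - 1)) (𝓝 0) (𝓝 0) := by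
    have : Continuous fun x : ℂ => ‖x‖ ^ (-s.re - 1) := continuous_norm.rpow_const (fun _ => Or.inr (by linarith))
    simpa [Real.zero_rpow (by linarith : -s.re - 1 ≠ 0)] using this.tendsto 0
  refine squeeze_zero_norm' (a := fun x => (Real.exp (Real.pi * |s.im|) * C) * (‖x‖ ^ (-s.re - 1) *
    ‖exp (Real.pi * I * x ^ 2)‖)) ?_ (by simpa using (hpow.mul hexp).const_mul _)
  filter_upwards [hC] with x hx
  by_cases hx0 : x = 0
  · rw [hx0, integrand_zero_right]; simp [Real.zero_rpow (by linarith : -s.re - 1 ≠ 0)]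
  have hxp : 0 < ‖x‖ := norm_pos_iff.2 hx0
  have hden : 0 < ‖exp (Real.pi * I * x) - exp (-(Real.pi * I * x))‖ := by
    rcases (norm_nonneg (exp (Real.pi * I * x) - exp (-(Real.pi * I * x)))).eq_or_lt with h | h
    · rw [← h, mul_zero] at hx; linarith
    · exact h
  rw [integrand, norm_div, norm_mul, div_le_iff₀ hden]
  calc ‖x ^ (-s)‖ * ‖exp (Real.pi * I * x ^ 2)‖
      ≤ (‖x‖ ^ (-s.re) * Real.exp (Real.pi * |s.im|)) * ‖exp (Real.pi * I * x ^ 2)‖ := by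
        gcongr; exact norm_cpow_neg_le s x hx0
    _ = (‖x‖ ^ (-s.re - 1) * ‖x‖ * Real.exp (Real.pi * |s.im|)) * ‖exp (Real.pi * I * x ^ 2)‖ := by
        rw [← Real.rpow_add_one hxp.ne']; ring_nf
    _ ≤ (‖x‖ ^ (-s.re - 1) * (C * ‖exp (Real.pi * I * x) - exp (-(Real.pi * I * x))‖) *
          Real.exp (Real.pi * |s.im|)) * ‖exp (Real.pi * I * x ^ 2)‖ := by gcongr
    _ = _ := by ring

theorem differentiableAt_integrand (s : ℂ) {x : ℂ} (hx : x ∈ slitPlane)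
    (hd : exp (Real.pi * I * x) - exp (-(Real.pi * I * x)) ≠ 0) :
    DifferentiableAt ℂ (integrand s) x := by
  unfold integrand
  refine ((differentiableAt_id.cpow_const hx).mul (by fun_prop)).div (by fun_prop) hd

theorem norm_diag_mul (z : ℂ) : ‖diag * z‖ = ‖z‖ := by rw [norm_mul, norm_diag, one_mul]

/-- This makes the vertical sides of the rectangles negligible. For |u| ≥ 1 and |v| ≤ √2/4 the point
has |Im x| = (√2/2)|u + v| ≥ √2/4, which keeps the denominator above 1. -/
theorem norm_integrand_strip_le {s : ℂ} (hs : s.re < -1) {u v : ℝ} (hv : v ∈ Icc (-(√2 / 4)) 0)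
    (hu : 1 ≤ |u|) : ‖integrand s (diag * (u + v * I))‖ ≤
      Real.exp (Real.pi * |s.im| + Real.pi) * ((|u| + 1) ^ (-s.re) * Real.exp (-Real.pi * |u| ^ 2)) := by
  have hs2 : √2 ^ 2 = (2 : ℝ) := Real.sq_sqrt (by norm_num)
  have hs0 : (0 : ℝ) ≤ √2 := by positivity
  have hs3 : √2 ≤ 3 / 2 := by nlinarith
  have hs4 : 7 / 5 ≤ √2 := by
    exact Real.le_sqrt_of_sq_le (by norm_num)
  have hv1 : |v| ≤ √2 / 4 := abs_le.2 ⟨hv.1, by linarith [hv.2]⟩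
  set z : ℂ := u + v * I with hz
  have hre : z.re = u := by simp [hz]
  have him : z.im = v := by simp [hz]
  have hz0 : z ≠ 0 := by
    intro h; rw [h] at hre; simp at hre; rw [← hre] at hu; simp at hu; linarith
  have hzn : ‖z‖ ≤ |u| + 1 := by
    refine (norm_le_abs_re_add_abs_im z).trans ?_
    rw [hre, him]; linarith
  have hden : 1 ≤ ‖exp (Real.pi * I * (diag * z)) - exp (-(Real.pi * I * (diag * z)))‖ := by
    refine le_trans ?_ (norm_denom_ge_im _)
    have : (diag * z).im = √2 / 2 * (u + v) := by
      rw [mul_im, diag_re, diag_im, hre, him]; ring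
    rw [this, abs_mul, abs_of_nonneg (by positivity)]
    have h1 : |u| - |v| ≤ |u + v| := by
      have := abs_sub_abs_le_abs_sub u (-v)
      simpa using this
    have h2 : 1 / 2 ≤ |u + v| := by linarith
    nlinarith [Real.pi_gt_three, mul_nonneg (by linarith : 0 ≤ √2 - 7 / 5) (by linarith : 0 ≤ |u + v| - 1 / 2)]
  rw [integrand, norm_div, norm_mul, norm_exp_diag_sq, hre, him]
  calc _ ≤ ‖(diag * z) ^ (-s)‖ * Real.exp (-Real.pi * (u ^ 2 - v ^ 2)) / 1 := by gcongr
    _ ≤ ((|u| + 1) ^ (-s.re) * Real.exp (Real.pi * |s.im|)) * Real.exp (-Real.pi * |u| ^ 2 + Real.pi) := by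
        rw [div_one]
        gcongr
        · refine (norm_cpow_neg_le s _ (mul_ne_zero diag_ne_zero hz0)).trans ?_
          rw [norm_diag_mul]
          gcongr
          linarith
        · rw [sq_abs]
          have : v ^ 2 ≤ 1 := by rw [← sq_abs]; nlinarith [abs_nonneg v]
          nlinarith [Real.pi_pos]
    _ = _ := by rw [Real.exp_add, Real.exp_add]; ring

/-- For `Re s < -1` the path of integration can be moved to the line through `0`. -/
theorem auxR_eq_integral_diag {s : ℂ} (hs : s.re < -1) :
    Integrable (fun r : ℝ => integrand s (diag * r)) ∧
    auxR s = -∫ r : ℝ, integrand s (diag * r) * diag := by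
  have hs0 : (0 : ℝ) < √2 := by positivity
  -- In the coordinate z = x / `diag` the original path is Im z = -√2/4 and the line through 0 is Im
  -- z = 0.
  set h : ℂ → ℂ := fun z => integrand s (diag * z) with hh
  have hc0 : ContinuousOn h {z | z.im ∈ Icc (-(√2 / 4)) 0} := by
    intro z hz
    refine ContinuousAt.continuousWithinAt ?_
    by_cases h0 : z = 0
    · have : ContinuousAt (integrand s) (diag * z) := by
        rw [h0, mul_zero]; exact continuousAt_integrand_zero hs
      exact this.comp (by fun_prop)
    · have := (differentiableAt_integrand s (diag_mul_mem_slitPlane hz.2 h0)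
        (denom_ne_zero_of_strip hz h0)).continuousAt
      exact ContinuousAt.comp (g := integrand s) (f := fun z => diag * z) this (by fun_prop)
  have hd : DifferentiableOn ℂ h {z | z.im ∈ Ioo (-(√2 / 4)) 0} := by
    intro z hz
    have h0 : z ≠ 0 := by
      rintro rfl
      simp at hz
    refine DifferentiableAt.differentiableWithinAt ?_
    exact (differentiableAt_integrand s (diag_mul_mem_slitPlane hz.2.le h0)
        (denom_ne_zero_of_strip ⟨hz.1.le, hz.2.le⟩ h0)).comp z (by fun_prop)
  have hβ := fun u v => @norm_integrand_strip_le s hs u v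
  have hline : (fun r : ℝ => integrand s (line r)) =
      fun r => h (((r + √2 / 4 : ℝ) : ℂ) + ((-(√2 / 4) : ℝ) : ℂ) * I) := by
    ext r; rw [line_eq_diag_mul]
  have hia : Integrable fun u : ℝ => h (u + ((-(√2 / 4) : ℝ) : ℂ) * I) := by
    have := integrable_integrand_line s
    rw [hline] at this
    have h2 := this.comp_sub_right (√2 / 4)
    simpa using h2
  have hcont : Continuous fun u : ℝ => h (u + ((0 : ℝ) : ℂ) * I) := by
    refine hc0.comp_continuous (by fun_prop) fun x => ?_
    simp; positivity
  have hexp : ∀ r : ℝ, 0 ≤ r → (r + 1) ^ (-s.re) * Real.exp (-Real.pi * r ^ 2) ≤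
      Real.exp (-s.re * |r| + 0 - Real.pi * r ^ 2) := by
    intro r hr
    rw [abs_of_nonneg hr, show -s.re * r + 0 - Real.pi * r ^ 2 = r * (-s.re) + -Real.pi * r ^ 2 by ring, Real.exp_add,
      Real.exp_mul r (-s.re)]
    have := Real.add_one_le_exp r
    gcongr
    linarith
  have hib : Integrable fun u : ℝ => h (u + ((0 : ℝ) : ℂ) * I) := by
    refine hcont.locallyIntegrable.integrable_of_isBigO_cocompact (g := fun r =>
      Real.exp (-s.re * |r| + 0 - Real.pi * r ^ 2)) ?_ ((integrable_exp_abs_sub_sq _ _).integrableAtFilter _)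
    refine Asymptotics.IsBigO.of_bound (Real.exp (Real.pi * |s.im| + Real.pi)) ?_
    have hco : ∀ᶠ u : ℝ in cocompact ℝ, 1 ≤ |u| := by
      have := (tendsto_norm_cocompact_atTop (E := ℝ)).eventually_ge_atTop 1
      exact this
    filter_upwards [hco] with u hu
    refine (hβ u 0 ⟨by linarith, le_rfl⟩ hu).trans ?_
    rw [Real.norm_eq_abs, Real.abs_exp]
    gcongr
    refine (hexp _ (abs_nonneg u)).trans_eq ?_
    rw [abs_abs, sq_abs]
  have hlim : Tendsto (fun r : ℝ => Real.exp (Real.pi * |s.im| + Real.pi) *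
      ((r + 1) ^ (-s.re) * Real.exp (-Real.pi * r ^ 2))) atTop (𝓝 0) := by
    rw [← mul_zero (Real.exp (Real.pi * |s.im| + Real.pi))]
    refine Tendsto.const_mul _ ?_
    have h1 : Tendsto (fun r : ℝ => Real.exp (r * (-s.re - r))) atTop (𝓝 0) := by
      refine Real.tendsto_exp_atBot.comp (tendsto_id.atTop_mul_atBot₀ ?_)
      exact tendsto_const_nhds.add_atBot tendsto_neg_atTop_atBot
    refine squeeze_zero' ((eventually_ge_atTop 0).mono fun r hr => by positivity)
      ((eventually_ge_atTop 0).mono fun r hr => (hexp r hr).trans ?_) h1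
    rw [abs_of_nonneg hr]
    gcongr
    nlinarith [Real.pi_gt_three]
  have key := integral_add_mul_I_eq (by linarith) hc0 hd (β := fun r => Real.exp (Real.pi * |s.im| + Real.pi) *
      ((r + 1) ^ (-s.re) * Real.exp (-Real.pi * r ^ 2)))
    (fun u v hv hu => hβ u v hv hu) hlim hia hib
  have hsimp : ∀ u : ℝ, h (u + ((0 : ℝ) : ℂ) * I) = integrand s (diag * u) := by
    intro u; simp [hh]
  simp_rw [hsimp] at key hib
  refine ⟨hib, ?_⟩
  rw [auxR, integral_mul_const, integral_mul_const, ← key, hline]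
  congr 2
  exact integral_add_right_eq_self (fun u : ℝ => h (u + ((-(√2 / 4) : ℝ) : ℂ) * I)) (√2 / 4)

theorem log_diag : log diag = Real.pi / 4 * I := by
  rw [diag, log_exp] <;> simp <;> linarith [Real.pi_pos]

theorem log_neg_diag : log (-diag) = -(3 * Real.pi / 4) * I := by
  have : -diag = exp (-(3 * Real.pi / 4) * I) := by
    rw [diag, neg_eq_neg_one_mul, ← exp_neg_pi_mul_I, ← exp_add]
    congr 1; ring
  have him : (-(3 * Real.pi / 4) * I : ℂ).im = -(3 * Real.pi / 4) := by simp
  rw [this, log_exp] <;> rw [him] <;> linarith [Real.pi_pos]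

/-- For `Re s < -1`, `R(s)` as an absolutely convergent Mellin transform. -/
theorem auxR_eq_mellin {s : ℂ} (hs : s.re < -1) :
    auxR s = diag * exp (I * Real.pi * s / 4) * sin (Real.pi * s / 2) *
      ∫ r in Ioi (0 : ℝ), (r : ℂ) ^ (-s) * exp (-(Real.pi * r ^ 2)) / sin (Real.pi * (diag * r)) := by
  obtain ⟨hi, he⟩ := auxR_eq_integral_diag hs
  rw [he, integral_mul_const]
  -- The line is folded at 0. Its halves have arguments π/4 and -3π/4, so x^(-s) contributes
  -- e^(-πis/4) and e^(3πis/4). The odd denominator turns their sum into a difference, which is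
  -- where sin(πs/2) comes from.
  have h1 : ∫ r : ℝ, integrand s (diag * r) =
      ∫ r in Ioi (0 : ℝ), (integrand s (diag * ((-r : ℝ) : ℂ)) + integrand s (diag * r)) := by
    rw [integral_add, integral_comp_neg_Ioi 0 (fun r : ℝ => integrand s (diag * r)), neg_zero,
      intervalIntegral.integral_Iic_add_Ioi hi.integrableOn hi.integrableOn]
    · have := hi.comp_neg
      exact this.integrableOn
    · exact hi.integrableOn
  rw [h1, ← integral_const_mul, ← neg_mul, ← integral_neg, ← integral_mul_const]
  refine setIntegral_congr_fun measurableSet_Ioi fun r hr => ?_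
  have hr' : (0 : ℝ) < r := hr
  have hrc : (r : ℂ) ≠ 0 := ofReal_ne_zero.2 hr'.ne'
  have e1 : (diag * r) ^ (-s) = (r : ℂ) ^ (-s) * exp (-(I * Real.pi * s / 4)) := by
    rw [cpow_def_of_ne_zero (mul_ne_zero diag_ne_zero hrc), cpow_def_of_ne_zero hrc, mul_comm diag,
      log_ofReal_mul hr' diag_ne_zero, log_diag, ← exp_add, ofReal_log hr'.le]
    congr 1; ring
  have e2 : (diag * ((-r : ℝ) : ℂ)) ^ (-s) = (r : ℂ) ^ (-s) * exp (3 * (I * Real.pi * s / 4)) := by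
    have : diag * ((-r : ℝ) : ℂ) = r * (-diag) := by push_cast; ring
    rw [this, cpow_def_of_ne_zero (mul_ne_zero hrc (neg_ne_zero.2 diag_ne_zero)), cpow_def_of_ne_zero hrc,
      log_ofReal_mul hr' (neg_ne_zero.2 diag_ne_zero), log_neg_diag, ← exp_add, ofReal_log hr'.le]
    congr 1; ring
  have e3 : Real.pi * I * (diag * r) ^ 2 = -(Real.pi * r ^ 2 : ℂ) := by
    rw [mul_pow, diag_sq]; linear_combination (Real.pi * r ^ 2 : ℂ) * I_sq
  have e4 : Real.pi * I * (diag * ((-r : ℝ) : ℂ)) ^ 2 = -(Real.pi * r ^ 2 : ℂ) := by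
    rw [mul_pow, diag_sq]; push_cast; linear_combination (Real.pi * r ^ 2 : ℂ) * I_sq
  have e5 : sin (Real.pi * s / 2) = (exp (-(I * Real.pi * s / 4)) ^ 2 - exp (I * Real.pi * s / 4) ^ 2) * I / 2 := by
    rw [sin, ← exp_nat_mul, ← exp_nat_mul]
    have a1 : -(Real.pi * s / 2) * I = (2 : ℕ) * -(I * Real.pi * s / 4) := by push_cast; ring
    have a2 : Real.pi * s / 2 * I = (2 : ℕ) * (I * Real.pi * s / 4) := by push_cast; ring
    rw [a1, a2]
  have e6 : exp (3 * (I * Real.pi * s / 4)) = exp (I * Real.pi * s / 4) ^ 3 := by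
    rw [← exp_nat_mul]; norm_num
  have e7 : exp (I * Real.pi * s / 4) * exp (-(I * Real.pi * s / 4)) = 1 := by
    rw [← exp_add, add_neg_cancel, exp_zero]
  simp only [integrand, denom_eq]
  rw [e1, e2, e3, e4, e5, e6, show (Real.pi : ℂ) * (diag * ((-r : ℝ) : ℂ)) = -(Real.pi * (diag * r)) by
    push_cast; ring, sin_neg]
  set E := exp (I * Real.pi * s / 4)
  set E' := exp (-(I * Real.pi * s / 4))
  have hI : (2 * I : ℂ)⁻¹ = -I / 2 := by rw [mul_inv, inv_I]; ring
  simp only [div_eq_mul_inv, mul_inv, mul_neg, inv_neg, inv_I]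
  set S := (sin (Real.pi * (diag * r)))⁻¹
  set P := (r : ℂ) ^ (-s) 
  set Q := exp (-(Real.pi * r ^ 2 : ℂ))
  linear_combination (diag * P * Q * S * I / 2) * (-E' * e7)

/-! ### Euler's integral with complex scale and the cosecant series -/

theorem integrableOn_rpow_mul_exp_neg {p c : ℝ} (hp : -1 < p) (hc : 0 < c) :
    IntegrableOn (fun t : ℝ => t ^ p * Real.exp (-c * t)) (Ioi 0) := by
  simpa using integrableOn_rpow_mul_exp_neg_mul_rpow hp one_pos hc

/-- Euler's integral with a complex scale. -/
theorem integral_cpow_mul_exp_neg_mul {a w : ℂ} (ha : 0 < a.re) (hw : 0 < w.re) :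
    ∫ t in Ioi (0 : ℝ), (t : ℂ) ^ (a - 1) * exp (-(w * t)) = w ^ (-a) * Gamma a := by
  have hmeas : AEStronglyMeasurable (fun t : ℝ => (t : ℂ) ^ (a - 1)) (volume.restrict (Ioi 0)) := by
    refine ContinuousOn.aestronglyMeasurable (fun t ht => ?_) measurableSet_Ioi
    exact (continuousAt_ofReal_cpow_const t _ (Or.inr (ne_of_gt ht))).continuousWithinAt
  have hdiff : ∀ z : ℂ, 0 < z.re → DifferentiableAt ℂ (fun z : ℂ => ∫ t in Ioi (0 : ℝ),
      exp (z * (-t : ℂ)) * (t : ℂ) ^ (a - 1)) z := by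
    intro z hz
    refine differentiableAt_integral_exp (ε := z.re / 2) (by fun_prop) hmeas (by positivity) ?_
    refine (integrableOn_rpow_mul_exp_neg (p := a.re - 1) (c := z.re / 2) (by linarith)
      (by positivity)).congr_fun (fun t ht => ?_) measurableSet_Ioi
    have ht' : (0 : ℝ) < t := ht
    rw [norm_cpow_eq_rpow_re_of_pos ht', mul_comm]
    simp only [norm_neg, norm_real, Real.norm_of_nonneg ht'.le, sub_re, one_re, mul_neg, neg_re,
      re_mul_ofReal]
    congr 2
    ring
  have hopen : IsOpen {z : ℂ | 0 < z.re} := isOpen_lt continuous_const continuous_re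
  have hpre : IsPreconnected {z : ℂ | 0 < z.re} := (convex_halfSpace_re_gt 0).isPreconnected
  have h1 : AnalyticOnNhd ℂ (fun z : ℂ => ∫ t in Ioi (0 : ℝ), exp (z * (-t : ℂ)) * (t : ℂ) ^ (a - 1))
      {z : ℂ | 0 < z.re} :=
    DifferentiableOn.analyticOnNhd (fun z hz => (hdiff z hz).differentiableWithinAt) hopen
  have h2 : AnalyticOnNhd ℂ (fun z : ℂ => z ^ (-a) * Gamma a) {z : ℂ | 0 < z.re} := by
    refine DifferentiableOn.analyticOnNhd (fun z hz => DifferentiableAt.differentiableWithinAt ?_) hopen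
    exact (differentiableAt_id.cpow_const (Or.inl hz)).mul_const _
  -- Identity theorem: for real scales the formula is the classical one, and the points 1 + 1/(n+1)
  -- accumulate at 1.
  have key := h1.eqOn_of_preconnected_of_frequently_eq h2 hpre (z₀ := 1) (by simp) ?_ hw
  · refine Eq.trans ?_ key
    refine setIntegral_congr_fun measurableSet_Ioi fun t _ => ?_
    rw [mul_comm, mul_neg]
  · have hseq : Tendsto (fun n : ℕ => ((1 + 1 / ((n : ℝ) + 1) : ℝ) : ℂ)) atTop (𝓝[≠] 1) := by
      rw [tendsto_nhdsWithin_iff]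
      constructor
      · have := (tendsto_one_div_add_atTop_nhds_zero_nat (𝕜 := ℝ)).const_add 1
        rw [add_zero] at this
        have h3 := (continuous_ofReal.tendsto (1 : ℝ)).comp this
        simpa [Function.comp_def] using h3
      · refine Eventually.of_forall fun n => ?_
        simp only [mem_compl_iff, mem_singleton_iff]
        have : (0 : ℝ) < 1 / (n + 1) := by positivity
        intro h
        have h4 : (1 + 1 / ((n : ℝ) + 1) : ℝ) = 1 := by exact_mod_cast h
        linarith
    refine hseq.frequently (Eventually.of_forall fun n => ?_).frequently
    have hpos : (0 : ℝ) < 1 + 1 / (n + 1) := by positivity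
    set x : ℝ := 1 + 1 / (n + 1)
    have := integral_cpow_mul_exp_neg_mul_Ioi ha hpos
    rw [one_div, inv_cpow _ _ (by rw [arg_ofReal_of_nonneg hpos.le]; exact Real.pi_pos.ne), ← cpow_neg] at this
    rw [← this]
    refine setIntegral_congr_fun measurableSet_Ioi fun t _ => ?_
    rw [mul_comm, mul_neg]

theorem integrableOn_cpow_mul_exp_neg_mul {a w : ℂ} (ha : 0 < a.re) (hw : 0 < w.re) :
    IntegrableOn (fun t : ℝ => (t : ℂ) ^ (a - 1) * exp (-(w * t))) (Ioi 0) := by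
  refine (integrableOn_rpow_mul_exp_neg (p := a.re - 1) (c := w.re) (by linarith) hw).mono' ?_ ?_
  · refine ContinuousOn.aestronglyMeasurable (fun t ht => ?_) measurableSet_Ioi
    refine ContinuousAt.continuousWithinAt ?_
    exact (continuousAt_ofReal_cpow_const t _ (Or.inr (ne_of_gt ht))).mul (by fun_prop)
  · refine (ae_restrict_iff' measurableSet_Ioi).2 (Eventually.of_forall fun t ht => ?_)
    have ht' : (0 : ℝ) < t := ht
    rw [norm_mul, norm_cpow_eq_rpow_re_of_pos ht', norm_exp]
    simp

/-- The partial fraction expansion of the cosecant. -/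
theorem inv_sin_pi_mul_eq {z : ℂ} (hz : ∀ k : ℤ, z ≠ k) :
    (sin (Real.pi * z))⁻¹ = (1 / z - 2 * z * ∑' n : ℕ, (-1) ^ (n + 1) / (((n : ℂ) + 1) ^ 2 - z ^ 2)) / Real.pi := by
  have hpi : (Real.pi : ℂ) ≠ 0 := ofReal_ne_zero.2 Real.pi_ne_zero
  have hz1 : z ∈ integerComplement := by
    rintro ⟨k, hk⟩; exact hz k hk.symm
  have hz2 : z / 2 ∈ integerComplement := by
    rintro ⟨k, hk⟩
    refine hz (2 * k) ?_
    push_cast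
    linear_combination (-2 : ℂ) * hk
  have hne : ∀ n : ℕ, ((n : ℂ) + 1) ^ 2 - z ^ 2 ≠ 0 := by
    intro n h
    have : ((n : ℂ) + 1 - z) * ((n : ℂ) + 1 + z) = 0 := by linear_combination h
    rcases mul_eq_zero.1 this with h | h
    · exact hz (n + 1) (by push_cast; linear_combination -h)
    · exact hz (-(n + 1)) (by push_cast; linear_combination h)
  have hct : ∀ w : ℂ, w ∈ integerComplement → Summable (fun n : ℕ => cotTerm w n) ∧
      Real.pi * cot (Real.pi * w) = 1 / w + ∑' n, cotTerm w n := by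
    intro w hw
    refine ⟨summable_cotTerm hw, ?_⟩
    have := cot_series_rep' hw
    simp only [cotTerm]
    rw [← this]; ring
  obtain ⟨s1, e1⟩ := hct z hz1
  obtain ⟨s2, e2⟩ := hct _ hz2
  have t1 : ∀ n : ℕ, cotTerm z n = -2 * z / (((n : ℂ) + 1) ^ 2 - z ^ 2) := by
    intro n
    rw [cotTerm_identity hz1, show (z + (n + 1)) * (z - (n + 1)) = -(((n : ℂ) + 1) ^ 2 - z ^ 2) by ring]
    rw [one_div, inv_neg]; ring
  -- Since csc(πz) = cot(πz/2) - cot(πz), the alternating series comes from two cotangent series.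
  -- `cotTerm z n` belongs to the integer n + 1, so the odd indices selected by z/2 are the even
  -- integers.
  have t2 : ∀ n : ℕ, cotTerm (z / 2) n = 2 * cotTerm z (2 * n + 1) := by
    intro n
    rw [cotTerm_identity hz2, cotTerm_identity hz1]
    rw [show (z / 2 + (n + 1)) * (z / 2 - (n + 1)) = ((z + ((2 * n + 1 : ℕ) + 1)) * (z - ((2 * n + 1 : ℕ) + 1))) / 4 by
      push_cast; ring]
    rw [one_div_div]; ring
  have so : Summable fun n : ℕ => cotTerm z (2 * n + 1) :=
    s1.comp_injective fun a b h => by simpa using h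
  have se : Summable fun n : ℕ => cotTerm z (2 * n) :=
    s1.comp_injective fun a b h => by simpa using h
  have hsplit := tsum_even_add_odd se so
  have halt := tsum_even_add_odd (f := fun n : ℕ => (-1) ^ n * cotTerm z n) (by simpa [pow_mul] using se)
    (by simpa [pow_add, pow_mul] using so.neg)
  simp only [pow_add, pow_mul, even_two, Even.neg_pow, one_pow, one_mul, pow_one, neg_mul] at halt
  rw [tsum_neg] at halt
  have hcsc : (sin (Real.pi * z))⁻¹ = cot (Real.pi * (z / 2)) - cot (Real.pi * z) := by
    have hs1 : sin (Real.pi * z) ≠ 0 := by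
      rw [Ne, sin_eq_zero_iff]
      rintro ⟨k, hk⟩
      exact hz k (mul_left_cancel₀ hpi (by rw [hk, mul_comm]))
    have hw : (Real.pi * z : ℂ) = 2 * (Real.pi * (z / 2)) := by ring
    rw [hw] at hs1 ⊢
    set w : ℂ := Real.pi * (z / 2)
    rw [cot, cot, sin_two_mul, cos_two_mul] at *
    have a1 : sin w ≠ 0 := fun h => hs1 (by rw [h]; ring)
    have a2 : cos w ≠ 0 := fun h => hs1 (by rw [h]; ring)
    field_simp
    ring
  have hfin : ∑' n : ℕ, (-1) ^ (n + 1) / (((n : ℂ) + 1) ^ 2 - z ^ 2) * (2 * z) =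
      ∑' n : ℕ, (-1) ^ n * cotTerm z n := by
    refine tsum_congr fun n => ?_
    rw [t1, pow_succ]; ring
  rw [tsum_mul_right] at hfin
  rw [eq_div_iff hpi, hcsc, mul_comm (2 * z), hfin, ← halt, sub_mul, mul_comm _ (Real.pi : ℂ), e2,
    mul_comm _ (Real.pi : ℂ), e1, tsum_congr t2, tsum_mul_left, ← hsplit, one_div_div]
  ring

/-! ### Theta integrals and the expansion of R for Re s < -1 -/

/-- The `n`-th theta integral along the ray spanned by `e`. -/
def thetaInt (e : ℂ) (m : ℝ) (s : ℂ) : ℂ :=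
  e * ∫ y in Ioi (0 : ℝ), exp (-(Real.pi * m * e * y)) * (1 - I * e * y) ^ (s / 2 - 1)

theorem inv_eq_integral_exp {q : ℂ} (hq : 0 < q.re) :
    ∫ y in Ioi (0 : ℝ), exp (-(q * y)) = q⁻¹ := by
  have := integral_exp_mul_complex_Ioi (a := -q) (by simpa using hq) 0
  simp only [neg_mul] at this
  rw [this]
  simp

theorem norm_exp_neg_mul_ofReal (q : ℂ) (y : ℝ) : ‖exp (-(q * y))‖ = Real.exp (-q.re * y) := by
  rw [norm_exp]; simp

/-- Write 1/(m - iv) as πe ∫₀^∞ e^(-π(m-iv)ey) dy, exchange the integrals, and evaluate the inner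
one by Euler's formula. The conditions on `e` make Re((m - iv)e) ≥ min(1, v). The left side does not
involve `e`, so different rays give the same value. -/
theorem integral_theta_kernel {e : ℂ} (h1 : 0 ≤ e.re) (h2 : 0 ≤ e.im) (h3 : 1 ≤ e.re + e.im)
    {m : ℝ} (hm : 1 ≤ m) {s : ℂ} (hs : s.re < 0) :
    ∫ v in Ioi (0 : ℝ), (v : ℂ) ^ (-s / 2) * exp (-(Real.pi * v)) / (m - I * v) =
      (Real.pi : ℂ) ^ (s / 2) * Gamma (1 - s / 2) * thetaInt e m s := by
  have hpi : (Real.pi : ℂ) ≠ 0 := ofReal_ne_zero.2 Real.pi_ne_zero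
  have he0 : e ≠ 0 := by rintro rfl; simp at h3; linarith
  have hq : ∀ v : ℝ, (Real.pi * (m - I * v) * e).re = Real.pi * (m * e.re + v * e.im) := by
    intro v; simp; ring
  have hlow : ∀ v : ℝ, 0 < v → min 1 v ≤ m * e.re + v * e.im := by
    intro v hv
    calc min 1 v ≤ min 1 v * (e.re + e.im) := le_mul_of_one_le_right (by positivity) h3
      _ = min 1 v * e.re + min 1 v * e.im := by ring
      _ ≤ m * e.re + v * e.im := by
        gcongr
        · exact (min_le_left _ _).trans hm
        · exact min_le_right _ _
  have hqpos : ∀ v : ℝ, 0 < v → 0 < (Real.pi * (m - I * v) * e).re := by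
    intro v hv
    rw [hq]
    exact mul_pos Real.pi_pos (lt_of_lt_of_le (by positivity) (hlow v hv))
  set f : ℝ → ℝ → ℂ := fun v y => (v : ℂ) ^ (-s / 2) * exp (-(Real.pi * v)) *
    (Real.pi * e * exp (-(Real.pi * (m - I * v) * e * y))) with hf
  have step1 : ∀ v ∈ Ioi (0 : ℝ), (v : ℂ) ^ (-s / 2) * exp (-(Real.pi * v)) / (m - I * v) =
      ∫ y in Ioi (0 : ℝ), f v y := by
    intro v hv
    simp only [hf]
    rw [integral_const_mul, integral_const_mul, inv_eq_integral_exp (hqpos v hv), mul_inv, mul_inv, div_eq_mul_inv]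
    field_simp
  have hint : Integrable (Function.uncurry f) ((volume.restrict (Ioi (0 : ℝ))).prod (volume.restrict (Ioi (0 : ℝ)))) := by
    have hmeas : AEStronglyMeasurable (Function.uncurry f) ((volume.restrict (Ioi (0 : ℝ))).prod (volume.restrict (Ioi (0 : ℝ)))) := by
      rw [Measure.prod_restrict]
      refine ContinuousOn.aestronglyMeasurable (fun p hp => ?_) (measurableSet_Ioi.prod measurableSet_Ioi)
      have hp1 : (0 : ℝ) < p.1 := hp.1
      refine ContinuousAt.continuousWithinAt ?_
      have hc : ContinuousAt (fun p : ℝ × ℝ => (p.1 : ℂ) ^ (-s / 2)) p :=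
        ContinuousAt.comp (g := fun x : ℝ => (x : ℂ) ^ (-s / 2)) (continuousAt_ofReal_cpow_const p.1 _ (Or.inr hp1.ne')) (by fun_prop)
      exact (hc.mul (by fun_prop)).mul (by fun_prop)
    rw [integrable_prod_iff hmeas]
    constructor
    · refine (ae_restrict_iff' measurableSet_Ioi).2 (Eventually.of_forall fun v hv => ?_)
      have := integrableOn_cpow_mul_exp_neg_mul (a := 1) (by simp) (hqpos v hv)
      simp only [sub_self, cpow_zero, one_mul] at this
      exact (this.const_mul (Real.pi * e)).const_mul ((v : ℂ) ^ (-s / 2) * exp (-(Real.pi * v)))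
    · have hb1 := integrableOn_rpow_mul_exp_neg (p := -s.re / 2) (c := Real.pi) (by linarith) Real.pi_pos
      have hb2 := integrableOn_rpow_mul_exp_neg (p := -s.re / 2 - 1) (c := Real.pi) (by linarith) Real.pi_pos
      refine ((hb1.add hb2).const_mul ‖e‖).mono' hmeas.norm.integral_prod_right' ?_
      refine (ae_restrict_iff' measurableSet_Ioi).2 (Eventually.of_forall fun v hv => ?_)
      have hv' : (0 : ℝ) < v := hv
      have hn : ∀ y : ℝ, ‖Function.uncurry f (v, y)‖ = (v ^ (-s.re / 2) * Real.exp (-Real.pi * v) * (Real.pi * ‖e‖)) *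
          Real.exp (-(Real.pi * (m - I * v) * e).re * y) := by
        intro y
        simp only [hf, Function.uncurry]
        rw [norm_mul, norm_mul, norm_mul, norm_mul, norm_exp_neg_mul_ofReal, norm_exp_neg_mul_ofReal,
          norm_cpow_eq_rpow_re_of_pos hv', norm_real, Real.norm_of_nonneg Real.pi_pos.le]
        simp only [neg_re, div_ofNat_re, ofReal_re]
        ring
      simp_rw [hn]
      have hI : ∫ y in Ioi (0 : ℝ), Real.exp (-(Real.pi * (m - I * v) * e).re * y) =
          (Real.pi * (m * e.re + v * e.im))⁻¹ := by
        have := integral_exp_mul_Ioi (a := -(Real.pi * (m - I * v) * e).re) (by linarith [hqpos v hv]) 0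
        rw [this, hq]; simp
      rw [integral_const_mul, hI, Real.norm_of_nonneg (mul_nonneg (by positivity) (inv_nonneg.2 (by rw [← hq]; exact (hqpos v hv).le)))]
      -- The bound 1 + 1/v is what makes Re s < 0 necessary: v^(-Re s/2 - 1) must be integrable at
      -- 0.
      have hmin : (m * e.re + v * e.im)⁻¹ ≤ 1 + v⁻¹ := by
        have h5 : 0 < min 1 v := by positivity
        calc (m * e.re + v * e.im)⁻¹ ≤ (min 1 v)⁻¹ := by gcongr; exact hlow v hv'
          _ ≤ 1 + v⁻¹ := by
            rcases min_choice 1 v with h | h <;> rw [h]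
            · simp; positivity
            · simp
      simp only [Pi.add_apply]
      rw [Real.rpow_sub_one hv'.ne', mul_inv]
      calc _ = ‖e‖ * ((v ^ (-s.re / 2) * Real.exp (-Real.pi * v)) * (m * e.re + v * e.im)⁻¹) := by
            field_simp
        _ ≤ ‖e‖ * ((v ^ (-s.re / 2) * Real.exp (-Real.pi * v)) * (1 + v⁻¹)) := by gcongr
        _ = _ := by ring
  rw [setIntegral_congr_fun measurableSet_Ioi step1, integral_integral_swap hint, thetaInt, ← mul_assoc, ← integral_const_mul]
  refine setIntegral_congr_fun measurableSet_Ioi fun y hy => ?_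
  have hy' : (0 : ℝ) < y := hy
  have hw : 0 < (1 - I * e * y).re := by
    have : (1 - I * e * y).re = 1 + e.im * y := by simp
    rw [this]; positivity
  have hw' : 0 < (Real.pi * (1 - I * e * y)).re := by
    rw [re_ofReal_mul]; exact mul_pos Real.pi_pos hw
  have hg := integral_cpow_mul_exp_neg_mul (a := 1 - s / 2) (w := Real.pi * (1 - I * e * y)) (by simp; linarith) hw'
  have h6 : ∀ v : ℝ, f v y = (Real.pi * e * exp (-(Real.pi * m * e * y))) *
      ((v : ℂ) ^ (1 - s / 2 - 1) * exp (-(Real.pi * (1 - I * e * y) * v))) := by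
    intro v
    have : exp (-(Real.pi * v : ℂ)) * exp (-(Real.pi * (m - I * v) * e * y)) =
      exp (-(Real.pi * m * e * y)) * exp (-(Real.pi * (1 - I * e * y) * v)) := by
      rw [← exp_add, ← exp_add]; congr 1; ring
    simp only [hf]
    rw [show 1 - s / 2 - 1 = -s / 2 by ring]
    linear_combination (v : ℂ) ^ (-s / 2) * Real.pi * e * this
  simp_rw [h6]
  rw [integral_const_mul, hg]
  have hne : (1 - I * e * y) ≠ 0 := by intro h; rw [h] at hw; simp at hw
  have h7 : (Real.pi * (1 - I * e * y) : ℂ) ^ (-(1 - s / 2)) * Real.pi =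
      (Real.pi : ℂ) ^ (s / 2) * (1 - I * e * y) ^ (s / 2 - 1) := by
    rw [show -(1 - s / 2) = s / 2 - 1 by ring, cpow_def_of_ne_zero (mul_ne_zero hpi hne),
      log_ofReal_mul Real.pi_pos hne, add_mul, exp_add, ofReal_log Real.pi_pos.le,
      ← cpow_def_of_ne_zero hpi, ← cpow_def_of_ne_zero hne, cpow_sub _ _ hpi, cpow_one]
    field_simp
  linear_combination e * exp (-(Real.pi * m * e * y)) * Gamma (1 - s / 2) * h7

theorem integral_Ioi_comp_sq (g : ℝ → ℂ) :
    ∫ r in Ioi (0 : ℝ), (r : ℂ) * g (r ^ 2) = 1 / 2 * ∫ v in Ioi (0 : ℝ), g v := by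
  rw [← integral_comp_rpow_Ioi_of_pos (g := g) (p := 2) two_pos, ← integral_const_mul]
  refine setIntegral_congr_fun measurableSet_Ioi fun r _ => ?_
  norm_num
  ring

theorem ofReal_sq_cpow {r : ℝ} (hr : 0 < r) (w : ℂ) : ((r ^ 2 : ℝ) : ℂ) ^ w = (r : ℂ) ^ (2 * w) := by
  have h1 : ((r ^ 2 : ℝ) : ℂ) ≠ 0 := ofReal_ne_zero.2 (by positivity)
  rw [cpow_def_of_ne_zero h1, cpow_def_of_ne_zero (ofReal_ne_zero.2 hr.ne'), ← ofReal_log (by positivity),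
    ← ofReal_log hr.le, Real.log_pow]
  congr 1
  push_cast; ring

theorem norm_sq_sub_ge (m r : ℝ) : m ≤ ‖(m - I * r ^ 2 : ℂ)‖ := by
  refine le_trans ?_ (re_le_norm _)
  simp [← ofReal_pow]

/-- The expansion of `R` for `Re s < -1`, along either coordinate axis. -/
theorem auxR_eq_tsum_thetaInt {e : ℂ} (h1 : 0 ≤ e.re) (h2 : 0 ≤ e.im) (h3 : 1 ≤ e.re + e.im) {s : ℂ}
    (hs : s.re < -1) : s * auxR s = (Real.pi : ℂ) ^ (s / 2) * (Gamma (s / 2))⁻¹ *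
      (exp (I * Real.pi * s / 4) * (-1 - I * s * ∑' n : ℕ, (-1) ^ (n + 1) * thetaInt e (((n : ℝ) + 1) ^ 2) s)) := by
  have hpi : (Real.pi : ℂ) ≠ 0 := ofReal_ne_zero.2 Real.pi_ne_zero
  have hs0 : s ≠ 0 := by rintro rfl; simp at hs; linarith
  -- the summands
  set q : ℕ → ℝ → ℂ := fun n r => (-1) ^ (n + 1) * ((r : ℂ) ^ (1 - s) * exp (-(Real.pi * r ^ 2)) /
    ((((n : ℝ) + 1) ^ 2 : ℝ) - I * r ^ 2)) with hq
  set p : ℝ → ℂ := fun r => (r : ℂ) ^ (-s - 1) * exp (-(Real.pi * r ^ 2)) with hp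
  have hcpow : ∀ w : ℂ, ∀ r ∈ Ioi (0 : ℝ), ContinuousAt (fun r : ℝ => (r : ℂ) ^ w) r := fun w r hr =>
    continuousAt_ofReal_cpow_const r _ (Or.inr (ne_of_gt hr))
  have hcont : ∀ w : ℂ, AEStronglyMeasurable (fun r : ℝ => (r : ℂ) ^ w * exp (-(Real.pi * r ^ 2)))
      (volume.restrict (Ioi 0)) := fun w =>
    ContinuousOn.aestronglyMeasurable (fun r hr => ((hcpow w r hr).mul (by fun_prop)).continuousWithinAt)
      measurableSet_Ioi
  have hgauss : ∀ w : ℂ, -1 < w.re → IntegrableOn (fun r : ℝ => (r : ℂ) ^ w * exp (-(Real.pi * r ^ 2))) (Ioi 0) := by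
    intro w hw
    have := integrableOn_rpow_mul_exp_neg_mul_rpow (s := w.re) (p := 2) (b := Real.pi) hw two_pos Real.pi_pos
    refine this.mono' (hcont w) ((ae_restrict_iff' measurableSet_Ioi).2 (Eventually.of_forall fun r hr => ?_))
    rw [norm_mul, norm_cpow_eq_rpow_re_of_pos hr, norm_exp, ← ofReal_pow, ← ofReal_mul, ← ofReal_neg, ofReal_re]
    simp
  have hne : ∀ n : ℕ, ∀ r : ℝ, ((((n : ℝ) + 1) ^ 2 : ℝ) - I * r ^ 2 : ℂ) ≠ 0 := by
    intro n r h
    have := norm_sq_sub_ge (((n : ℝ) + 1) ^ 2) r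
    rw [h, norm_zero] at this
    have : (0 : ℝ) < ((n : ℝ) + 1) ^ 2 := by positivity
    linarith
  have hqm : ∀ n, AEStronglyMeasurable (q n) (volume.restrict (Ioi 0)) := by
    intro n
    refine ContinuousOn.aestronglyMeasurable (fun r hr => ?_) measurableSet_Ioi
    exact (continuousAt_const.mul (((hcpow _ r hr).mul (by fun_prop)).div (by fun_prop) (hne n r))).continuousWithinAt
  have hG := (hgauss (1 - s) (by simp; linarith)).norm
  have hqb : ∀ n r, ‖q n r‖ ≤ ‖(r : ℂ) ^ (1 - s) * exp (-(Real.pi * r ^ 2))‖ * (1 / ((n : ℝ) + 1) ^ 2) := by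
    intro n r
    simp only [hq]
    rw [norm_mul, norm_pow, norm_neg, norm_one, one_pow, one_mul, norm_div, ← div_eq_mul_one_div]
    gcongr
    exact norm_sq_sub_ge _ r
  have hqi : ∀ n, IntegrableOn (q n) (Ioi 0) := fun n => (hG.mul_const _).mono' (hqm n) (Eventually.of_forall (hqb n))
  have hsum2 : Summable fun n : ℕ => 1 / ((n : ℝ) + 1) ^ 2 := by
    have := (summable_nat_add_iff 1).2 (Real.summable_one_div_nat_pow.2 one_lt_two)
    simpa using this
  have hqs : Summable fun n => ∫ r in Ioi (0 : ℝ), ‖q n r‖ := by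
    refine Summable.of_nonneg_of_le (fun n => integral_nonneg fun r => norm_nonneg _) (fun n => ?_)
      (hsum2.mul_left (∫ r in Ioi (0 : ℝ), ‖(r : ℂ) ^ (1 - s) * exp (-(Real.pi * r ^ 2))‖))
    rw [← integral_mul_const]
    exact integral_mono (hqi n).norm (hG.mul_const _) (hqb n)
  have hqsum := hasSum_integral_of_summable_integral_norm hqi hqs
  have hqint : ∀ n, ∫ r in Ioi (0 : ℝ), q n r =
      (1 / 2 * ((Real.pi : ℂ) ^ (s / 2) * Gamma (1 - s / 2))) * ((-1) ^ (n + 1) * thetaInt e (((n : ℝ) + 1) ^ 2) s) := by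
    intro n
    have hm : (1 : ℝ) ≤ ((n : ℝ) + 1) ^ 2 := by
      have : (0 : ℝ) ≤ n := n.cast_nonneg
      nlinarith
    have hk := integral_theta_kernel h1 h2 h3 hm (s := s) (by linarith)
    have hc := integral_Ioi_comp_sq (fun v => (v : ℂ) ^ (-s / 2) * exp (-(Real.pi * v)) / ((((n : ℝ) + 1) ^ 2 : ℝ) - I * v))
    rw [hk] at hc
    simp only [hq]
    rw [integral_const_mul]
    have : ∫ r in Ioi (0 : ℝ), (r : ℂ) ^ (1 - s) * exp (-(Real.pi * r ^ 2)) / ((((n : ℝ) + 1) ^ 2 : ℝ) - I * r ^ 2) =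
        ∫ r in Ioi (0 : ℝ), (r : ℂ) * (((r ^ 2 : ℝ) : ℂ) ^ (-s / 2) * exp (-(Real.pi * ((r ^ 2 : ℝ) : ℂ))) /
          ((((n : ℝ) + 1) ^ 2 : ℝ) - I * ((r ^ 2 : ℝ) : ℂ))) := by
      refine setIntegral_congr_fun measurableSet_Ioi fun r hr => ?_
      rw [ofReal_sq_cpow hr, show 2 * (-s / 2) = -s by ring, sub_eq_add_neg 1 s, cpow_add _ _ (ofReal_ne_zero.2 (ne_of_gt hr)),
        cpow_one, ofReal_pow r 2]
      ring
    rw [this, hc]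
    ring
  have hpint : ∫ r in Ioi (0 : ℝ), p r = 1 / 2 * ((Real.pi : ℂ) ^ (s / 2) * Gamma (-s / 2)) := by
    have hg := integral_cpow_mul_exp_neg_mul (a := -s / 2) (w := Real.pi) (by simp; linarith) (by simp [Real.pi_pos])
    rw [show -(-s / 2) = s / 2 by ring] at hg
    rw [← hg, ← integral_Ioi_comp_sq]
    refine setIntegral_congr_fun measurableSet_Ioi fun r hr => ?_
    simp only [hp]
    have hr0 : (r : ℂ) ≠ 0 := ofReal_ne_zero.2 (ne_of_gt hr)
    rw [ofReal_sq_cpow hr, show 2 * (-s / 2 - 1) = (-s - 1) - 1 by ring, cpow_sub (-s - 1) _ hr0, cpow_one, ofReal_pow r 2]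
    field_simp
  -- The cosecant series at z = `diag` · r, where z² = ir². The polar term 1/z produces `p`, and the
  -- pairs ±(n+1) produce `q n`.
  have hmain : ∫ r in Ioi (0 : ℝ), (r : ℂ) ^ (-s) * exp (-(Real.pi * r ^ 2)) / sin (Real.pi * (diag * r)) =
      1 / (diag * Real.pi) * (∫ r in Ioi (0 : ℝ), p r) - 2 * diag / Real.pi * ∫ r in Ioi (0 : ℝ), ∑' n, q n r := by
    rw [← integral_const_mul, ← integral_const_mul, ← integral_sub]
    · refine setIntegral_congr_fun measurableSet_Ioi fun r hr => ?_
      have hr' : (0 : ℝ) < r := hr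
      have hr0 : (r : ℂ) ≠ 0 := ofReal_ne_zero.2 hr'.ne'
      have hz : ∀ k : ℤ, diag * r ≠ k := by
        intro k hk
        have := congrArg im hk
        rw [im_mul_ofReal, diag_im, intCast_im] at this
        have : 0 < √2 / 2 * r := by positivity
        linarith
      simp only [div_eq_mul_inv ((r : ℂ) ^ (-s) * exp (-(Real.pi * r ^ 2))), inv_sin_pi_mul_eq hz]
      rw [mul_pow, diag_sq]
      simp only [hq, hp]
      have : ∑' n : ℕ, (-1) ^ (n + 1) * ((r : ℂ) ^ (1 - s) * exp (-(Real.pi * r ^ 2)) / ((((n : ℝ) + 1) ^ 2 : ℝ) - I * r ^ 2)) =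
        (r : ℂ) ^ (1 - s) * exp (-(Real.pi * r ^ 2)) * ∑' n : ℕ, (-1) ^ (n + 1) / (((n : ℂ) + 1) ^ 2 - I * r ^ 2) := by
        rw [← tsum_mul_left]
        refine tsum_congr fun n => ?_
        push_cast
        ring
      rw [this, sub_eq_add_neg 1 s, cpow_add _ _ hr0, cpow_one, cpow_sub _ _ hr0, cpow_one]
      have hd : diag ≠ 0 := diag_ne_zero
      generalize ∑' n : ℕ, (-1) ^ (n + 1) / (((n : ℂ) + 1) ^ 2 - I * r ^ 2) = S
      generalize exp (-(Real.pi * r ^ 2 : ℂ)) = E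
      generalize (r : ℂ) ^ (-s) = P
      generalize diag = D at *
      field_simp
    · exact (hgauss _ (by simp; linarith)).const_mul _
    · have : Integrable (fun r => ∑' n, q n r) (volume.restrict (Ioi (0 : ℝ))) := by
        refine (hG.mul_const (∑' n : ℕ, 1 / ((n : ℝ) + 1) ^ 2)).mono' ?_ (Eventually.of_forall fun r => ?_)
        · exact aestronglyMeasurable_of_tendsto_ae atTop
            (fun N => Finset.aestronglyMeasurable_fun_sum (Finset.range N) fun n _ => hqm n)
            (Eventually.of_forall fun r => (Summable.of_norm_bounded (hsum2.mul_left _)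
              fun n => hqb n r).hasSum.tendsto_sum_nat)
        · rw [← tsum_mul_left]
          exact tsum_of_norm_bounded (hsum2.mul_left _).hasSum fun n => hqb n r
      exact this.const_mul _
  rw [auxR_eq_mellin hs, hmain, hpint, ← hqsum.tsum_eq, tsum_congr hqint, tsum_mul_left]
  generalize ∑' n : ℕ, (-1) ^ (n + 1) * thetaInt e (((n : ℝ) + 1) ^ 2) s = S
  have hG1 : Gamma (1 - s / 2) = (-s / 2) * Gamma (-s / 2) := by
    rw [← Gamma_add_one _ (by simpa using hs0)]
    congr 1; ring
  -- Reflection formula. At the poles of Γ(s/2) the conventional value 0 of `Gamma`, and hence of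
  -- its inverse, agrees with the zero of the entire function 1/Γ, and the sine vanishes as well.
  have hG2 : sin (Real.pi * s / 2) * Gamma (1 - s / 2) = Real.pi * (Gamma (s / 2))⁻¹ := by
    have hr := Complex.Gamma_mul_Gamma_one_sub (s / 2)
    rw [show (Real.pi : ℂ) * (s / 2) = Real.pi * s / 2 by ring] at hr
    by_cases h0 : Gamma (s / 2) = 0
    · obtain ⟨k, hk⟩ := (Gamma_eq_zero_iff _).1 h0
      have : sin (Real.pi * s / 2) = 0 := by
        rw [sin_eq_zero_iff]
        exact ⟨-k, by push_cast; linear_combination (Real.pi : ℂ) * hk⟩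
      rw [this, h0]; simp
    · have hsin : sin (Real.pi * s / 2) ≠ 0 := by
        intro h
        have hG3 : Gamma (1 - s / 2) ≠ 0 := Gamma_ne_zero_of_re_pos (by simp; linarith)
        rw [h, div_zero] at hr
        exact (mul_ne_zero h0 hG3) hr
      rw [eq_div_iff hsin] at hr
      rw [← div_eq_mul_inv, eq_div_iff h0]
      linear_combination hr
  have hG3 : Gamma (-s / 2) = -2 / s * Gamma (1 - s / 2) := by rw [hG1]; field_simp
  rw [hG3]
  have hd : diag ≠ 0 := diag_ne_zero
  have hd2 : diag ^ 2 = I := diag_sq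
  generalize diag = D at *
  have e1 : s * (D * exp (I * Real.pi * s / 4) * sin (Real.pi * s / 2) *
    (1 / (D * Real.pi) * (1 / 2 * ((Real.pi : ℂ) ^ (s / 2) * (-2 / s * Gamma (1 - s / 2)))) -
      2 * D / Real.pi * (1 / 2 * ((Real.pi : ℂ) ^ (s / 2) * Gamma (1 - s / 2)) * S))) =
    exp (I * Real.pi * s / 4) * (Real.pi : ℂ) ^ (s / 2) * (sin (Real.pi * s / 2) * Gamma (1 - s / 2)) / Real.pi *
      (-1 - D ^ 2 * s * S) := by
    field_simp
  rw [e1, hG2, hd2]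
  field_simp

/-! ### The alternating theta series and the entire function G -/

/-- The alternating theta series `∑ (-1) ^ n e ^ (-π n ^ 2 y)` over `n ≥ 1`. -/
def altTheta (y : ℝ) : ℝ := ∑' n : ℕ, (-1) ^ (n + 1) * Real.exp (-(Real.pi * ((n : ℝ) + 1) ^ 2 * y))

theorem succ_le_sq (n : ℕ) : (n : ℝ) + 1 ≤ ((n : ℝ) + 1) ^ 2 := by
  have : (0 : ℝ) ≤ n := n.cast_nonneg
  nlinarith

theorem summable_exp_sq {y : ℝ} (hy : 0 < y) :
    Summable fun n : ℕ => Real.exp (-(Real.pi * ((n : ℝ) + 1) ^ 2 * y)) := by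
  have h : Summable fun n : ℕ => Real.exp (-(Real.pi * y)) ^ (n + 1) := by
    refine (summable_nat_add_iff 1).2 (summable_geometric_of_lt_one (Real.exp_pos _).le ?_)
    rw [Real.exp_lt_one_iff]
    have := mul_pos Real.pi_pos hy
    linarith
  refine Summable.of_nonneg_of_le (fun n => (Real.exp_pos _).le) (fun n => ?_) h
  rw [← Real.exp_nat_mul]
  gcongr
  push_cast
  nlinarith [mul_nonneg (mul_pos Real.pi_pos hy).le (sub_nonneg.2 (succ_le_sq n))]

/-- Leibniz criterion: an alternating sum of decreasing terms is bounded by its first term. Unlike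
the sum of absolute values, this stays bounded as y tends to 0. -/
theorem abs_altTheta_le {y : ℝ} (hy : 0 < y) : |altTheta y| ≤ Real.exp (-(Real.pi * y)) := by
  set f : ℕ → ℝ := fun n => Real.exp (-(Real.pi * ((n : ℝ) + 1) ^ 2 * y)) with hf
  have hanti : Antitone f := by
    intro a b hab
    have : (a : ℝ) ≤ b := by exact_mod_cast hab
    have ha : (0 : ℝ) ≤ a := a.cast_nonneg
    simp only [hf]
    gcongr
  have hs := summable_exp_sq hy
  have hsa : Summable fun n => (-1) ^ n * f n := hs.alternating
  have ht := hsa.hasSum.tendsto_sum_nat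
  have h1 := hanti.alternating_series_le_tendsto ht 0
  have h2 := hanti.tendsto_le_alternating_series ht 0
  have h3 : altTheta y = -∑' n, (-1) ^ n * f n := by
    rw [altTheta, ← tsum_neg]
    refine tsum_congr fun n => ?_
    rw [pow_succ]; ring
  simp [hf] at h1 h2
  rw [h3, abs_neg, abs_of_nonneg h1]
  exact h2

theorem aestronglyMeasurable_altTheta : AEStronglyMeasurable altTheta (volume.restrict (Ioi 0)) := by
  refine aestronglyMeasurable_of_tendsto_ae atTop (f := fun (N : ℕ) y => ∑ n ∈ Finset.range N,
    (-1) ^ (n + 1) * Real.exp (-(Real.pi * ((n : ℝ) + 1) ^ 2 * y))) (fun N => ?_) ?_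
  · exact (by fun_prop : Continuous _).aestronglyMeasurable
  · refine (ae_restrict_iff' measurableSet_Ioi).2 (Eventually.of_forall fun y hy => ?_)
    have : Summable fun n : ℕ => (-1) ^ (n + 1) * Real.exp (-(Real.pi * ((n : ℝ) + 1) ^ 2 * y)) :=
      Summable.of_norm_bounded (summable_exp_sq hy) fun n => by simp
    exact this.hasSum.tendsto_sum_nat

/-- The growth exponent 3/2 originates here. Splitting log(1+y) at b = a + 1 leaves a slope 1 in y,
which the decay e^(-πy) absorbs, and a term b log b, estimated crudely by 2b√b. Any exponent below 2
would serve. -/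
theorem mul_log_one_add_le {a y : ℝ} (ha : 0 ≤ a) (hy : 0 ≤ y) :
    a * Real.log (1 + y) ≤ y + 2 * (a + 1) * √(a + 1) := by
  set b := a + 1 with hb
  have hb1 : 1 ≤ b := by linarith
  have hbp : 0 < b := by linarith
  have h1 : Real.log (1 + y) ≤ Real.log b + ((1 + y) / b - 1) := by
    have := Real.log_le_sub_one_of_pos (x := (1 + y) / b) (by positivity)
    rw [Real.log_div (by positivity) hbp.ne'] at this
    linarith
  have h2 : Real.log b ≤ 2 * (√b - 1) := by
    have := Real.log_le_sub_one_of_pos (x := √b) (by positivity)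
    rw [Real.log_sqrt hbp.le] at this
    linarith
  have h0 : 0 ≤ Real.log (1 + y) := Real.log_nonneg (by linarith)
  calc a * Real.log (1 + y) ≤ b * Real.log (1 + y) := by gcongr; linarith
    _ ≤ b * (2 * (√b - 1) + ((1 + y) / b - 1)) := by gcongr; linarith
    _ = 2 * b * √b - 2 * b + (1 + y) - b := by field_simp; ring
    _ ≤ y + 2 * b * √b := by linarith

theorem norm_one_sub_I_mul_le {y : ℝ} (hy : 0 ≤ y) : ‖(1 - I * y : ℂ)‖ ≤ 1 + y := by
  refine (norm_sub_le _ _).trans ?_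
  simp [abs_of_nonneg hy]

theorem one_le_norm_one_sub_I_mul (y : ℝ) : 1 ≤ ‖(1 - I * y : ℂ)‖ := by
  refine le_trans ?_ (re_le_norm _)
  simp

theorem one_sub_I_mul_mem_slitPlane (y : ℝ) : (1 - I * y : ℂ) ∈ slitPlane := Or.inl (by simp)

theorem one_sub_I_mul_ne_zero (y : ℝ) : (1 - I * y : ℂ) ≠ 0 :=
  slitPlane_ne_zero (one_sub_I_mul_mem_slitPlane y)

theorem norm_log_one_sub_I_mul_le {y : ℝ} (hy : 0 ≤ y) :
    ‖log (1 - I * y)‖ ≤ Real.log (1 + y) + Real.pi := by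
  refine (norm_le_abs_re_add_abs_im _).trans ?_
  rw [log_re, log_im]
  gcongr
  · rw [abs_of_nonneg (Real.log_nonneg (one_le_norm_one_sub_I_mul y))]
    exact Real.log_le_log (lt_of_lt_of_le one_pos (one_le_norm_one_sub_I_mul y)) (norm_one_sub_I_mul_le hy)
  · exact abs_arg_le_pi _

theorem mul_norm_log_le {a y : ℝ} (ha : 0 ≤ a) (hy : 0 ≤ y) :
    a * ‖log (1 - I * y)‖ ≤ y + 6 * (a + 1) * √(a + 1) := by
  have h1 := mul_log_one_add_le ha hy
  have h2 : a * ‖log (1 - I * y)‖ ≤ a * (Real.log (1 + y) + Real.pi) := by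
    gcongr; exact norm_log_one_sub_I_mul_le hy
  have h3 : 1 ≤ √(a + 1) := Real.one_le_sqrt.2 (by linarith)
  nlinarith [Real.pi_lt_four, mul_nonneg ha (sub_nonneg.2 h3)]

theorem norm_one_sub_I_mul_cpow_le {y : ℝ} (hy : 0 ≤ y) (w : ℂ) :
    ‖(1 - I * y : ℂ) ^ w‖ ≤ Real.exp (6 * (‖w‖ + 1) * √(‖w‖ + 1)) * Real.exp y := by
  rw [cpow_def_of_ne_zero (one_sub_I_mul_ne_zero y), norm_exp, ← Real.exp_add]
  gcongr
  refine (re_le_norm _).trans ?_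
  rw [norm_mul, mul_comm]
  linarith [mul_norm_log_le (norm_nonneg w) hy]

theorem continuous_one_sub_I_mul_cpow (w : ℂ) : Continuous fun y : ℝ => (1 - I * y : ℂ) ^ w := by
  refine Continuous.cpow (by fun_prop) continuous_const fun y => one_sub_I_mul_mem_slitPlane y

theorem norm_ofReal_altTheta_le {y : ℝ} (hy : 0 < y) : ‖(altTheta y : ℂ)‖ ≤ Real.exp (-(Real.pi * y)) := by
  rw [norm_real]; exact abs_altTheta_le hy

theorem aestronglyMeasurable_ofReal_altTheta :
    AEStronglyMeasurable (fun y => (altTheta y : ℂ)) (volume.restrict (Ioi 0)) :=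
  continuous_ofReal.comp_aestronglyMeasurable aestronglyMeasurable_altTheta

theorem integrableOn_exp_neg {c : ℝ} (hc : 0 < c) : IntegrableOn (fun y : ℝ => Real.exp (-c * y)) (Ioi 0) :=
  integrableOn_exp_mul_Ioi (by linarith) 0

theorem integral_exp_neg {c : ℝ} (hc : 0 < c) : ∫ y in Ioi (0 : ℝ), Real.exp (-c * y) = 1 / c := by
  rw [integral_exp_mul_Ioi (by linarith) 0]; simp

/-- The alternating theta integral. -/
def altInt (s : ℂ) : ℂ := ∫ y in Ioi (0 : ℝ), (1 - I * y : ℂ) ^ (s / 2 - 1) * altTheta y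

theorem norm_altInt_le (s : ℂ) : ‖altInt s‖ ≤ Real.exp (6 * (‖s / 2 - 1‖ + 1) * √(‖s / 2 - 1‖ + 1)) := by
  rw [altInt]
  set K := Real.exp (6 * (‖s / 2 - 1‖ + 1) * √(‖s / 2 - 1‖ + 1))
  have hpi : 0 < Real.pi - 1 := by linarith [Real.pi_gt_three]
  refine (norm_integral_le_of_norm_le ((integrableOn_exp_neg hpi).const_mul K) ?_).trans ?_
  · refine (ae_restrict_iff' measurableSet_Ioi).2 (Eventually.of_forall fun y hy => ?_)
    have hy' : (0 : ℝ) < y := hy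
    rw [norm_mul]
    calc _ ≤ (K * Real.exp y) * Real.exp (-(Real.pi * y)) := by
          gcongr
          · exact norm_one_sub_I_mul_cpow_le hy'.le _
          · exact norm_ofReal_altTheta_le hy'
      _ = _ := by rw [mul_assoc, ← Real.exp_add]; ring_nf
  · rw [integral_const_mul, integral_exp_neg hpi]
    have : 1 / (Real.pi - 1) ≤ 1 := by rw [div_le_one hpi]; linarith [Real.pi_gt_three]
    exact mul_le_of_le_one_right (Real.exp_pos _).le this

theorem differentiable_altInt : Differentiable ℂ altInt := by
  have he : altInt = fun s : ℂ => ∫ y in Ioi (0 : ℝ), exp (s * (log (1 - I * y) / 2)) *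
      ((1 - I * y : ℂ)⁻¹ * altTheta y) := by
    ext s
    refine setIntegral_congr_fun measurableSet_Ioi fun y _ => ?_
    rw [cpow_sub _ _ (one_sub_I_mul_ne_zero y), cpow_one, cpow_def_of_ne_zero (one_sub_I_mul_ne_zero y),
      show log (1 - I * y) * (s / 2) = s * (log (1 - I * y) / 2) by ring]
    ring
  have hlog : Continuous fun y : ℝ => log (1 - I * y) / 2 :=
    (Continuous.clog (by fun_prop) fun y => one_sub_I_mul_mem_slitPlane y).div_const _
  have hinv : Continuous fun y : ℝ => (1 - I * y : ℂ)⁻¹ :=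
    Continuous.inv₀ (by fun_prop) one_sub_I_mul_ne_zero
  rw [he]
  refine differentiable_integral_exp hlog.aestronglyMeasurable
    (hinv.aestronglyMeasurable.mul aestronglyMeasurable_ofReal_altTheta) fun c => ?_
  have hpi : 0 < Real.pi - 1 := by linarith [Real.pi_gt_three]
  refine ((integrableOn_exp_neg hpi).const_mul (Real.exp (6 * (|c| + 1) * √(|c| + 1)))).mono' ?_ ?_
  · exact (by fun_prop : Continuous fun y : ℝ => Real.exp (c * ‖log (1 - I * y) / 2‖)).aestronglyMeasurable.mul
      (hinv.aestronglyMeasurable.mul aestronglyMeasurable_ofReal_altTheta).norm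
  · refine (ae_restrict_iff' measurableSet_Ioi).2 (Eventually.of_forall fun y hy => ?_)
    have hy' : (0 : ℝ) < y := hy
    rw [Real.norm_of_nonneg (by positivity), norm_mul, norm_inv, norm_div, Complex.norm_two]
    calc _ ≤ Real.exp (6 * (|c| + 1) * √(|c| + 1) + y) * (1 * Real.exp (-(Real.pi * y))) := by
          gcongr
          · have h1 := mul_norm_log_le (abs_nonneg c) hy'.le
            have h2 : c * (‖log (1 - I * y)‖ / 2) ≤ |c| * (‖log (1 - I * y)‖ / 2) := by
              gcongr; exact le_abs_self c
            have : 0 ≤ |c| * ‖log (1 - I * y)‖ := by positivity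
            linarith
          · exact inv_le_one_of_one_le₀ (one_le_norm_one_sub_I_mul y)
          · exact norm_ofReal_altTheta_le hy'
      _ = _ := by rw [one_mul, ← Real.exp_add, ← Real.exp_add]; ring_nf

/-- Sum and integral may be exchanged: the power costs e^y, and πm - 1 ≥ 2m for m = (n+1)², so the
integrals of the absolute values are O(1/(n+1)²). -/
theorem hasSum_thetaInt_one (s : ℂ) :
    HasSum (fun n : ℕ => (-1) ^ (n + 1) * thetaInt 1 (((n : ℝ) + 1) ^ 2) s) (altInt s) := by
  set q : ℕ → ℝ → ℂ := fun n y => (-1) ^ (n + 1) * (exp (-(Real.pi * ((((n : ℝ) + 1) ^ 2 : ℝ) : ℂ) * 1 * y)) *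
    (1 - I * 1 * y) ^ (s / 2 - 1)) with hq
  set K := Real.exp (6 * (‖s / 2 - 1‖ + 1) * √(‖s / 2 - 1‖ + 1))
  have hn1 : ∀ n : ℕ, (1 : ℝ) ≤ ((n : ℝ) + 1) ^ 2 := fun n => by
    have : (0 : ℝ) ≤ n := n.cast_nonneg
    nlinarith
  have hb : ∀ n, ∀ y ∈ Ioi (0 : ℝ), ‖q n y‖ ≤ K * Real.exp (-(2 * ((n : ℝ) + 1) ^ 2) * y) := by
    intro n y hy
    have hy' : (0 : ℝ) < y := hy
    simp only [hq]
    rw [norm_mul, norm_pow, norm_neg, norm_one, one_pow, one_mul, norm_mul, norm_exp_neg_mul_ofReal, mul_one, mul_one]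
    calc _ ≤ Real.exp (-(Real.pi * ((((n : ℝ) + 1) ^ 2 : ℝ) : ℂ)).re * y) * (K * Real.exp y) := by
          gcongr
          exact norm_one_sub_I_mul_cpow_le hy'.le _
      _ = K * (Real.exp (-(Real.pi * ((n : ℝ) + 1) ^ 2) * y + y)) := by
          rw [re_ofReal_mul, ofReal_re, Real.exp_add]; ring
      _ ≤ _ := by
          gcongr
          nlinarith [mul_nonneg (mul_nonneg (sub_nonneg.2 Real.pi_gt_three.le) (zero_le_one.trans (hn1 n))) hy'.le,
            mul_nonneg (sub_nonneg.2 (hn1 n)) hy'.le]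
  have hbi : ∀ n : ℕ, IntegrableOn (fun y : ℝ => K * Real.exp (-(2 * ((n : ℝ) + 1) ^ 2) * y)) (Ioi 0) := fun n =>
    (integrableOn_exp_neg (by positivity)).const_mul K
  have hqm : ∀ n, AEStronglyMeasurable (q n) (volume.restrict (Ioi 0)) := by
    intro n
    have := continuous_one_sub_I_mul_cpow (s / 2 - 1)
    simp only [hq, mul_one]
    exact (by fun_prop : Continuous _).aestronglyMeasurable
  have hqi : ∀ n, IntegrableOn (q n) (Ioi 0) := fun n => (hbi n).mono' (hqm n)
    ((ae_restrict_iff' measurableSet_Ioi).2 (Eventually.of_forall (hb n)))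
  have hsum2 : Summable fun n : ℕ => 1 / ((n : ℝ) + 1) ^ 2 := by
    have := (summable_nat_add_iff 1).2 (Real.summable_one_div_nat_pow.2 one_lt_two)
    simpa using this
  have hqs : Summable fun n => ∫ y in Ioi (0 : ℝ), ‖q n y‖ := by
    refine Summable.of_nonneg_of_le (fun n => integral_nonneg fun r => norm_nonneg _) (fun n => ?_)
      (hsum2.mul_left K)
    refine (setIntegral_mono_on (hqi n).norm (hbi n) measurableSet_Ioi (hb n)).trans ?_
    rw [integral_const_mul, integral_exp_neg (by positivity)]
    gcongr
    linarith [hn1 n]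
  have := hasSum_integral_of_summable_integral_norm hqi hqs
  have e1 : ∀ n, ∫ y in Ioi (0 : ℝ), q n y = (-1) ^ (n + 1) * thetaInt 1 (((n : ℝ) + 1) ^ 2) s := by
    intro n
    simp only [hq, thetaInt]
    rw [integral_const_mul, one_mul]
  have e2 : altInt s = ∫ y in Ioi (0 : ℝ), ∑' n, q n y := by
    refine setIntegral_congr_fun measurableSet_Ioi fun y _ => ?_
    simp only [hq, altTheta]
    rw [ofReal_tsum, ← tsum_mul_left]
    refine tsum_congr fun n => ?_
    push_cast
    ring_nf
  simp_rw [e1] at this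
  rwa [e2]

/-- The normalized nontrivial part of `R`. -/
def auxG (s : ℂ) : ℂ := -1 - I * s * altInt s

theorem differentiable_auxG : Differentiable ℂ auxG := by
  have := differentiable_altInt
  unfold auxG
  fun_prop

/-- Both sides are entire, since 1/Γ is, and on Re s < -1 they agree by the expansion along the
positive axis `e = 1`. -/
theorem mul_auxR_eq (s : ℂ) : s * auxR s = (Real.pi : ℂ) ^ (s / 2) * (Gamma (s / 2))⁻¹ *
    (exp (I * Real.pi * s / 4) * auxG s) := by
  have hpi : (Real.pi : ℂ) ≠ 0 := ofReal_ne_zero.2 Real.pi_ne_zero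
  have h1 : Differentiable ℂ fun s => s * auxR s := differentiable_id.mul differentiable_auxR
  have h2 : Differentiable ℂ fun s => (Real.pi : ℂ) ^ (s / 2) * (Gamma (s / 2))⁻¹ *
      (exp (I * Real.pi * s / 4) * auxG s) := by
    have hg : Differentiable ℂ fun s : ℂ => (Gamma (s / 2))⁻¹ :=
      differentiable_one_div_Gamma.comp (differentiable_id.div_const 2)
    have hp : Differentiable ℂ fun s : ℂ => (Real.pi : ℂ) ^ (s / 2) :=
      (differentiable_id.div_const 2).const_cpow (Or.inl hpi)
    have := differentiable_auxG
    fun_prop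
  refine congrFun ((analyticOnNhd_univ_iff_differentiable.2 h1).eq_of_eventuallyEq
    (analyticOnNhd_univ_iff_differentiable.2 h2) (z₀ := -2) ?_) s
  have hopen : IsOpen {z : ℂ | z.re < -1} := isOpen_lt continuous_re continuous_const
  filter_upwards [hopen.mem_nhds (by simp : (-2 : ℂ) ∈ {z : ℂ | z.re < -1})] with z hz
  rw [auxR_eq_tsum_thetaInt (e := 1) (by simp) (by simp) (by simp) hz, (hasSum_thetaInt_one z).tsum_eq, auxG]

/-- Growth of order at most 3/2, hence below 2: the partial fractions of G'/G then need only one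
subtraction. -/
theorem norm_auxG_le (s : ℂ) : ‖auxG s‖ ≤ Real.exp (8 * (‖s‖ + 2) * √(‖s‖ + 2)) := by
  have h1 : ‖s / 2 - 1‖ + 1 ≤ ‖s‖ + 2 := by
    have := norm_sub_le (s / 2) 1
    rw [norm_div, Complex.norm_two, norm_one] at this
    linarith [norm_nonneg s]
  have h2 : ‖altInt s‖ ≤ Real.exp (6 * (‖s‖ + 2) * √(‖s‖ + 2)) := (norm_altInt_le s).trans (by gcongr)
  have h3 : ‖auxG s‖ ≤ 1 + ‖s‖ * ‖altInt s‖ := by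
    rw [auxG]
    refine (norm_sub_le _ _).trans_eq ?_
    simp
  have h4 : 1 ≤ √(‖s‖ + 2) := Real.one_le_sqrt.2 (by linarith [norm_nonneg s])
  have h5 : 1 + ‖s‖ ≤ Real.exp (2 * (‖s‖ + 2) * √(‖s‖ + 2)) := by
    refine le_trans ?_ (Real.add_one_le_exp _)
    nlinarith [norm_nonneg s]
  have h6 : 1 ≤ Real.exp (6 * (‖s‖ + 2) * √(‖s‖ + 2)) := Real.one_le_exp (by positivity)
  calc ‖auxG s‖ ≤ 1 + ‖s‖ * Real.exp (6 * (‖s‖ + 2) * √(‖s‖ + 2)) := h3.trans (by gcongr)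
    _ ≤ (1 + ‖s‖) * Real.exp (6 * (‖s‖ + 2) * √(‖s‖ + 2)) := by linarith
    _ ≤ Real.exp (2 * (‖s‖ + 2) * √(‖s‖ + 2)) * Real.exp (6 * (‖s‖ + 2) * √(‖s‖ + 2)) := by gcongr
    _ = _ := by rw [← Real.exp_add]; ring_nf

/-- At s = 1/2 the power (1 - iy)^(-3/4) has modulus at most 1, so the integral is at most 1/π and
cannot cancel the -1. This makes 1/2 an admissible base point for all expansions over zeros. -/
theorem auxG_half_ne_zero : auxG (1 / 2) ≠ 0 := by
  have h : ‖altInt (1 / 2)‖ ≤ 1 := by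
    rw [altInt]
    refine (norm_integral_le_of_norm_le (integrableOn_exp_neg Real.pi_pos) ?_).trans ?_
    · refine (ae_restrict_iff' measurableSet_Ioi).2 (Eventually.of_forall fun y hy => ?_)
      have hy' : (0 : ℝ) < y := hy
      rw [norm_mul, neg_mul]
      refine (mul_le_of_le_one_left (norm_nonneg _) ?_).trans (norm_ofReal_altTheta_le hy')
      have hw : ((1 / 2 : ℂ) / 2 - 1) = ((-(3 / 4) : ℝ) : ℂ) := by push_cast; norm_num
      rw [hw, norm_cpow_real]
      exact Real.rpow_le_one_of_one_le_of_nonpos (one_le_norm_one_sub_I_mul y) (by norm_num)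
    · rw [integral_exp_neg Real.pi_pos, div_le_one Real.pi_pos]
      linarith [Real.pi_gt_three]
  intro h0
  rw [auxG] at h0
  have h1 : I * (1 / 2) * altInt (1 / 2) = -1 := by linear_combination -h0
  have h2 := congrArg norm h1
  rw [norm_mul, norm_mul, norm_I, norm_neg, norm_one] at h2
  norm_num at h2
  linarith

/-! ### Polynomial growth of G in the left half plane -/

theorem thetaInt_one_eq {m : ℝ} (hm : 1 ≤ m) {s : ℂ} (hs : s.re < 0) : thetaInt 1 m s = thetaInt I m s := by
  have h1 := integral_theta_kernel (e := 1) (by simp) (by simp) (by simp) hm hs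
  have h2 := integral_theta_kernel (e := I) (by simp) (by simp) (by simp) hm hs
  rw [h1] at h2
  refine mul_left_cancel₀ (mul_ne_zero ?_ ?_) h2
  · rw [Ne, cpow_eq_zero_iff]; simp [Real.pi_ne_zero]
  · exact Gamma_ne_zero_of_re_pos (by simp; linarith)

/-- On the imaginary ray 1 - iey becomes the real number 1 + y and the exponential becomes
unimodular. For Re s ≤ -2 the power decays at least like (1+y)^(-2), and one integration by parts
against the exponential gains the factor 1/m. -/
theorem norm_thetaInt_I_le {m : ℝ} (hm : 1 ≤ m) {s : ℂ} (hs : s.re ≤ -2) :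
    ‖thetaInt I m s‖ ≤ (2 + ‖s‖) / m := by
  have hm0 : 0 < m := by linarith
  set w : ℂ := s / 2 - 1 with hw
  have hwre : w.re ≤ -2 := by simp [hw]; linarith
  have hwn : ‖w‖ ≤ 1 + ‖s‖ := by
    have := norm_sub_le (s / 2) 1
    rw [norm_div, Complex.norm_two, norm_one] at this
    linarith [norm_nonneg s]
  have hbase : ∀ y : ℝ, (1 - I * I * y : ℂ) = ((1 + y : ℝ) : ℂ) := by
    intro y; rw [I_mul_I]; push_cast; ring
  have hrpow : IntegrableOn (fun y : ℝ => (1 + y) ^ (-2 : ℝ)) (Ioi 0) := by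
    have := integrableOn_add_rpow_Ioi_of_lt (a := -2) (m := 1) (c := 0) (by norm_num) (by norm_num)
    simpa [add_comm] using this
  have hrval : ∫ y in Ioi (0 : ℝ), (1 + y) ^ (-2 : ℝ) = 1 := by
    have hmp : MeasurePreserving (fun y : ℝ => 1 + y) := measurePreserving_add_left volume 1
    have h1 := hmp.setIntegral_preimage_emb (measurableEmbedding_addLeft 1) (fun y : ℝ => y ^ (-2 : ℝ)) (Ioi 1)
    have h2 : (fun y : ℝ => 1 + y) ⁻¹' (Ioi 1) = Ioi 0 := by ext y; simp
    rw [h2] at h1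
    rw [h1, integral_Ioi_rpow_of_lt (by norm_num) one_pos]
    norm_num
  have hnorm : ∀ v : ℂ, v.re ≤ -2 → ∀ y ∈ Ioi (0 : ℝ), ‖exp (-(Real.pi * m * I * y)) * ((1 + y : ℝ) : ℂ) ^ v‖ ≤ (1 + y) ^ (-2 : ℝ) := by
    intro v hv y hy
    have hy' : (0 : ℝ) < y := hy
    rw [norm_mul, norm_cpow_eq_rpow_re_of_pos (by linarith : (0 : ℝ) < 1 + y), norm_exp]
    have hz : (-(Real.pi * m * I * y) : ℂ).re = 0 := by simp
    rw [hz, Real.exp_zero, one_mul]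
    exact Real.rpow_le_rpow_of_exponent_le (by linarith) hv
  have hcont : ∀ v : ℂ, ContinuousOn (fun y : ℝ => exp (-(Real.pi * m * I * y)) * ((1 + y : ℝ) : ℂ) ^ v) (Ici 0) := by
    intro v y hy
    have hy' : (0 : ℝ) ≤ y := hy
    refine ContinuousAt.continuousWithinAt ?_
    have h1 : ContinuousAt (fun y : ℝ => ((1 + y : ℝ) : ℂ) ^ v) y :=
      ContinuousAt.comp (g := fun x : ℝ => (x : ℂ) ^ v) (continuousAt_ofReal_cpow_const _ _ (Or.inr (by linarith))) (by fun_prop)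
    exact ContinuousAt.mul (by fun_prop) h1
  have hint : ∀ v : ℂ, v.re ≤ -2 → IntegrableOn (fun y : ℝ => exp (-(Real.pi * m * I * y)) * ((1 + y : ℝ) : ℂ) ^ v) (Ioi 0) :=
    fun v hv => hrpow.mono' (((hcont v).mono Ioi_subset_Ici_self).aestronglyMeasurable measurableSet_Ioi)
      ((ae_restrict_iff' measurableSet_Ioi).2 (Eventually.of_forall (hnorm v hv)))
  set A := ∫ y in Ioi (0 : ℝ), exp (-(Real.pi * m * I * y)) * ((1 + y : ℝ) : ℂ) ^ w with hA
  set B := ∫ y in Ioi (0 : ℝ), exp (-(Real.pi * m * I * y)) * ((1 + y : ℝ) : ℂ) ^ (w - 1) with hB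
  have hw1 : (w - 1).re ≤ -2 := by simp; linarith
  have hBn : ‖B‖ ≤ 1 := by
    rw [← hrval]
    exact norm_integral_le_of_norm_le hrpow ((ae_restrict_iff' measurableSet_Ioi).2 (Eventually.of_forall (hnorm _ hw1)))
  have hparts : -(Real.pi * m * I) * A + w * B = -1 := by
    have hder : ∀ y ∈ Ioi (0 : ℝ), HasDerivAt (fun y : ℝ => exp (-(Real.pi * m * I * y)) * ((1 + y : ℝ) : ℂ) ^ w)
        (-(Real.pi * m * I) * (exp (-(Real.pi * m * I * y)) * ((1 + y : ℝ) : ℂ) ^ w) +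
          w * (exp (-(Real.pi * m * I * y)) * ((1 + y : ℝ) : ℂ) ^ (w - 1))) y := by
      intro y hy
      have hy' : (0 : ℝ) < y := hy
      have e1 : HasDerivAt (fun y : ℝ => exp (-(Real.pi * m * I * y))) (exp (-(Real.pi * m * I * y)) * -(Real.pi * m * I)) y := by
        have := ((hasDerivAt_id y).ofReal_comp.const_mul (Real.pi * m * I : ℂ)).neg.cexp
        simpa using this
      have e2 : HasDerivAt (fun y : ℝ => ((1 + y : ℝ) : ℂ) ^ w) (w * ((1 + y : ℝ) : ℂ) ^ (w - 1)) y := by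
        have h0 : HasDerivAt (fun y : ℝ => ((1 + y : ℝ) : ℂ)) 1 y := by
          have := ((hasDerivAt_id y).const_add 1).ofReal_comp
          simpa using this
        have h1 : (((1 + y : ℝ) : ℂ)) ∈ slitPlane := Or.inl (by rw [ofReal_re]; linarith)
        have := ((hasDerivAt_id (((1 + y : ℝ) : ℂ))).cpow_const (c := w) h1).comp y h0
        simpa [Function.comp_def] using this
      exact (e1.mul e2).congr_deriv (by ring)
    have hlim : Tendsto (fun y : ℝ => exp (-(Real.pi * m * I * y)) * ((1 + y : ℝ) : ℂ) ^ w) atTop (𝓝 0) := by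
      refine squeeze_zero_norm' ((eventually_gt_atTop 0).mono fun y hy => hnorm w hwre y hy) ?_
      have := (tendsto_rpow_neg_atTop (y := 2) two_pos).comp (tendsto_atTop_add_const_left atTop 1 tendsto_id)
      exact this
    have := integral_Ioi_of_hasDerivAt_of_tendsto ((hcont w) 0 (by simp)) hder
      (((hint w hwre).const_mul _).add ((hint _ hw1).const_mul _)) hlim
    rw [integral_add ((hint w hwre).const_mul _) ((hint _ hw1).const_mul _), integral_const_mul, integral_const_mul] at this
    rw [this]
    simp
  have hth : thetaInt I m s = I * A := by
    simp only [thetaInt, hbase, hA, hw]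
  rw [hth, norm_mul, norm_I, one_mul, le_div_iff₀ hm0]
  have h1 : (Real.pi * m * I) * A = 1 + w * B := by linear_combination -hparts
  have h2 := congrArg norm h1
  rw [norm_mul, norm_mul, norm_mul, norm_I, norm_real, norm_real, Real.norm_of_nonneg Real.pi_pos.le,
    Real.norm_of_nonneg hm0.le] at h2
  have h3 : ‖1 + w * B‖ ≤ 2 + ‖s‖ := by
    refine (norm_add_le _ _).trans ?_
    rw [norm_one, norm_mul]
    have := mul_le_of_le_one_right (norm_nonneg w) hBn
    linarith
  nlinarith [Real.pi_gt_three, mul_nonneg hm0.le (norm_nonneg A)]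

theorem tsum_one_div_sq_le : Summable (fun n : ℕ => 1 / ((n : ℝ) + 1) ^ 2) ∧ ∑' n : ℕ, 1 / ((n : ℝ) + 1) ^ 2 ≤ 2 := by
  have h := hasSum_zeta_two
  have hs : Summable fun n : ℕ => 1 / ((n : ℝ) + 1) ^ 2 := by
    have := (summable_nat_add_iff 1).2 (Real.summable_one_div_nat_pow.2 one_lt_two)
    simpa using this
  refine ⟨hs, ?_⟩
  have h2 := h.summable.tsum_eq_zero_add
  rw [h.tsum_eq] at h2
  simp only [Nat.cast_add, Nat.cast_one, Nat.cast_zero] at h2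
  norm_num at h2
  norm_num
  rw [← h2]
  nlinarith [Real.pi_lt_d2, Real.pi_pos]

/-- Each theta integral is moved to the imaginary ray, where the bounds (2 + |s|)/(n+1)² can be
summed. Polynomial growth in a half plane is what will force the Blaschke condition on the zeros
there. -/
theorem norm_auxG_le_of_re_le {s : ℂ} (hs : s.re ≤ -2) : ‖auxG s‖ ≤ 4 * (1 + ‖s‖) ^ 2 := by
  have hm : ∀ n : ℕ, (1 : ℝ) ≤ ((n : ℝ) + 1) ^ 2 := fun n => by
    have : (0 : ℝ) ≤ n := n.cast_nonneg
    nlinarith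
  obtain ⟨hs1, hs2⟩ := tsum_one_div_sq_le
  have h1 : ‖altInt s‖ ≤ (2 + ‖s‖) * 2 := by
    rw [← (hasSum_thetaInt_one s).tsum_eq]
    refine (tsum_of_norm_bounded ((hs1.mul_left (2 + ‖s‖)).hasSum) fun n => ?_).trans ?_
    · rw [norm_mul, norm_pow, norm_neg, norm_one, one_pow, one_mul, thetaInt_one_eq (hm n) (by linarith),
        mul_one_div]
      exact norm_thetaInt_I_le (hm n) hs
    · rw [tsum_mul_left]
      gcongr
  have h3 : ‖auxG s‖ ≤ 1 + ‖s‖ * ‖altInt s‖ := by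
    rw [auxG]
    refine (norm_sub_le _ _).trans_eq ?_
    simp
  nlinarith [norm_nonneg s, mul_le_mul_of_nonneg_left h1 (norm_nonneg s)]

/-! ### Upper and lower bounds for the Gamma function -/

/-- Euler's integral with scale w = 1 + iy gives Γ(a) = w^a ∫ t^(a-1) e^(-wt) dt, and the integral
is at most Γ(x). The exponential decay is that of w^a, since arg w = arctan y ≥ π/2 - 1/y. -/
theorem norm_Gamma_le {x y : ℝ} (hx : 0 < x) (hy : 0 < y) :
    ‖Gamma (x + y * I)‖ ≤ Real.Gamma x * (1 + y ^ 2) ^ (x / 2) * Real.exp (1 - Real.pi / 2 * y) := by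
  set a : ℂ := x + y * I with ha
  have hare : a.re = x := by simp [ha]
  have haim : a.im = y := by simp [ha]
  set w : ℂ := 1 + y * I with hw
  have hwre : w.re = 1 := by simp [hw]
  have hwim : w.im = y := by simp [hw]
  have hw0 : w ≠ 0 := by intro h; rw [h] at hwre; simp at hwre
  have h := integral_cpow_mul_exp_neg_mul (a := a) (w := w) (by rw [hare]; exact hx) (by rw [hwre]; exact one_pos)
  have h1 : Gamma a = w ^ a * ∫ t in Ioi (0 : ℝ), (t : ℂ) ^ (a - 1) * exp (-(w * t)) := by
    rw [h, ← mul_assoc, ← cpow_add _ _ hw0, add_neg_cancel, cpow_zero, one_mul]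
  have h2 : ‖∫ t in Ioi (0 : ℝ), (t : ℂ) ^ (a - 1) * exp (-(w * t))‖ ≤ Real.Gamma x := by
    rw [Real.Gamma_eq_integral hx]
    refine norm_integral_le_of_norm_le (Real.GammaIntegral_convergent hx)
      ((ae_restrict_iff' measurableSet_Ioi).2 (Eventually.of_forall fun t ht => ?_))
    have ht' : (0 : ℝ) < t := ht
    rw [norm_mul, norm_cpow_eq_rpow_re_of_pos ht', norm_exp_neg_mul_ofReal, hwre, sub_re, hare, one_re, mul_comm]
    simp
  have h3 : ‖w ^ a‖ ≤ (1 + y ^ 2) ^ (x / 2) * Real.exp (1 - Real.pi / 2 * y) := by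
    rw [norm_cpow_of_ne_zero hw0, hare, haim, div_eq_mul_inv, ← Real.exp_neg]
    have hn : ‖w‖ ^ x = (1 + y ^ 2) ^ (x / 2) := by
      rw [show ‖w‖ = √(1 + y ^ 2) by
        rw [Complex.norm_def, normSq_apply, hwre, hwim]; ring_nf, Real.sqrt_eq_rpow, ← Real.rpow_mul (by positivity)]
      ring_nf
    rw [hn]
    gcongr
    have harg : arg w = Real.arctan y := by
      rw [arg_of_re_nonneg (by rw [hwre]; exact zero_le_one), hwim, Real.arctan_eq_arcsin]
      congr 2
      rw [Complex.norm_def, normSq_apply, hwre, hwim]; ring_nf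
    have h4 := Real.arctan_inv_of_pos hy
    have h5 : Real.arctan y⁻¹ ≤ y⁻¹ := by
      have := Real.le_tan (Real.arctan_nonneg.2 (inv_nonneg.2 hy.le)) (Real.arctan_lt_pi_div_two y⁻¹)
      rwa [Real.tan_arctan] at this
    rw [harg]
    have h6 : Real.pi / 2 - y⁻¹ ≤ Real.arctan y := by linarith
    have h7 := mul_le_mul_of_nonneg_right h6 hy.le
    rw [sub_mul, inv_mul_cancel₀ hy.ne'] at h7
    linarith
  rw [h1, norm_mul]
  calc _ ≤ ((1 + y ^ 2) ^ (x / 2) * Real.exp (1 - Real.pi / 2 * y)) * Real.Gamma x := by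
        gcongr
    _ = _ := by ring

theorem Gamma_le_one {x : ℝ} (h1 : 1 ≤ x) (h2 : x ≤ 2) : Real.Gamma x ≤ 1 := by
  have hc := Real.convexOn_Gamma.2 (show (1 : ℝ) ∈ Ioi 0 by simp) (show (2 : ℝ) ∈ Ioi 0 by simp)
    (show 0 ≤ 2 - x by linarith) (show 0 ≤ x - 1 by linarith) (by ring)
  simp only [smul_eq_mul, Real.Gamma_one, Real.Gamma_two] at hc
  rw [show (2 - x) * 1 + (x - 1) * 2 = x by ring] at hc
  linarith

theorem norm_sin_le (z : ℂ) : ‖sin z‖ ≤ Real.exp |z.im| := by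
  rw [sin, norm_div, norm_mul, norm_I, mul_one, Complex.norm_two, div_le_iff₀ two_pos]
  refine (norm_sub_le _ _).trans ?_
  rw [norm_exp, norm_exp, mul_two]
  gcongr
  · simp [le_abs_self]
  · simp [neg_le_abs]

/-- For y ≤ 1 this is compactness. For y ≥ 1 use Γ(z) Γ(3-z) sin(πz) = π(2-z)(1-z), together with
the upper bounds for Γ(3-z) and the sine. -/
theorem exists_norm_Gamma_ge_strip : ∃ c : ℝ, 0 < c ∧ ∀ x y : ℝ, 1 ≤ x → x ≤ 2 → 0 ≤ y →
    c * Real.exp (-(Real.pi / 2 * y)) ≤ ‖Gamma (x + y * I)‖ * (1 + y ^ 2) := by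
  have hcont : ContinuousOn (fun p : ℝ × ℝ => ‖Gamma (p.1 + p.2 * I)‖) (Icc 1 2 ×ˢ Icc 0 1) := by
    intro p hp
    have hp1 : (1 : ℝ) ≤ p.1 := hp.1.1
    refine ContinuousAt.continuousWithinAt (ContinuousAt.norm ?_)
    refine ContinuousAt.comp (g := Gamma) (f := fun p : ℝ × ℝ => (p.1 + p.2 * I : ℂ)) ?_ (by fun_prop)
    refine (differentiableAt_Gamma _ fun m h => ?_).continuousAt
    have := congrArg re h
    simp at this
    have hm : (0 : ℝ) ≤ m := m.cast_nonneg
    linarith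
  obtain ⟨p, hp, hmin⟩ := (isCompact_Icc.prod isCompact_Icc).exists_isMinOn
    ⟨((1 : ℝ), (0 : ℝ)), by simp⟩ hcont
  have hp1 : (1 : ℝ) ≤ p.1 := hp.1.1
  have hpos : 0 < ‖Gamma (p.1 + p.2 * I)‖ := norm_pos_iff.2 (Gamma_ne_zero_of_re_pos (by simp; linarith))
  refine ⟨min ‖Gamma (p.1 + p.2 * I)‖ (Real.exp (-1)), lt_min hpos (Real.exp_pos _), fun x y hx1 hx2 hy => ?_⟩
  rcases le_total y 1 with hy1 | hy1
  · have := hmin (show (x, y) ∈ Icc (1 : ℝ) 2 ×ˢ Icc (0 : ℝ) 1 from ⟨⟨hx1, hx2⟩, ⟨hy, hy1⟩⟩)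
    simp only [mem_ofPred_eq] at this
    have h1 : Real.exp (-(Real.pi / 2 * y)) ≤ 1 := by
      rw [Real.exp_le_one_iff]; have := Real.pi_pos; nlinarith
    calc _ ≤ ‖Gamma (p.1 + p.2 * I)‖ * 1 := by gcongr; exact min_le_left _ _
      _ ≤ ‖Gamma (x + y * I)‖ * (1 + y ^ 2) := by gcongr; nlinarith
  · set z : ℂ := x + y * I with hz
    have hzre : z.re = x := by simp [hz]
    have hzim : z.im = y := by simp [hz]
    have hne : ∀ k : ℝ, 1 ≤ ‖((k : ℂ) - z)‖ := by
      intro k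
      refine le_trans ?_ (abs_im_le_norm _)
      rw [sub_im, ofReal_im, hzim, zero_sub, abs_neg]
      exact hy1.trans (le_abs_self y)
    have hne0 : ∀ k : ℝ, ((k : ℂ) - z) ≠ 0 := fun k h => by
      have := hne k; rw [h, norm_zero] at this; linarith
    have e1 : Gamma (3 - z) = (2 - z) * ((1 - z) * Gamma (1 - z)) := by
      have a1 := Gamma_add_one (1 - z) (by simpa using hne0 1)
      have a2 := Gamma_add_one (2 - z) (by simpa using hne0 2)
      rw [show (2 : ℂ) - z + 1 = 3 - z by ring] at a2
      rw [show (1 : ℂ) - z + 1 = 2 - z by ring] at a1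
      rw [a2, a1]
    have e2 := Complex.Gamma_mul_Gamma_one_sub z
    have hsin : sin (Real.pi * z) ≠ 0 := by
      rw [Ne, sin_eq_zero_iff]
      rintro ⟨k, hk⟩
      have hpi : (Real.pi : ℂ) ≠ 0 := ofReal_ne_zero.2 Real.pi_ne_zero
      have : z = k := mul_left_cancel₀ hpi (by rw [hk, mul_comm])
      have := congrArg im this
      rw [hzim, intCast_im] at this
      linarith
    rw [eq_div_iff hsin] at e2
    have e3 : Gamma z * Gamma (3 - z) * sin (Real.pi * z) = Real.pi * ((2 - z) * (1 - z)) := by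
      rw [e1]; linear_combination (2 - z) * (1 - z) * e2
    have e4 := congrArg norm e3
    rw [norm_mul, norm_mul, norm_mul, norm_mul, norm_real, Real.norm_of_nonneg Real.pi_pos.le] at e4
    have e5 : 1 ≤ ‖Gamma z‖ * ‖Gamma (3 - z)‖ * ‖sin (Real.pi * z)‖ := by
      rw [e4]
      have a1 := hne 1
      have a2 := hne 2
      simp only [ofReal_one, ofReal_ofNat] at a1 a2
      have := one_le_mul_of_one_le_of_one_le a2 a1
      nlinarith [Real.pi_gt_three]
    have e6 : ‖sin (Real.pi * z)‖ ≤ Real.exp (Real.pi * y) := by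
      refine (norm_sin_le _).trans ?_
      rw [im_ofReal_mul, hzim, abs_of_nonneg (by positivity)]
    have e7 : ‖Gamma (3 - z)‖ ≤ (1 + y ^ 2) * Real.exp (1 - Real.pi / 2 * y) := by
      have hconj : (3 - z) = (starRingEnd ℂ) (((3 - x : ℝ) : ℂ) + y * I) := by
        simp only [hz, map_add, map_mul, conj_ofReal, conj_I]; push_cast; ring
      rw [hconj, Gamma_conj, RCLike.norm_conj]
      refine (norm_Gamma_le (by linarith) (by linarith)).trans ?_
      gcongr
      calc Real.Gamma (3 - x) * (1 + y ^ 2) ^ ((3 - x) / 2) ≤ 1 * (1 + y ^ 2) ^ (1 : ℝ) := by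
            gcongr
            · exact Gamma_le_one (by linarith) (by linarith)
            · nlinarith
            · linarith
        _ = 1 + y ^ 2 := by rw [Real.rpow_one, one_mul]
    calc _ ≤ Real.exp (-1) * Real.exp (-(Real.pi / 2 * y)) * 1 := by
          rw [mul_one]; gcongr; exact min_le_right _ _
      _ ≤ Real.exp (-1) * Real.exp (-(Real.pi / 2 * y)) * (‖Gamma z‖ * ((1 + y ^ 2) * Real.exp (1 - Real.pi / 2 * y)) * Real.exp (Real.pi * y)) := by
          gcongr
          refine e5.trans ?_
          gcongr
      _ = ‖Gamma z‖ * (1 + y ^ 2) * (Real.exp (-1) * Real.exp (-(Real.pi / 2 * y)) * Real.exp (1 - Real.pi / 2 * y) * Real.exp (Real.pi * y)) := by ring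
      _ = _ := by
        rw [← Real.exp_add, ← Real.exp_add, ← Real.exp_add]
        rw [show -1 + -(Real.pi / 2 * y) + (1 - Real.pi / 2 * y) + Real.pi * y = 0 by ring, Real.exp_zero, mul_one]

/-- A substitute for Stirling's formula. The functional equation, applied repeatedly from the strip
1 ≤ Re z ≤ 2, produces a factor j!, which beats π^j. A final factor z - 1 supplies |z|, up to the
constant 2. -/
theorem exists_norm_Gamma_ge (M : ℝ) : ∃ X : ℝ, ∀ z : ℂ, X ≤ z.re → 0 ≤ z.im →
    M * ‖z‖ * Real.pi ^ z.re * Real.exp (-(Real.pi / 2 * z.im)) < ‖Gamma z‖ := by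
  obtain ⟨c, hc, hlow⟩ := exists_norm_Gamma_ge_strip
  have hshift : ∀ (x y : ℝ), 1 ≤ x → x ≤ 2 → 0 ≤ y → ∀ j : ℕ,
      c * j.factorial * Real.exp (-(Real.pi / 2 * y)) ≤ ‖Gamma (x + y * I + 2 + j)‖ := by
    intro x y hx1 hx2 hy j
    have hre : ∀ k : ℝ, 0 ≤ k → ∀ z : ℂ, z = x + y * I + k → k + 1 ≤ ‖z‖ ∧ z ≠ 0 := by
      intro k hk z hz
      have h1 : z.re = x + k := by simp [hz]
      have h2 := re_le_norm z
      have h3 : k + 1 ≤ ‖z‖ := by linarith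
      exact ⟨h3, norm_pos_iff.1 (by linarith)⟩
    induction j with
    | zero =>
      have h0 := (hre 0 le_rfl _ rfl).2
      have h1 := (hre 1 zero_le_one _ rfl).2
      have e1 := Gamma_add_one _ h0
      have e2 := Gamma_add_one _ h1
      simp only [ofReal_zero, add_zero, ofReal_one] at e1 e2
      have e3 : (x + y * I + 2 + (0 : ℕ) : ℂ) = x + y * I + 1 + 1 := by push_cast; ring
      rw [e3, e2, e1, norm_mul, norm_mul]
      have a1 : 1 + y ^ 2 ≤ ‖(x + y * I : ℂ)‖ ^ 2 := by
        rw [← normSq_eq_norm_sq, normSq_apply]; simp; nlinarith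
      have a2 : ‖(x + y * I : ℂ)‖ ≤ ‖(x + y * I + 1 : ℂ)‖ := by
        rw [← sq_le_sq₀ (norm_nonneg _) (norm_nonneg _), ← normSq_eq_norm_sq, ← normSq_eq_norm_sq, normSq_apply, normSq_apply]
        simp; nlinarith
      have a3 := hlow x y hx1 hx2 hy
      simp only [Nat.factorial_zero, Nat.cast_one, mul_one]
      have a4 := norm_nonneg (x + y * I : ℂ)
      calc _ ≤ ‖Gamma (x + y * I)‖ * (1 + y ^ 2) := a3
        _ ≤ ‖Gamma (x + y * I)‖ * (‖(x + y * I + 1 : ℂ)‖ * ‖(x + y * I : ℂ)‖) := by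
            gcongr; nlinarith
        _ = _ := by ring
    | succ j ih =>
      have hj := hre (2 + j) (by positivity) _ rfl
      have e1 := Gamma_add_one _ hj.2
      have e2 : (x + y * I + ((2 + j : ℝ) : ℂ)) = x + y * I + 2 + j := by push_cast; ring
      rw [e2] at e1 hj
      have e3 : (x + y * I + 2 + (j + 1 : ℕ) : ℂ) = x + y * I + 2 + j + 1 := by push_cast; ring
      rw [e3, e1, norm_mul, Nat.factorial_succ]
      push_cast
      calc _ = ((j : ℝ) + 1) * (c * j.factorial * Real.exp (-(Real.pi / 2 * y))) := by ring
        _ ≤ _ := by gcongr; linarith [hj.1]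
  have hfac : ∀ᶠ j : ℕ in atTop, |M| * Real.pi ^ (5 : ℝ) * Real.pi ^ j < c / 2 * j.factorial := by
    have := (FloorSemiring.tendsto_pow_div_factorial_atTop Real.pi).const_mul (|M| * Real.pi ^ (5 : ℝ))
    rw [mul_zero] at this
    filter_upwards [this.eventually_lt_const (half_pos hc)] with j hj
    have hjp : (0 : ℝ) < j.factorial := by positivity
    rw [← mul_div_assoc, div_lt_iff₀ hjp] at hj
    exact hj
  obtain ⟨J, hJ⟩ := eventually_atTop.1 hfac
  refine ⟨J + 5, fun z hz1 hz2 => ?_⟩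
  have hz4 : (0 : ℝ) ≤ z.re - 4 := by have : (0 : ℝ) ≤ J := J.cast_nonneg; linarith
  set j := ⌊z.re - 4⌋₊ with hj
  have hj1 : (j : ℝ) ≤ z.re - 4 := Nat.floor_le hz4
  have hj2 : z.re - 4 < j + 1 := Nat.lt_floor_add_one _
  have hjJ : J ≤ j := Nat.le_floor (by linarith)
  -- This choice puts x in [1, 2) with z - 1 = (x + i Im z) + 2 + j. Since Re z < j + 5, the power
  -- π^(Re z) costs at most π^5 π^j.
  set x := z.re - 3 - j with hx
  have hzx : (x + z.im * I + 2 + j : ℂ) = z - 1 := by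
    apply Complex.ext <;> simp [hx]
    ring
  have h1 := hshift x z.im (by linarith) (by linarith) hz2 j
  rw [hzx] at h1
  have hz1n : z.re - 1 ≤ ‖z - 1‖ := by
    have := re_le_norm (z - 1)
    simpa using this
  have hz10 : z - 1 ≠ 0 := norm_pos_iff.1 (by linarith [(J.cast_nonneg : (0 : ℝ) ≤ J)])
  have e1 := Gamma_add_one _ hz10
  rw [sub_add_cancel] at e1
  have hhalf : ‖z‖ / 2 ≤ ‖z - 1‖ := by
    have := norm_sub_norm_le z 1
    rw [norm_one] at this
    linarith [(J.cast_nonneg : (0 : ℝ) ≤ J)]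
  have hzpos : 0 < ‖z‖ := by
    have := re_le_norm z
    linarith [(J.cast_nonneg : (0 : ℝ) ≤ J)]
  rw [e1, norm_mul]
  have hpow : Real.pi ^ z.re ≤ Real.pi ^ (5 : ℝ) * Real.pi ^ j := by
    rw [← Real.rpow_natCast, ← Real.rpow_add Real.pi_pos]
    exact Real.rpow_le_rpow_of_exponent_le (by linarith [Real.pi_gt_three]) (by linarith)
  calc M * ‖z‖ * Real.pi ^ z.re * Real.exp (-(Real.pi / 2 * z.im))
      ≤ |M| * ‖z‖ * (Real.pi ^ (5 : ℝ) * Real.pi ^ j) * Real.exp (-(Real.pi / 2 * z.im)) := by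
        gcongr; exact le_abs_self M
    _ = (|M| * Real.pi ^ (5 : ℝ) * Real.pi ^ j) * (‖z‖ * Real.exp (-(Real.pi / 2 * z.im))) := by ring
    _ < (c / 2 * j.factorial) * (‖z‖ * Real.exp (-(Real.pi / 2 * z.im))) := by
        exact mul_lt_mul_of_pos_right (hJ j hjJ) (by positivity)
    _ = ‖z‖ / 2 * (c * j.factorial * Real.exp (-(Real.pi / 2 * z.im))) := by ring
    _ ≤ ‖z - 1‖ * ‖Gamma (z - 1)‖ := by gcongr

/-! ### A zero-free region of G to the upper right -/

theorem I_mul_one_sub_cpow {y : ℝ} (hy : 0 ≤ y) (w : ℂ) : ((y : ℂ) + I) ^ w = I ^ w * (1 - I * y) ^ w := by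
  have h0 : (y : ℂ) + I ≠ 0 := by intro h; have := congrArg im h; simp at this
  have h1 := one_sub_I_mul_ne_zero y
  have hmul : (y : ℂ) + I = I * (1 - I * y) := by linear_combination (y : ℂ) * I_sq
  have ha1 : arg (1 - I * y : ℂ) ≤ 0 := by
    rcases hy.eq_or_lt with h | h
    · rw [← h]; simp
    · exact (arg_neg_iff.2 (by simpa using h)).le
  have ha2 : -(Real.pi / 2) ≤ arg (1 - I * y : ℂ) :=
    (neg_pi_div_two_le_arg_iff.2 (Or.inl (by simp)))
  have hlog : log ((y : ℂ) + I) = log I + log (1 - I * y) := by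
    rw [hmul]
    refine (log_mul_eq_add_log_iff I_ne_zero h1).2 ?_
    rw [arg_I]
    constructor <;> linarith [Real.pi_pos]
  rw [cpow_def_of_ne_zero h0, cpow_def_of_ne_zero I_ne_zero, cpow_def_of_ne_zero h1, hlog, add_mul, exp_add]

/-- As n² and n have the same parity, the alternating sign is the value of e^(-πn²z) at z = i. It
disappears once the integral is written on the ray above i. -/
theorem exp_neg_pi_mul_succ_sq_I (n : ℕ) : exp (-(Real.pi * ((((n : ℝ) + 1) ^ 2 : ℝ) : ℂ) * I)) = (-1) ^ (n + 1) := by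
  have h1 : -(Real.pi * ((((n : ℝ) + 1) ^ 2 : ℝ) : ℂ) * I) = (((n + 1) ^ 2 : ℕ) : ℂ) * (-Real.pi * I) := by
    push_cast; ring
  rw [h1, exp_nat_mul, neg_mul, exp_neg, exp_pi_mul_I]
  norm_num
  rw [sq, pow_mul]
  rcases Nat.even_or_odd (n + 1) with h | h
  · simp [h.neg_one_pow]
  · simp [h.neg_one_pow]

/-- Moving the path of `∫ z ^ w e ^ (-π m z)` from the ray above `I` to the real axis. -/
theorem integral_rect {m : ℝ} (hm : 1 ≤ m) {w : ℂ} (hw : 0 < w.re) :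
    ∫ y in Ioi (0 : ℝ), ((y : ℂ) + I) ^ w * exp (-(Real.pi * m * (y + I))) =
      (∫ y in Ioi (0 : ℝ), (y : ℂ) ^ w * exp (-(Real.pi * m * y))) -
        I * ∫ v in (0 : ℝ)..1, (v * I) ^ w * exp (-(Real.pi * m * (v * I))) := by
  set h : ℂ → ℂ := fun z => z ^ w * exp (-(Real.pi * m * z)) with hh
  have hpm : 0 < Real.pi * m := by have := Real.pi_pos; positivity
  have hint1 : IntegrableOn (fun y : ℝ => h y) (Ioi 0) := by
    have := integrableOn_cpow_mul_exp_neg_mul (a := w + 1) (w := Real.pi * m) (by simp; linarith)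
      (by rw [← ofReal_mul, ofReal_re]; exact hpm)
    simpa using this
  have hint2 : IntegrableOn (fun y : ℝ => h (y + I)) (Ioi 0) := by
    have hb : IntegrableOn (fun y : ℝ => ‖I ^ w‖ * Real.exp (6 * (‖w‖ + 1) * √(‖w‖ + 1)) *
      Real.exp (-(Real.pi - 1) * y)) (Ioi 0) :=
      (integrableOn_exp_neg (by linarith [Real.pi_gt_three])).const_mul _
    have hcont : Continuous fun y : ℝ => h (y + I) := by
      refine Continuous.mul ?_ (by fun_prop)
      exact Continuous.cpow (by fun_prop) continuous_const fun y => Or.inr (by simp)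
    refine hb.mono' hcont.aestronglyMeasurable ((ae_restrict_iff' measurableSet_Ioi).2 (Eventually.of_forall fun y hy => ?_))
    have hy' : (0 : ℝ) < y := hy
    simp only [hh]
    rw [norm_mul, I_mul_one_sub_cpow hy'.le, norm_mul, norm_exp]
    calc _ ≤ ‖I ^ w‖ * (Real.exp (6 * (‖w‖ + 1) * √(‖w‖ + 1)) * Real.exp y) * Real.exp (-(Real.pi * y)) := by
          gcongr
          · exact norm_one_sub_I_mul_cpow_le hy'.le w
          · simp
            nlinarith [mul_nonneg (mul_nonneg Real.pi_pos.le (sub_nonneg.2 hm)) hy'.le]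
      _ = ‖I ^ w‖ * Real.exp (6 * (‖w‖ + 1) * √(‖w‖ + 1)) * (Real.exp y * Real.exp (-(Real.pi * y))) := by ring
      _ = _ := by rw [← Real.exp_add]; ring_nf
  have hrect : ∀ X : ℝ, 0 < X → (∫ x in (0 : ℝ)..X, h x) - (∫ x in (0 : ℝ)..X, h (x + I)) +
      I * (∫ v in (0 : ℝ)..1, h (X + v * I)) - I * (∫ v in (0 : ℝ)..1, h (v * I)) = 0 := by
    intro X hX
    have := integral_boundary_rect_eq_zero_of_continuousOn_of_differentiableOn h 0 (X + I) ?_ ?_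
    · simpa using this
    · intro z hz
      rw [mem_reProdIm] at hz
      simp [uIcc_of_le hX.le] at hz
      refine ContinuousAt.continuousWithinAt ?_
      exact (continuousAt_cpow_const_of_re_pos (Or.inl hz.1.1) hw).mul (by fun_prop)
    · intro z hz
      rw [mem_reProdIm] at hz
      simp [hX.le] at hz
      refine DifferentiableAt.differentiableWithinAt ?_
      exact (differentiableAt_id.cpow_const (Or.inl hz.1.1)).mul (by fun_prop)
  have t1 := intervalIntegral_tendsto_integral_Ioi 0 hint1 tendsto_id
  have t2 := intervalIntegral_tendsto_integral_Ioi 0 hint2 tendsto_id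
  have t3 : Tendsto (fun X : ℝ => ∫ v in (0 : ℝ)..1, h (X + v * I)) atTop (𝓝 0) := by
    -- On the right side the power costs about e^X and the exponential gains at least e^(-3X), which
    -- leaves e^(-2X).
    have hlim : Tendsto (fun X : ℝ => Real.exp (Real.pi * |w.im| + (1 + 2 * (w.re + 1) * √(w.re + 1)) - 2 * X)) atTop (𝓝 0) := by
      refine Real.tendsto_exp_atBot.comp ?_
      refine tendsto_const_nhds.add_atBot ?_
      exact tendsto_neg_atTop_atBot.comp (tendsto_id.const_mul_atTop two_pos)
    refine squeeze_zero_norm' ((eventually_gt_atTop 0).mono fun X hX => ?_) hlim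
    refine (intervalIntegral.norm_integral_le_of_norm_le_const (C := Real.exp (Real.pi * |w.im| + (1 + 2 * (w.re + 1) * √(w.re + 1)) - 2 * X)) fun v hv => ?_).trans_eq (by simp)
    rw [uIoc_of_le zero_le_one] at hv
    have hz0 : (X + v * I : ℂ) ≠ 0 := by intro h; have := congrArg re h; simp at this; linarith
    have hzn : ‖(X + v * I : ℂ)‖ ≤ 1 + X := by
      refine (norm_add_le _ _).trans ?_
      simp [abs_of_pos hX, abs_of_pos hv.1]
      linarith [hv.2]
    have h1 := norm_cpow_neg_le (-w) _ hz0
    rw [neg_neg, neg_re, neg_im, neg_neg, abs_neg] at h1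
    have h2 : (1 + X) ^ w.re ≤ Real.exp (X + 2 * (w.re + 1) * √(w.re + 1)) := by
      rw [Real.rpow_def_of_pos (by linarith)]
      gcongr
      rw [mul_comm]
      exact mul_log_one_add_le hw.le hX.le
    simp only [hh]
    rw [norm_mul, norm_exp]
    calc _ ≤ (Real.exp (X + 2 * (w.re + 1) * √(w.re + 1)) * Real.exp (Real.pi * |w.im|)) * Real.exp (-(3 * X)) := by
          gcongr
          · refine h1.trans ?_
            gcongr
            refine le_trans ?_ h2
            gcongr
          · simp
            nlinarith [mul_nonneg (mul_nonneg Real.pi_pos.le (sub_nonneg.2 hm)) hX.le, Real.pi_gt_three]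
      _ ≤ _ := by
          rw [← Real.exp_add, ← Real.exp_add]
          gcongr
          linarith
  have t4 := ((t1.sub t2).add (t3.const_mul I)).sub_const (I * (∫ v in (0 : ℝ)..1, h (v * I)))
  have t5 : Tendsto (fun X : ℝ => (∫ x in (0 : ℝ)..X, h x) - (∫ x in (0 : ℝ)..X, h (x + I)) +
      I * (∫ v in (0 : ℝ)..1, h (X + v * I)) - I * (∫ v in (0 : ℝ)..1, h (v * I))) atTop (𝓝 0) :=
    tendsto_const_nhds.congr' ((eventually_gt_atTop 0).mono fun X hX => (hrect X hX).symm)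
  have := tendsto_nhds_unique t4 t5
  linear_combination -this

/-- The exponential is unimodular on the segment from 0 to i, so one integration by parts gains 1/m.
The boundary term at 0 vanishes because Re w > 0. -/
theorem norm_segment_integral_le {m : ℝ} (hm : 1 ≤ m) {w : ℂ} (hw : 1 < w.re) :
    ‖∫ v in (0 : ℝ)..1, (v : ℂ) ^ w * exp (-(Real.pi * m * (v * I)))‖ ≤ (1 + ‖w‖) / m := by
  have hm0 : 0 < m := by linarith
  have hw1 : 0 < (w - 1).re := by simp; linarith
  have hcont : ∀ u : ℂ, 0 < u.re → Continuous fun v : ℝ => (v : ℂ) ^ u * exp (-(Real.pi * m * (v * I))) := by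
    intro u hu
    exact (continuous_ofReal_cpow_const hu).mul (by fun_prop)
  have hexp : ∀ v : ℝ, ‖exp (-(Real.pi * m * (v * I)))‖ = 1 := by
    intro v; rw [norm_exp]; simp
  have hnorm : ‖∫ v in (0 : ℝ)..1, (v : ℂ) ^ (w - 1) * exp (-(Real.pi * m * (v * I)))‖ ≤ 1 := by
    refine (intervalIntegral.norm_integral_le_of_norm_le_const (C := 1) fun v hv => ?_).trans_eq (by simp)
    rw [uIoc_of_le zero_le_one] at hv
    rw [norm_mul, hexp, mul_one, norm_cpow_eq_rpow_re_of_pos hv.1]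
    exact Real.rpow_le_one hv.1.le hv.2 hw1.le
  have hder : ∀ v ∈ Ioo (0 : ℝ) 1, HasDerivAt (fun v : ℝ => (v : ℂ) ^ w * exp (-(Real.pi * m * (v * I))))
      (w * ((v : ℂ) ^ (w - 1) * exp (-(Real.pi * m * (v * I)))) +
        -(Real.pi * m * I) * ((v : ℂ) ^ w * exp (-(Real.pi * m * (v * I))))) v := by
    intro v hv
    have e1 : HasDerivAt (fun v : ℝ => exp (-(Real.pi * m * (v * I)))) (exp (-(Real.pi * m * (v * I))) * -(Real.pi * m * I)) v := by
      have := (((hasDerivAt_id v).ofReal_comp.mul_const I).const_mul (Real.pi * m : ℂ)).neg.cexp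
      simpa using this
    have e2 : HasDerivAt (fun v : ℝ => (v : ℂ) ^ w) (w * (v : ℂ) ^ (w - 1)) v := by
      have h1 : (v : ℂ) ∈ slitPlane := Or.inl (by rw [ofReal_re]; exact hv.1)
      have := ((hasDerivAt_id (v : ℂ)).cpow_const (c := w) h1).comp v (hasDerivAt_id v).ofReal_comp
      simpa [Function.comp_def] using this
    exact (e2.mul e1).congr_deriv (by ring)
  have i1 := ((hcont (w - 1) hw1).intervalIntegrable (μ := volume) 0 1).const_mul w
  have i2 := ((hcont w (by linarith)).intervalIntegrable (μ := volume) 0 1).const_mul (-(Real.pi * m * I))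
  have hftc := intervalIntegral.integral_eq_sub_of_hasDerivAt_of_le zero_le_one
    (hcont w (by linarith)).continuousOn hder (i1.add i2)
  rw [intervalIntegral.integral_add i1 i2, intervalIntegral.integral_const_mul, intervalIntegral.integral_const_mul] at hftc
  have hw0 : w ≠ 0 := by rintro rfl; simp at hw; linarith
  simp only [ofReal_one, one_cpow, one_mul, ofReal_zero, zero_cpow hw0, zero_mul, sub_zero] at hftc
  set A := ∫ v in (0 : ℝ)..1, (v : ℂ) ^ w * exp (-(Real.pi * m * (v * I)))
  set B := ∫ v in (0 : ℝ)..1, (v : ℂ) ^ (w - 1) * exp (-(Real.pi * m * (v * I)))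
  have h1 : (Real.pi * m * I) * A = w * B - exp (-(Real.pi * m * I)) := by linear_combination -hftc
  have h2 := congrArg norm h1
  rw [norm_mul, norm_mul, norm_mul, norm_I, norm_real, norm_real, Real.norm_of_nonneg Real.pi_pos.le,
    Real.norm_of_nonneg hm0.le] at h2
  have h3 : ‖w * B - exp (-(Real.pi * m * I))‖ ≤ ‖w‖ + 1 := by
    refine (norm_sub_le _ _).trans ?_
    have := hexp 1
    rw [ofReal_one, one_mul] at this
    rw [this, norm_mul]
    gcongr
    exact mul_le_of_le_one_right (norm_nonneg w) hnorm
  rw [le_div_iff₀ hm0]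
  nlinarith [Real.pi_gt_three, mul_nonneg hm0.le (norm_nonneg A)]

theorem cpow_ofReal_mul_I {v : ℝ} (hv : 0 < v) (w : ℂ) : ((v : ℂ) * I) ^ w = I ^ w * (v : ℂ) ^ w := by
  have hv0 : (v : ℂ) ≠ 0 := ofReal_ne_zero.2 hv.ne'
  rw [cpow_def_of_ne_zero (mul_ne_zero hv0 I_ne_zero), cpow_def_of_ne_zero hv0, cpow_def_of_ne_zero I_ne_zero,
    log_ofReal_mul hv I_ne_zero, ofReal_log hv.le, add_mul, exp_add, mul_comm]

/-- With z = y + i one has 1 - iy = z/i, so the signed theta integral is an integral of z^(s/2-1)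
e^(-πmz) along the ray above i. Moving that ray to the real axis leaves Γ(s/2) π^(-s/2) (n+1)^(-s),
a term of the zeta series, and the segment from 0 to i. -/
theorem thetaInt_one_right (n : ℕ) {s : ℂ} (hs : 4 < s.re) :
    I ^ (s / 2 - 1) * ((-1) ^ (n + 1) * thetaInt 1 (((n : ℝ) + 1) ^ 2) s) =
      (Real.pi : ℂ) ^ (-(s / 2)) * Gamma (s / 2) * ((((n : ℝ) + 1) ^ 2 : ℝ) : ℂ) ^ (-(s / 2)) -
        I * (I ^ (s / 2 - 1) * ∫ v in (0 : ℝ)..1, (v : ℂ) ^ (s / 2 - 1) *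
          exp (-(Real.pi * ((((n : ℝ) + 1) ^ 2 : ℝ) : ℂ) * (v * I)))) := by
  set m : ℝ := ((n : ℝ) + 1) ^ 2 with hm
  have hm1 : 1 ≤ m := by have : (0 : ℝ) ≤ n := n.cast_nonneg; rw [hm]; nlinarith
  have hm0 : 0 < m := by linarith
  set w := s / 2 - 1 with hw
  have hwre : 1 < w.re := by simp [hw]; linarith
  have h1 := integral_rect hm1 (w := w) (by linarith)
  have h2 : ∫ y in Ioi (0 : ℝ), ((y : ℂ) + I) ^ w * exp (-(Real.pi * m * (y + I))) =
      I ^ w * ((-1) ^ (n + 1) * thetaInt 1 m s) := by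
    rw [thetaInt, one_mul, ← mul_assoc, ← integral_const_mul]
    refine setIntegral_congr_fun measurableSet_Ioi fun y hy => ?_
    have hy' : (0 : ℝ) < y := hy
    rw [I_mul_one_sub_cpow hy'.le, mul_add, neg_add, exp_add, hm, exp_neg_pi_mul_succ_sq_I, hw]
    simp only [mul_one]
    ring
  have h3 : ∫ v in (0 : ℝ)..1, (v * I : ℂ) ^ w * exp (-(Real.pi * m * (v * I))) =
      I ^ w * ∫ v in (0 : ℝ)..1, (v : ℂ) ^ w * exp (-(Real.pi * m * (v * I))) := by
    rw [← intervalIntegral.integral_const_mul]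
    refine intervalIntegral.integral_congr_ae (Eventually.of_forall fun v hv => ?_)
    rw [uIoc_of_le zero_le_one] at hv
    rw [cpow_ofReal_mul_I hv.1, mul_assoc]
  have h4 : ∫ y in Ioi (0 : ℝ), (y : ℂ) ^ w * exp (-(Real.pi * m * y)) =
      (Real.pi : ℂ) ^ (-(s / 2)) * Gamma (s / 2) * (m : ℂ) ^ (-(s / 2)) := by
    have hpm : 0 < Real.pi * m := by have := Real.pi_pos; positivity
    have := integral_cpow_mul_exp_neg_mul (a := s / 2) (w := Real.pi * m) (by simp; linarith)
      (by rw [← ofReal_mul, ofReal_re]; exact hpm)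
    rw [← hw] at this
    rw [this, mul_cpow_ofReal_nonneg Real.pi_pos.le hm0.le]
    ring
  rw [← h2, h1, h3, h4]

/-- `R` has no nontrivial zeros far to the right in the upper half plane. -/
theorem exists_auxG_ne_zero : ∃ σ₀ : ℝ, ∀ s : ℂ, σ₀ ≤ s.re → 0 ≤ s.im → auxG s ≠ 0 := by
  -- The constant is fixed by the end of the argument: with |ζ(s)| ≥ 1/4, a zero would give 40 ·
  -- (|s|/2) · (1/4) = 5|s| < 5 + 2|s|, which is impossible once |s| ≥ 5.
  obtain ⟨X, hX⟩ := exists_norm_Gamma_ge 40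
  refine ⟨max (2 * X) 5, fun s hs ht h0 => ?_⟩
  have hs1 : X ≤ (s / 2).re := by
    have := (le_max_left _ _).trans hs
    simp; linarith
  have hs2 : 5 ≤ s.re := (le_max_right _ _).trans hs
  have hn1 : ∀ n : ℕ, (1 : ℝ) ≤ ((n : ℝ) + 1) ^ 2 := fun n => by
    have : (0 : ℝ) ≤ n := n.cast_nonneg
    nlinarith
  have hsn : 5 ≤ ‖s‖ := hs2.trans (re_le_norm s)
  obtain ⟨hsum, hsum2⟩ := tsum_one_div_sq_le
  set w := s / 2 - 1 with hw
  have hwn : ‖w‖ ≤ 1 + ‖s‖ := by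
    have := norm_sub_le (s / 2) 1
    rw [norm_div, Complex.norm_two, norm_one] at this
    linarith [norm_nonneg s]
  have hwre : 1 < w.re := by simp [hw]; linarith
  set a : ℕ → ℂ := fun n => ((((n : ℝ) + 1) ^ 2 : ℝ) : ℂ) ^ (-(s / 2)) with ha
  set b : ℕ → ℂ := fun n => ∫ v in (0 : ℝ)..1, (v : ℂ) ^ w * exp (-(Real.pi * ((((n : ℝ) + 1) ^ 2 : ℝ) : ℂ) * (v * I))) with hb
  have hbn : ∀ n, ‖b n‖ ≤ (2 + ‖s‖) * (1 / ((n : ℝ) + 1) ^ 2) := by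
    intro n
    refine (norm_segment_integral_le (hn1 n) hwre).trans ?_
    rw [mul_one_div]
    exact div_le_div_of_nonneg_right (by linarith) (by positivity)
  have hbs : Summable b := Summable.of_norm_bounded (hsum.mul_left _) hbn
  have hbt : ‖∑' n, b n‖ ≤ (2 + ‖s‖) * 2 := by
    refine (tsum_of_norm_bounded (hsum.mul_left (2 + ‖s‖)).hasSum hbn).trans ?_
    rw [tsum_mul_left]; gcongr
  have han : ∀ n, ‖a n‖ ≤ 1 / ((n : ℝ) + 1) ^ 2 := by
    intro n
    simp only [ha]
    rw [norm_cpow_eq_rpow_re_of_pos (by linarith [hn1 n])]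
    calc _ ≤ (((n : ℝ) + 1) ^ 2) ^ (-1 : ℝ) := by
          refine Real.rpow_le_rpow_of_exponent_le (hn1 n) ?_
          simp; linarith
      _ = _ := by rw [Real.rpow_neg_one, one_div]
  have has : Summable a := Summable.of_norm_bounded hsum han
  have hat : 1 / 4 ≤ ‖∑' n, a n‖ := by
    have h1 := has.tsum_eq_zero_add
    have h2 : a 0 = 1 := by simp [ha]
    have h3 : ‖∑' n, a (n + 1)‖ ≤ 3 / 4 := by
      refine (tsum_of_norm_bounded ((summable_nat_add_iff 1).2 hsum).hasSum fun n => han (n + 1)).trans ?_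
      have h4 := hsum.tsum_eq_zero_add
      have h5 := hasSum_zeta_two
      have h6 := h5.summable.tsum_eq_zero_add
      rw [h5.tsum_eq] at h6
      simp only [Nat.cast_add, Nat.cast_one, Nat.cast_zero] at h6 h4 ⊢
      norm_num at h6 h4 ⊢
      rw [← h6] at h4
      nlinarith [Real.pi_lt_d2, Real.pi_pos]
    rw [h1, h2]
    have := norm_sub_norm_le (1 : ℂ) (-∑' n, a (n + 1))
    rw [norm_one, norm_neg, sub_neg_eq_add] at this
    linarith
  -- the expansion of `altInt`
  have hexp : I ^ w * altInt s = (Real.pi : ℂ) ^ (-(s / 2)) * Gamma (s / 2) * (∑' n, a n) - I * (I ^ w * ∑' n, b n) := by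
    have h1 := ((hasSum_thetaInt_one s).mul_left (I ^ w))
    have h2 := ((has.hasSum.mul_left ((Real.pi : ℂ) ^ (-(s / 2)) * Gamma (s / 2))).sub ((hbs.hasSum.mul_left (I ^ w)).mul_left I))
    refine h1.unique (h2.congr_fun ?_)
    intro n
    exact thetaInt_one_right n (by linarith)
  -- This is exactly the decay in the lower bound for Γ(s/2) when Im s ≥ 0, so the two exponentials
  -- cancel. In the lower half plane the comparison would fail.
  have hI : ‖I ^ w‖ = Real.exp (-(Real.pi / 4 * s.im)) := by
    rw [norm_cpow_of_ne_zero I_ne_zero, norm_I, Real.one_rpow, arg_I, one_div, ← Real.exp_neg]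
    congr 1
    simp [hw]; ring
  have hI1 : ‖I ^ w‖ ≤ 1 := by
    rw [hI, Real.exp_le_one_iff]
    have := mul_nonneg Real.pi_pos.le ht
    linarith
  have halt : ‖altInt s‖ ≤ 1 := by
    rw [auxG] at h0
    have h1 : I * s * altInt s = -1 := by linear_combination -h0
    have h2 := congrArg norm h1
    rw [norm_mul, norm_mul, norm_I, norm_neg, norm_one, one_mul] at h2
    nlinarith [norm_nonneg (altInt s)]
  have hG := hX (s / 2) hs1 (by simp; linarith)
  have h5 : (Real.pi : ℂ) ^ (-(s / 2)) * Gamma (s / 2) * (∑' n, a n) = I ^ w * (altInt s + I * ∑' n, b n) := by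
    linear_combination -hexp
  have h6 := congrArg norm h5
  rw [norm_mul, norm_mul, norm_mul, hI, norm_cpow_eq_rpow_re_of_pos Real.pi_pos, neg_re, Real.rpow_neg Real.pi_pos.le] at h6
  have h7 : ‖altInt s + I * ∑' n, b n‖ ≤ 1 + (2 + ‖s‖) * 2 := by
    refine (norm_add_le _ _).trans ?_
    rw [norm_mul, norm_I, one_mul]
    gcongr
  have him : (s / 2).im = s.im / 2 := by simp
  have hnn : ‖s / 2‖ = ‖s‖ / 2 := by rw [norm_div, Complex.norm_two]
  rw [him, hnn, show Real.pi / 2 * (s.im / 2) = Real.pi / 4 * s.im by ring] at hG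
  set P := Real.pi ^ (s / 2).re with hP
  have hPp : 0 < P := Real.rpow_pos_of_pos Real.pi_pos _
  set E := Real.exp (-(Real.pi / 4 * s.im)) with hE
  have hEp : 0 < E := Real.exp_pos _
  have h8 : P⁻¹ * (40 * (‖s‖ / 2) * P * E) * (1 / 4) < E * (1 + (2 + ‖s‖) * 2) := by
    calc _ < P⁻¹ * ‖Gamma (s / 2)‖ * (1 / 4) := by gcongr
      _ ≤ P⁻¹ * ‖Gamma (s / 2)‖ * ‖∑' n, a n‖ := by gcongr
      _ = E * ‖altInt s + I * ∑' n, b n‖ := h6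
      _ ≤ _ := by gcongr
  have h9 : P⁻¹ * (40 * (‖s‖ / 2) * P * E) * (1 / 4) = E * (5 * ‖s‖) := by field_simp; ring
  rw [h9] at h8
  have := lt_of_mul_lt_mul_left h8 hEp.le
  linarith

/-! ### Zeros of entire functions of order at most 3/2 -/

section Entire

variable {f : ℂ → ℂ} {c : ℂ}

theorem analyticOrderAt_ne_top_of_entire (hf : Differentiable ℂ f) (hc : f c ≠ 0) (ρ : ℂ) :
    analyticOrderAt f ρ ≠ ⊤ := by
  have h : AnalyticOnNhd ℂ f univ := fun z _ => hf.analyticAt z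
  refine h.analyticOrderAt_ne_top_of_isPreconnected isPreconnected_univ (mem_univ c) (mem_univ ρ) ?_
  rw [(hf.analyticAt c).analyticOrderAt_eq_zero.2 hc]
  exact ENat.zero_ne_top

theorem exists_entire_quotient (hf : Differentiable ℂ f) {ρ : ℂ} {k : ℕ}
    (hk : analyticOrderAt f ρ = k) :
    ∃ g : ℂ → ℂ, Differentiable ℂ g ∧ g ρ ≠ 0 ∧ ∀ z, f z = (z - ρ) ^ k * g z := by
  obtain ⟨g, hg, hg0, hfg⟩ := (hf.analyticAt ρ).analyticOrderAt_eq_natCast.1 hk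
  have hne : ∀ z, z ≠ ρ → Function.update (fun z => f z / (z - ρ) ^ k) ρ (g ρ) z
      = f z / (z - ρ) ^ k := fun z hz => Function.update_of_ne hz _ _
  refine ⟨Function.update (fun z => f z / (z - ρ) ^ k) ρ (g ρ), ?_, by simpa using hg0, ?_⟩
  · intro z
    rcases eq_or_ne z ρ with rfl | hz
    · refine hg.differentiableAt.congr_of_eventuallyEq ?_
      filter_upwards [hfg] with w hw
      rcases eq_or_ne w z with rfl | h
      · simp
      · rw [hne w h, hw, smul_eq_mul, mul_div_cancel_left₀ _ (pow_ne_zero _ (sub_ne_zero.2 h))]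
    · have : DifferentiableAt ℂ (fun z => f z / (z - ρ) ^ k) z :=
        (hf z).div (by fun_prop) (pow_ne_zero _ (sub_ne_zero.2 hz))
      refine this.congr_of_eventuallyEq ?_
      filter_upwards [isOpen_ne.mem_nhds hz] with w hw using hne w hw
  · intro z
    rcases eq_or_ne z ρ with rfl | hz
    · have := hfg.self_of_nhds
      simpa using this
    · rw [hne z hz, mul_div_cancel₀ _ (pow_ne_zero _ (sub_ne_zero.2 hz))]

theorem exists_entire_quotient_finset (hf : Differentiable ℂ f) (hc : f c ≠ 0) (S : Finset ℂ) :
    ∃ g : ℂ → ℂ, Differentiable ℂ g ∧ (∀ ρ ∈ S, g ρ ≠ 0) ∧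
      ∀ z, f z = (∏ ρ ∈ S, (z - ρ) ^ analyticOrderNatAt f ρ) * g z := by
  classical
  induction S using Finset.induction_on with
  | empty => exact ⟨f, hf, by simp, by simp⟩
  | insert a S ha ih =>
    obtain ⟨g, hg, hgS, hfg⟩ := ih
    have hgc : g c ≠ 0 := fun h => hc (by rw [hfg, h, mul_zero])
    obtain ⟨k, hk⟩ := ENat.ne_top_iff_exists.1 (analyticOrderAt_ne_top_of_entire hg hgc a)
    obtain ⟨g', hg', hga, hgg⟩ := exists_entire_quotient hg hk.symm
    -- The factors already removed do not vanish at `a`, so the quotient has the same order there as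
    -- `f`.
    have hka : analyticOrderNatAt f a = k := by
      have : analyticOrderAt f a = k := by
        refine (hf.analyticAt a).analyticOrderAt_eq_natCast.2
          ⟨fun z => (∏ ρ ∈ S, (z - ρ) ^ analyticOrderNatAt f ρ) * g' z, ?_, ?_, ?_⟩
        · exact Differentiable.analyticAt (by fun_prop) a
        · refine mul_ne_zero (Finset.prod_ne_zero_iff.2 fun ρ hρ => pow_ne_zero _ (sub_ne_zero.2 ?_)) hga
          rintro rfl
          exact ha hρ
        · refine Eventually.of_forall fun z => ?_
          rw [hfg, hgg, smul_eq_mul]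
          ring
      rw [analyticOrderNatAt, this]
      rfl
    refine ⟨g', hg', ?_, ?_⟩
    · intro ρ hρ
      rcases Finset.mem_insert.1 hρ with rfl | h
      · exact hga
      · intro h0
        exact hgS ρ h (by rw [hgg, h0, mul_zero])
    · intro z
      rw [Finset.prod_insert ha, hka, hfg, hgg]
      ring

theorem analyticOrderNatAt_eq_zero_iff (hf : Differentiable ℂ f) (hc : f c ≠ 0) {ρ : ℂ} :
    analyticOrderNatAt f ρ = 0 ↔ f ρ ≠ 0 := by
  rw [← (hf.analyticAt ρ).analyticOrderAt_eq_zero, analyticOrderNatAt, ENat.toNat_eq_zero]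
  exact or_iff_left (analyticOrderAt_ne_top_of_entire hf hc ρ)

theorem finite_zeros_of_isCompact (hf : Differentiable ℂ f) (hc : f c ≠ 0) {K : Set ℂ}
    (hK : IsCompact K) : {ρ | ρ ∈ K ∧ f ρ = 0}.Finite := by
  have h : AnalyticOnNhd ℂ f univ := fun z _ => hf.analyticAt z
  have h1 := h.preimage_zero_mem_codiscrete hc
  have h2 := hK.finite_sdiff_of_mem_codiscreteWithin (s := f ⁻¹' {0}ᶜ) (by
    exact codiscreteWithin_mono (subset_univ K) h1)
  refine h2.subset ?_
  rintro ρ ⟨h3, h4⟩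
  exact ⟨h3, by simpa using h4⟩

/-- On the circle of radius (q+1)R every removed zero satisfies |z - ρ| ≥ qR ≥ q|c - ρ|; then apply
the maximum principle to the quotient. The case q = 3 counts zeros, as Jensen's formula would, and q
= 1 prepares the estimate of the logarithmic derivative. -/
theorem norm_quotient_le (hc : f c ≠ 0) {S : Finset ℂ} {g : ℂ → ℂ}
    (hg : Differentiable ℂ g)
    (hfg : ∀ z, f z = (∏ ρ ∈ S, (z - ρ) ^ analyticOrderNatAt f ρ) * g z) {R q M : ℝ} (hR : 0 < R)
    (hq : 1 ≤ q) (hS : ∀ ρ ∈ S, ‖c - ρ‖ ≤ R) (hM : ∀ z, ‖z - c‖ = (q + 1) * R → ‖f z‖ ≤ M)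
    {z : ℂ} (hz : ‖z - c‖ ≤ (q + 1) * R) :
    q ^ (∑ ρ ∈ S, analyticOrderNatAt f ρ) * ‖g z‖ ≤ M / ‖f c‖ * ‖g c‖ := by
  have hP0 : (∏ ρ ∈ S, (c - ρ) ^ analyticOrderNatAt f ρ) ≠ 0 :=
    fun h => hc (by rw [hfg, h, zero_mul])
  have hP : 0 < ‖∏ ρ ∈ S, (c - ρ) ^ analyticOrderNatAt f ρ‖ := norm_pos_iff.2 hP0
  have hgc : 0 < ‖g c‖ := norm_pos_iff.2 fun h => hc (by rw [hfg, h, mul_zero])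
  have hr : 0 < (q + 1) * R := by positivity
  have hfr : ∀ w ∈ frontier (Metric.ball c ((q + 1) * R)), ‖g w‖ ≤
      M / (q ^ (∑ ρ ∈ S, analyticOrderNatAt f ρ) * ‖∏ ρ ∈ S, (c - ρ) ^ analyticOrderNatAt f ρ‖) := by
    intro w hw
    rw [frontier_ball c hr.ne', mem_sphere_iff_norm] at hw
    rw [le_div_iff₀ (by positivity)]
    refine le_trans ?_ (hM w hw)
    rw [hfg w, norm_mul, mul_comm]
    refine mul_le_mul_of_nonneg_right ?_ (norm_nonneg _)
    rw [norm_prod, norm_prod, ← Finset.prod_pow_eq_pow_sum, ← Finset.prod_mul_distrib]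
    refine Finset.prod_le_prod (fun _ _ => by positivity) fun ρ hρ => ?_
    rw [norm_pow, norm_pow, ← mul_pow]
    refine pow_le_pow_left₀ (by positivity) ?_ _
    have h1 := hS ρ hρ
    have h2 : ‖w - c‖ ≤ ‖w - ρ‖ + ‖c - ρ‖ := by
      have := norm_sub_le (w - ρ) (c - ρ)
      rwa [sub_sub_sub_cancel_right] at this
    rw [hw] at h2
    nlinarith
  have hmem : z ∈ closure (Metric.ball c ((q + 1) * R)) := by
    rw [closure_ball c hr.ne', Metric.mem_closedBall, dist_eq_norm]
    exact hz
  have := norm_le_of_forall_mem_frontier_norm_le Metric.isBounded_ball hg.diffContOnCl hfr hmem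
  rw [le_div_iff₀ (by positivity)] at this
  rw [hfg c, norm_mul, div_mul_eq_mul_div, le_div_iff₀ (by positivity)]
  nlinarith

theorem sum_order_mul_log_le (hf : Differentiable ℂ f) (hc : f c ≠ 0) {S : Finset ℂ} {R M : ℝ}
    (hR : 0 < R) (hS : ∀ ρ ∈ S, ‖c - ρ‖ ≤ R) (hM : ∀ z, ‖z - c‖ = 4 * R → ‖f z‖ ≤ M) :
    (∑ ρ ∈ S, (analyticOrderNatAt f ρ : ℝ)) * Real.log 3 ≤ Real.log (M / ‖f c‖) := by
  obtain ⟨g, hg, -, hfg⟩ := exists_entire_quotient_finset hf hc S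
  have hgc : 0 < ‖g c‖ := norm_pos_iff.2 fun h => hc (by rw [hfg, h, mul_zero])
  have := norm_quotient_le hc hg hfg (q := 3) hR (by norm_num) hS
    (by convert hM using 4; norm_num) (z := c) (by simp; positivity)
  have h3 := le_of_mul_le_mul_right this hgc
  have := Real.log_le_log (by positivity) h3
  rwa [Real.log_pow, Nat.cast_sum] at this

end Entire

section Entire

variable {f : ℂ → ℂ} {c : ℂ}

theorem exists_forall_norm_lt_order_eq_zero (hf : Differentiable ℂ f) (hc : f c ≠ 0) :
    ∃ r > 0, ∀ ρ, analyticOrderNatAt f ρ ≠ 0 → r ≤ ‖ρ - c‖ := by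
  obtain ⟨r, hr, h⟩ := Metric.eventually_nhds_iff.1 (hf.continuous.continuousAt.eventually_ne hc)
  refine ⟨r, hr, fun ρ hρ => ?_⟩
  by_contra! hlt
  exact hρ ((analyticOrderNatAt_eq_zero_iff hf hc).2 (h (by rwa [dist_eq_norm])))

theorem exists_sum_order_le (hf : Differentiable ℂ f) (hc : f c ≠ 0) {K : ℝ} (hK : 0 ≤ K)
    (hgr : ∀ z, ‖f z‖ ≤ Real.exp (K * (‖z - c‖ + 1) * √(‖z - c‖ + 1))) :
    ∃ C, 0 ≤ C ∧ ∀ R, 1 ≤ R → ∀ S : Finset ℂ, (∀ ρ ∈ S, ‖ρ - c‖ ≤ R) →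
      ∑ ρ ∈ S, (analyticOrderNatAt f ρ : ℝ) ≤ C * (R * √R) := by
  have h3 : 0 < Real.log 3 := Real.log_pos (by norm_num)
  have hfc : 0 < ‖f c‖ := norm_pos_iff.2 hc
  refine ⟨(K * 5 * √5 + |Real.log ‖f c‖|) / Real.log 3, by positivity, fun R hR S hS => ?_⟩
  have h := sum_order_mul_log_le hf hc (S := S) (R := R)
    (M := Real.exp (K * (4 * R + 1) * √(4 * R + 1))) (by linarith)
    (fun ρ hρ => by rw [norm_sub_rev]; exact hS ρ hρ) (fun z hz => by rw [← hz]; exact hgr z)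
  rw [Real.log_div (Real.exp_ne_zero _) hfc.ne', Real.log_exp] at h
  rw [div_mul_eq_mul_div, le_div_iff₀ h3]
  refine h.trans ?_
  have h1 : K * (4 * R + 1) * √(4 * R + 1) ≤ K * (5 * R) * √(5 * R) := by
    gcongr <;> linarith
  rw [Real.sqrt_mul (by norm_num)] at h1
  have h2 : 1 ≤ R * √R := by
    have : 1 ≤ √R := Real.one_le_sqrt.2 hR
    nlinarith
  have h4 := neg_abs_le (Real.log ‖f c‖)
  nlinarith [mul_le_mul_of_nonneg_left h2 (abs_nonneg (Real.log ‖f c‖))]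

theorem exists_pow_two_bound {r x : ℝ} (hr : 0 < r) (hx : r ≤ x) :
    ∃ k : ℕ, x ≤ 2 ^ k ∧ 1 / x ^ 2 ≤ (4 + 1 / r ^ 2) * (1 / 4) ^ k := by
  have hx0 : 0 < x := hr.trans_le hx
  rcases le_total x 1 with h | h
  · refine ⟨0, by simpa using h, ?_⟩
    have : 1 / x ^ 2 ≤ 1 / r ^ 2 := by gcongr
    simp only [pow_zero, mul_one]
    linarith
  · obtain ⟨n, hn1, hn2⟩ := exists_nat_pow_near h (one_lt_two : (1 : ℝ) < 2)
    refine ⟨n + 1, hn2.le, ?_⟩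
    have h2 : 1 / x ^ 2 ≤ 1 / (2 ^ n) ^ 2 := by gcongr
    have h3 : (1 : ℝ) / (2 ^ n) ^ 2 = 4 * (1 / 4) ^ (n + 1) := by
      rw [← pow_mul, mul_comm n, pow_mul, pow_succ, one_div_pow]
      norm_num
      ring
    rw [h3] at h2
    have : (0 : ℝ) ≤ 1 / r ^ 2 * (1 / 4) ^ (n + 1) := by positivity
    linarith

/-- Dyadic decomposition: the disc of radius 2^k holds O(2^(3k/2)) zeros, each of weight O(4^(-k)),
so the total is dominated by a geometric series of ratio √2/2. -/
theorem summable_order_div_sq (hf : Differentiable ℂ f) (hc : f c ≠ 0) {K : ℝ} (hK : 0 ≤ K)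
    (hgr : ∀ z, ‖f z‖ ≤ Real.exp (K * (‖z - c‖ + 1) * √(‖z - c‖ + 1))) :
    Summable fun ρ : ℂ => (analyticOrderNatAt f ρ : ℝ) / ‖ρ - c‖ ^ 2 := by
  obtain ⟨r, hr, hr0⟩ := exists_forall_norm_lt_order_eq_zero hf hc
  obtain ⟨C, hC, hN⟩ := exists_sum_order_le hf hc hK hgr
  have hsq : √2 / 2 < 1 := by
    rw [div_lt_one (by norm_num)]
    rw [Real.sqrt_lt' (by norm_num)]
    norm_num
  have hgeo : Summable fun k : ℕ => (√2 / 2) ^ k :=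
    summable_geometric_of_lt_one (by positivity) hsq
  set D := 4 + 1 / r ^ 2
  have hD : 0 < D := by positivity
  refine summable_of_sum_le (c := ∑' k : ℕ, D * C * (√2 / 2) ^ k) (fun ρ => by positivity) fun S => ?_
  have ha : ∀ ρ, Summable fun k : ℕ => (analyticOrderNatAt f ρ : ℝ) * (D * if ‖ρ - c‖ ≤ 2 ^ k then (1 / 4 : ℝ) ^ k else 0) := by
    intro ρ
    refine ((Summable.of_nonneg_of_le (fun k => ?_) (fun k => ?_)
      (summable_geometric_of_lt_one (r := (1 / 4 : ℝ)) (by norm_num) (by norm_num))).mul_left D).mul_left _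
    · split_ifs <;> positivity
    · split_ifs
      · exact le_rfl
      · positivity
  calc ∑ ρ ∈ S, (analyticOrderNatAt f ρ : ℝ) / ‖ρ - c‖ ^ 2
      ≤ ∑ ρ ∈ S, ∑' k : ℕ, (analyticOrderNatAt f ρ : ℝ) *
          (D * if ‖ρ - c‖ ≤ 2 ^ k then (1 / 4 : ℝ) ^ k else 0) := by
        refine Finset.sum_le_sum fun ρ _ => ?_
        rcases eq_or_ne (analyticOrderNatAt f ρ) 0 with h | h
        · simp [h]
        · obtain ⟨k, hk, hk2⟩ := exists_pow_two_bound hr (hr0 ρ h)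
          refine le_trans ?_ ((ha ρ).le_tsum k fun j _ => ?_)
          · rw [if_pos hk, div_eq_mul_one_div]
            gcongr
          · split_ifs <;> positivity
    _ = ∑' k : ℕ, ∑ ρ ∈ S, (analyticOrderNatAt f ρ : ℝ) *
          (D * if ‖ρ - c‖ ≤ 2 ^ k then (1 / 4 : ℝ) ^ k else 0) :=
        (Summable.tsum_finsetSum fun ρ _ => ha ρ).symm
    _ ≤ ∑' k : ℕ, D * C * (√2 / 2) ^ k := by
        refine Summable.tsum_le_tsum (fun k => ?_) (summable_sum fun ρ _ => ha ρ) (hgeo.mul_left _)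
        have h1 := hN (2 ^ k) (one_le_pow₀ (by norm_num)) (S.filter fun ρ => ‖ρ - c‖ ≤ 2 ^ k)
          (fun ρ hρ => (Finset.mem_filter.1 hρ).2)
        have h2 : ∑ ρ ∈ S, (analyticOrderNatAt f ρ : ℝ) *
            (D * if ‖ρ - c‖ ≤ 2 ^ k then (1 / 4 : ℝ) ^ k else 0) =
            D * (1 / 4) ^ k * ∑ ρ ∈ S.filter fun ρ => ‖ρ - c‖ ≤ 2 ^ k, (analyticOrderNatAt f ρ : ℝ) := by
          rw [Finset.sum_filter, Finset.mul_sum]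
          refine Finset.sum_congr rfl fun ρ _ => ?_
          split_ifs <;> ring
        rw [h2]
        have h3 : √((2 : ℝ) ^ k) = √2 ^ k := by
          rw [Real.sqrt_eq_iff_mul_self_eq (by positivity) (by positivity), ← mul_pow,
            Real.mul_self_sqrt (by norm_num)]
        have h4 : (1 / 4 : ℝ) ^ k * (2 ^ k * √2 ^ k) = (√2 / 2) ^ k := by
          rw [← mul_pow, ← mul_pow]
          congr 1
          ring
        calc _ ≤ D * (1 / 4) ^ k * (C * (2 ^ k * √(2 ^ k))) := by gcongr
          _ = D * C * ((1 / 4 : ℝ) ^ k * (2 ^ k * √2 ^ k)) := by rw [h3]; ring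
          _ = _ := by rw [h4]

end Entire

/-! ### Partial fractions of the logarithmic derivative -/

theorem exists_log_of_ne_zero {g : ℂ → ℂ} (hg : Differentiable ℂ g) {c : ℂ} {R : ℝ} (hR : 0 < R)
    (h0 : ∀ z ∈ Metric.ball c R, g z ≠ 0) :
    ∃ L : ℂ → ℂ, L c = 0 ∧ (∀ z ∈ Metric.ball c R, HasDerivAt L (logDeriv g z) z) ∧
      ∀ z ∈ Metric.ball c R, g z = g c * exp (L z) := by
  have hcm : c ∈ Metric.ball c R := Metric.mem_ball_self hR
  have hd : DifferentiableOn ℂ (logDeriv g) (Metric.ball c R) := by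
    intro z hz
    have h1 : DifferentiableAt ℂ (deriv g) z := hg.deriv z
    exact (h1.div (hg z) (h0 z hz)).differentiableWithinAt
  obtain ⟨L, hLc, hL⟩ := hd.isExactOn_ball.with_val_at c 0
  refine ⟨L, hLc, hL, fun z hz => ?_⟩
  have hder : ∀ w ∈ Metric.ball c R, HasDerivAt (fun w => g w * exp (-L w)) 0 w := by
    intro w hw
    refine ((hg w).hasDerivAt.mul (hL w hw).neg.cexp).congr_deriv ?_
    rw [logDeriv_apply]
    field_simp [h0 w hw]
    ring
  have := (convex_ball c R).is_const_of_fderivWithin_eq_zero (𝕜 := ℂ)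
    (f := fun w => g w * exp (-L w)) (fun w hw => (hder w hw).differentiableAt.differentiableWithinAt)
    (fun w hw => by
      rw [fderivWithin_of_isOpen Metric.isOpen_ball hw, ((hder w hw).hasFDerivAt).fderiv]
      ext
      simp) hz hcm
  simp only [hLc, neg_zero, exp_zero, mul_one] at this
  rw [← this, mul_assoc, ← exp_add, neg_add_cancel, exp_zero, mul_one]

/-- Borel–Carathéodory bounds a logarithm of g/g(c) by 2A on radius R/2, Cauchy's estimate bounds
its derivative by 8A/R on radius R/4, and the Schwarz lemma gives the factor (16A/R)/(R/4) = 64A/R².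
-/
theorem norm_logDeriv_sub_le {g : ℂ → ℂ} (hg : Differentiable ℂ g) {c : ℂ} {R A : ℝ} (hR : 0 < R)
    (hA : 0 < A) (h0 : ∀ z ∈ Metric.ball c R, g z ≠ 0)
    (hb : ∀ z ∈ Metric.ball c R, ‖g z‖ ≤ Real.exp A * ‖g c‖) {s : ℂ} (hs : ‖s - c‖ < R / 4) :
    ‖logDeriv g s - logDeriv g c‖ ≤ 64 * A / R ^ 2 * ‖s - c‖ := by
  obtain ⟨L, hLc, hL, hgL⟩ := exists_log_of_ne_zero hg hR h0
  have hgc : 0 < ‖g c‖ := norm_pos_iff.2 (h0 c (Metric.mem_ball_self hR))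
  have hre : ∀ z ∈ Metric.ball c R, (L z).re ≤ A := by
    intro z hz
    have := hb z hz
    rw [hgL z hz, norm_mul, norm_exp, mul_comm] at this
    exact Real.exp_le_exp.1 (le_of_mul_le_mul_right this hgc)
  have hLb : ∀ z, ‖z - c‖ ≤ R / 2 → ‖L z‖ ≤ 2 * A := by
    intro z hz
    have hmem : ∀ w ∈ Metric.ball (0 : ℂ) R, w + c ∈ Metric.ball c R := by
      intro w hw
      simpa using hw
    have h := borelCaratheodory_zero (f := fun w => L (w + c)) (z := z - c) hA (R := R)
      (fun w hw => ((hL _ (hmem w hw)).differentiableAt.comp w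
        (by fun_prop : DifferentiableAt ℂ (fun w => w + c) w)).differentiableWithinAt)
      (fun w hw => hre _ (hmem w hw)) hR (by simp; linarith) (by simpa using hLc)
    simp only [sub_add_cancel] at h
    refine h.trans ?_
    rw [div_le_iff₀ (by linarith)]
    nlinarith
  have hD : DifferentiableOn ℂ L (Metric.ball c R) :=
    fun z hz => (hL z hz).differentiableAt.differentiableWithinAt
  have hd1 : ∀ z, ‖z - c‖ ≤ R / 4 → ‖logDeriv g z‖ ≤ 8 * A / R := by
    intro z hz
    have hsub : ∀ w, ‖w - z‖ ≤ R / 4 → ‖w - c‖ ≤ R / 2 := by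
      intro w hw
      have := norm_sub_le_norm_sub_add_norm_sub w z c
      linarith
    have hz' : z ∈ Metric.ball c R := by rw [mem_ball_iff_norm]; linarith
    rw [← (hL z hz').deriv]
    have := norm_deriv_le_of_forall_mem_sphere_norm_le (f := L) (c := z) (R := R / 4) (C := 2 * A)
      (by linarith) (DifferentiableOn.diffContOnCl (hD.mono (by
        rw [closure_ball _ (by linarith)]
        intro w hw
        rw [mem_closedBall_iff_norm] at hw
        rw [mem_ball_iff_norm]
        linarith [hsub w hw]))) (fun w hw => hLb w (hsub w (by
          rw [mem_sphere_iff_norm] at hw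
          exact hw.le)))
    refine this.trans (le_of_eq ?_)
    field_simp
    ring
  have hd2 : DifferentiableOn ℂ (logDeriv g) (Metric.ball c (R / 4)) := by
    intro z hz
    rw [mem_ball_iff_norm] at hz
    have h1 : DifferentiableAt ℂ (deriv g) z := hg.deriv z
    exact (h1.div (hg z) (h0 z (by rw [mem_ball_iff_norm]; linarith))).differentiableWithinAt
  have := dist_le_div_mul_dist_of_mapsTo_ball (R₂ := 16 * A / R) (z := s) hd2 (fun z hz => by
    rw [mem_ball_iff_norm] at hz
    rw [mem_closedBall_iff_norm]
    refine (norm_sub_le _ _).trans ?_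
    have h1 := hd1 z hz.le
    have h2 := hd1 c (by simp; positivity)
    calc _ ≤ 8 * A / R + 8 * A / R := add_le_add h1 h2
      _ = _ := by ring) (by rwa [mem_ball_iff_norm])
  rw [dist_eq_norm, dist_eq_norm] at this
  refine this.trans (le_of_eq ?_)
  field_simp
  ring

section Entire

variable {f : ℂ → ℂ} {c : ℂ}

/-- Dividing out all zeros in the disc leaves a zero-free function. On |z - c| = 2R each removed
factor is at least as large as at c, so the quotient inherits the bound e^A relative to its value at
c. -/
theorem norm_logDeriv_sub_sum_le (hf : Differentiable ℂ f) (hc : f c ≠ 0) {R A : ℝ} (hR : 0 < R)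
    (hA : 0 < A) {S : Finset ℂ} (hS : ∀ ρ, ρ ∈ S ↔ ‖ρ - c‖ ≤ R ∧ f ρ = 0)
    (hM : ∀ z, ‖z - c‖ = 2 * R → ‖f z‖ ≤ Real.exp A * ‖f c‖) {s : ℂ} (hs : f s ≠ 0)
    (hsR : ‖s - c‖ < R / 4) :
    ‖logDeriv f s - logDeriv f c -
        ∑ ρ ∈ S, (analyticOrderNatAt f ρ : ℂ) * (1 / (s - ρ) - 1 / (c - ρ))‖ ≤
      64 * A / R ^ 2 * ‖s - c‖ := by
  obtain ⟨g, hg, hgS, hfg⟩ := exists_entire_quotient_finset hf hc S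
  have hlog : ∀ z, f z ≠ 0 → logDeriv f z =
      ∑ ρ ∈ S, (analyticOrderNatAt f ρ : ℂ) * (1 / (z - ρ)) + logDeriv g z := by
    intro z hz
    have hz1 : (∏ ρ ∈ S, (z - ρ) ^ analyticOrderNatAt f ρ) ≠ 0 :=
      fun h => hz (by rw [hfg, h, zero_mul])
    have hz2 : g z ≠ 0 := fun h => hz (by rw [hfg, h, mul_zero])
    have h1 : f = fun z => (∏ ρ ∈ S, (z - ρ) ^ analyticOrderNatAt f ρ) * g z := funext hfg
    conv_lhs => rw [h1]
    rw [logDeriv_mul z hz1 hz2 (by fun_prop) (hg z), logDeriv_prod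
      (fun ρ hρ => Finset.prod_ne_zero_iff.1 hz1 ρ hρ) (fun ρ _ => by fun_prop)]
    congr 1
    refine Finset.sum_congr rfl fun ρ _ => ?_
    rw [logDeriv_fun_pow (by fun_prop), logDeriv_apply]
    simp
  have hgne : ∀ z ∈ Metric.ball c R, g z ≠ 0 := by
    intro z hz h
    rw [mem_ball_iff_norm] at hz
    exact hgS z ((hS z).2 ⟨hz.le, by rw [hfg, h, mul_zero]⟩) h
  have hgb : ∀ z ∈ Metric.ball c R, ‖g z‖ ≤ Real.exp A * ‖g c‖ := by
    intro z hz
    rw [mem_ball_iff_norm] at hz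
    have := norm_quotient_le hc hg hfg (q := 1) (M := Real.exp A * ‖f c‖) hR le_rfl
      (fun ρ hρ => by rw [norm_sub_rev]; exact ((hS ρ).1 hρ).1)
      (by convert hM using 4; norm_num) (z := z) (by linarith)
    rwa [one_pow, one_mul, mul_div_cancel_right₀ _ (norm_ne_zero_iff.2 hc)] at this
  have := norm_logDeriv_sub_le hg hR hA hgne hgb hsR
  refine le_trans (le_of_eq ?_) this
  congr 1
  rw [hlog s hs, hlog c hc]
  simp only [mul_sub, Finset.sum_sub_distrib]
  ring

theorem summable_order_mul_sub (hf : Differentiable ℂ f) (hc : f c ≠ 0)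
    (hsum : Summable fun ρ : ℂ => (analyticOrderNatAt f ρ : ℝ) / ‖ρ - c‖ ^ 2) (s : ℂ) :
    Summable fun ρ : ℂ => (analyticOrderNatAt f ρ : ℂ) * (1 / (s - ρ) - 1 / (c - ρ)) := by
  refine Summable.of_norm_bounded_eventually (hsum.mul_left (2 * ‖s - c‖)) ?_
  have hfin := finite_zeros_of_isCompact hf hc (isCompact_closedBall c (2 * ‖s - c‖))
  refine hfin.subset ?_
  intro ρ hρ
  by_contra hno
  refine hρ ?_
  change ‖(analyticOrderNatAt f ρ : ℂ) * (1 / (s - ρ) - 1 / (c - ρ))‖ ≤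
    2 * ‖s - c‖ * ((analyticOrderNatAt f ρ : ℝ) / ‖ρ - c‖ ^ 2)
  by_cases h0 : f ρ = 0
  · have hfar : 2 * ‖s - c‖ < ‖ρ - c‖ := by
      by_contra! h
      exact hno ⟨by rwa [mem_closedBall_iff_norm], h0⟩
    have hρc : 0 < ‖ρ - c‖ := by linarith [norm_nonneg (s - c)]
    have h1 : ‖ρ - c‖ / 2 ≤ ‖s - ρ‖ := by
      have := norm_sub_le_norm_sub_add_norm_sub ρ s c
      rw [norm_sub_rev ρ s] at this
      linarith
    have hsρ : s - ρ ≠ 0 := norm_pos_iff.1 (by linarith)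
    have hcρ : c - ρ ≠ 0 := norm_pos_iff.1 (by rwa [norm_sub_rev])
    rw [div_sub_div _ _ hsρ hcρ, norm_mul, norm_div, norm_mul, Complex.norm_natCast,
      norm_sub_rev c ρ]
    have h2 : ‖1 * (c - ρ) - (s - ρ) * 1‖ = ‖s - c‖ := by
      rw [norm_sub_rev s]
      congr 1
      ring
    rw [h2]
    calc (analyticOrderNatAt f ρ : ℝ) * (‖s - c‖ / (‖s - ρ‖ * ‖ρ - c‖))
        ≤ (analyticOrderNatAt f ρ : ℝ) * (‖s - c‖ / (‖ρ - c‖ / 2 * ‖ρ - c‖)) := by gcongr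
      _ = _ := by field_simp
  · rw [(analyticOrderNatAt_eq_zero_iff hf hc).2 h0]
    simp

/-- The logarithmic derivative of Hadamard's product, obtained without the product. With the zeros
in the disc of radius n removed, A is O(n^(3/2)), and the error 64A/n² · |s - c| tends to 0. -/
theorem logDeriv_sub_eq_tsum (hf : Differentiable ℂ f) (hc : f c ≠ 0) {K : ℝ} (hK : 0 ≤ K)
    (hgr : ∀ z, ‖f z‖ ≤ Real.exp (K * (‖z - c‖ + 1) * √(‖z - c‖ + 1))) {s : ℂ} (hs : f s ≠ 0) :
    logDeriv f s - logDeriv f c =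
      ∑' ρ : ℂ, (analyticOrderNatAt f ρ : ℂ) * (1 / (s - ρ) - 1 / (c - ρ)) := by
  set F : ℂ → ℂ := fun ρ => (analyticOrderNatAt f ρ : ℂ) * (1 / (s - ρ) - 1 / (c - ρ)) with hF
  have hFs : Summable F := summable_order_mul_sub hf hc (summable_order_div_sq hf hc hK hgr) s
  have hfin := fun n : ℕ => finite_zeros_of_isCompact hf hc (isCompact_closedBall c (n : ℝ))
  have hS : ∀ (n : ℕ) ρ, ρ ∈ (hfin n).toFinset ↔ ‖ρ - c‖ ≤ n ∧ f ρ = 0 := by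
    intro n ρ
    rw [Set.Finite.mem_toFinset]
    show _ ∧ _ ↔ _
    rw [mem_closedBall_iff_norm]
  have h1 : Tendsto (fun n : ℕ => ∑ ρ ∈ (hfin n).toFinset, F ρ) atTop (𝓝 (∑' ρ, F ρ)) := by
    have hd := tendsto_tsum_of_dominated_convergence (𝓕 := atTop) (g := F)
      (f := fun (n : ℕ) => ((Metric.closedBall c (n : ℝ)).indicator F)) hFs.norm
      (fun ρ => by
        refine tendsto_const_nhds.congr' ?_
        obtain ⟨N, hN⟩ := exists_nat_ge ‖ρ - c‖
        filter_upwards [eventually_ge_atTop N] with n hn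
        rw [indicator_of_mem]
        rw [mem_closedBall_iff_norm]
        exact hN.trans (Nat.cast_le.2 hn))
      (Eventually.of_forall fun n ρ => norm_indicator_le_norm_self _ _)
    refine hd.congr fun n => ?_
    rw [tsum_eq_sum (s := (hfin n).toFinset)]
    · refine Finset.sum_congr rfl fun ρ hρ => indicator_of_mem ?_ _
      rw [mem_closedBall_iff_norm]
      exact ((hS n ρ).1 hρ).1
    · intro ρ hρ
      by_cases hm : ρ ∈ Metric.closedBall c (n : ℝ)
      · rw [indicator_of_mem hm, hF]
        have : f ρ ≠ 0 := fun h => hρ ((hS n ρ).2 ⟨by rwa [mem_closedBall_iff_norm] at hm, h⟩)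
        simp [(analyticOrderNatAt_eq_zero_iff hf hc).2 this]
      · exact indicator_of_notMem hm _
  have hfc : 0 < ‖f c‖ := norm_pos_iff.2 hc
  set a : ℝ := |Real.log ‖f c‖| + 1
  have ha : 0 < a := by positivity
  have h2 : Tendsto (fun n : ℕ => 64 * (K * (2 * n + 1) * √(2 * n + 1) + a) / (n : ℝ) ^ 2 * ‖s - c‖)
      atTop (𝓝 0) := by
    have hlim : Tendsto (fun n : ℕ => (64 * K * 3 * √3 + 64 * a) * ‖s - c‖ * (√(n : ℝ))⁻¹) atTop
        (𝓝 0) := by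
      have := (Real.tendsto_sqrt_atTop.comp
        (tendsto_natCast_atTop_atTop (R := ℝ))).inv_tendsto_atTop.const_mul
        ((64 * K * 3 * √3 + 64 * a) * ‖s - c‖)
      rw [mul_zero] at this
      exact this
    refine squeeze_zero' (Eventually.of_forall fun n => by positivity) ?_ hlim
    filter_upwards [eventually_ge_atTop 1] with n hn
    have hn1 : (1 : ℝ) ≤ n := by exact_mod_cast hn
    have hq : 1 ≤ √(n : ℝ) := Real.one_le_sqrt.2 hn1
    have hqq : √(n : ℝ) * √(n : ℝ) = n := Real.mul_self_sqrt (by linarith)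
    have hb : K * (2 * n + 1) * √(2 * n + 1) ≤ K * (3 * n) * (√3 * √n) := by
      rw [← Real.sqrt_mul (by norm_num)]
      gcongr <;> linarith
    have hb2 : a ≤ a * (n * √n) := by
      nlinarith [mul_le_mul hn1 hq zero_le_one (by linarith)]
    calc 64 * (K * (2 * n + 1) * √(2 * n + 1) + a) / (n : ℝ) ^ 2 * ‖s - c‖
        ≤ 64 * (K * (3 * n) * (√3 * √n) + a * (n * √n)) / (n : ℝ) ^ 2 * ‖s - c‖ := by gcongr
      _ = _ := by
        generalize √(n : ℝ) = q at *
        have hq0 : q ≠ 0 := by linarith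
        rw [← hqq]
        field_simp
  have h3 : Tendsto (fun n : ℕ => logDeriv f s - logDeriv f c - ∑ ρ ∈ (hfin n).toFinset, F ρ)
      atTop (𝓝 0) := by
    refine squeeze_zero_norm' ?_ h2
    obtain ⟨N, hN⟩ := exists_nat_gt (4 * ‖s - c‖)
    filter_upwards [eventually_ge_atTop (N + 1)] with n hn
    have hn1 : (N : ℝ) + 1 ≤ n := by exact_mod_cast hn
    have hN0 : (0 : ℝ) ≤ N := N.cast_nonneg
    refine norm_logDeriv_sub_sum_le hf hc (R := n) (by linarith) (by positivity) (hS n) ?_ hs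
      (by linarith)
    intro z hz
    refine (hgr z).trans ?_
    rw [hz, Real.exp_add, mul_assoc (Real.exp _)]
    refine le_mul_of_one_le_right (Real.exp_pos _).le ?_
    rw [← Real.exp_log hfc, ← Real.exp_add]
    refine Real.one_le_exp ?_
    have := neg_abs_le (Real.log ‖f c‖)
    simp only [a]
    linarith
  have h4 := tendsto_nhds_unique h3 (tendsto_const_nhds.sub h1)
  exact (sub_eq_zero.1 h4.symm)

end Entire

/-! ### The Blaschke condition in the half plane Re z < -2 -/

/-- The point -4 - conj ρ is the mirror image of ρ in the line Re z = -2. The two distances agree on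
that line, and their difference of squares is explicit elsewhere. -/
theorem normSq_sub_reflection (z ρ : ℂ) : ‖z - (-4 - (starRingEnd ℂ) ρ)‖ ^ 2 =
    ‖z - ρ‖ ^ 2 + 4 * (-2 - z.re) * (-2 - ρ.re) := by
  rw [← normSq_eq_norm_sq, ← normSq_eq_norm_sq, normSq_apply, normSq_apply]
  simp
  ring

/-- Replaces the polynomial bound by the modulus of (z - 1)², which is holomorphic and zero-free on
the half plane and so can be divided out. -/
theorem one_add_norm_sq_le {z : ℂ} (hz : z.re ≤ -2) : 4 * (1 + ‖z‖) ^ 2 ≤ 16 * ‖z - 1‖ ^ 2 := by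
  have h1 : 1 ≤ ‖z - 1‖ := by
    have h1 := neg_le_abs (z - 1).re
    have h2 := abs_re_le_norm (z - 1)
    rw [sub_re, one_re] at h1 h2
    linarith
  have h3 : ‖z‖ ≤ ‖z - 1‖ := by
    rw [← abs_of_nonneg (norm_nonneg z), ← abs_of_nonneg (norm_nonneg (z - 1)), ← sq_le_sq,
      ← normSq_eq_norm_sq, ← normSq_eq_norm_sq, normSq_apply, normSq_apply]
    simp
    nlinarith
  have : (1 + ‖z‖) ^ 2 ≤ (2 * ‖z - 1‖) ^ 2 := pow_le_pow_left₀ (by positivity) (by linarith) 2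
  linarith

section Entire

variable {f : ℂ → ℂ} {c : ℂ}

/-- Divide f by (z - 1)² and by the Blaschke factors (z - ρ)/(z - ρ*), with ρ* the mirror image of
ρ. These are unimodular on Re z = -2, so the quotient is at most 16 there, and Phragmén–Lindelöf
carries the bound into the half plane. -/
theorem norm_mul_prod_reflection_le (hf : Differentiable ℂ f) (hc : f c ≠ 0)
    (hb : ∀ z : ℂ, z.re ≤ -2 → ‖f z‖ ≤ 4 * (1 + ‖z‖) ^ 2) {S : Finset ℂ}
    {z₀ : ℂ} (hz₀ : z₀.re < -2) :
    ‖f z₀‖ * ∏ ρ ∈ S, ‖z₀ - (-4 - (starRingEnd ℂ) ρ)‖ ^ analyticOrderNatAt f ρ ≤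
      16 * ‖z₀ - 1‖ ^ 2 * ∏ ρ ∈ S, ‖z₀ - ρ‖ ^ analyticOrderNatAt f ρ := by
  obtain ⟨g, hg, -, hfg⟩ := exists_entire_quotient_finset hf hc S
  set k : ℂ → ℂ := fun z =>
    g z * (∏ ρ ∈ S, (z - (-4 - (starRingEnd ℂ) ρ)) ^ analyticOrderNatAt f ρ) / (z - 1) ^ 2 with hk
  have hne : ∀ z : ℂ, z.re ≤ -2 → z - 1 ≠ 0 := by
    intro z hz h
    have := congrArg re h
    simp at this
    linarith
  have hkey : ∀ z : ℂ, z.re ≤ -2 → ∀ q : ℝ, 0 ≤ q →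
      (∀ ρ ∈ S, ‖z - (-4 - (starRingEnd ℂ) ρ)‖ ≤ q * ‖z - ρ‖) →
      ‖k z‖ ≤ 16 * q ^ (∑ ρ ∈ S, analyticOrderNatAt f ρ) := by
    intro z hz q hq hle
    have h1 : 0 < ‖z - 1‖ := norm_pos_iff.2 (hne z hz)
    rw [hk]
    simp only []
    rw [norm_div, norm_mul, norm_pow, div_le_iff₀ (by positivity), norm_prod]
    have h2 : ∏ ρ ∈ S, ‖(z - (-4 - (starRingEnd ℂ) ρ)) ^ analyticOrderNatAt f ρ‖ ≤
        q ^ (∑ ρ ∈ S, analyticOrderNatAt f ρ) * ‖∏ ρ ∈ S, (z - ρ) ^ analyticOrderNatAt f ρ‖ := by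
      rw [norm_prod, ← Finset.prod_pow_eq_pow_sum, ← Finset.prod_mul_distrib]
      refine Finset.prod_le_prod (fun _ _ => by positivity) fun ρ hρ => ?_
      rw [norm_pow, norm_pow, ← mul_pow]
      exact pow_le_pow_left₀ (norm_nonneg _) (hle ρ hρ) _
    have h3 := (hb z hz).trans (one_add_norm_sq_le hz)
    rw [hfg z, norm_mul] at h3
    calc _ ≤ ‖g z‖ * (q ^ (∑ ρ ∈ S, analyticOrderNatAt f ρ) *
          ‖∏ ρ ∈ S, (z - ρ) ^ analyticOrderNatAt f ρ‖) := by gcongr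
      _ = q ^ (∑ ρ ∈ S, analyticOrderNatAt f ρ) *
          (‖∏ ρ ∈ S, (z - ρ) ^ analyticOrderNatAt f ρ‖ * ‖g z‖) := by ring
      _ ≤ q ^ (∑ ρ ∈ S, analyticOrderNatAt f ρ) * (16 * ‖z - 1‖ ^ 2) := by gcongr
      _ = _ := by ring
  have hkd : ∀ z : ℂ, z.re ≤ -2 → DifferentiableAt ℂ k z := fun z hz =>
    DifferentiableAt.div (by fun_prop) (by fun_prop) (pow_ne_zero _ (hne z hz))
  have hre : ∀ w : ℂ, 0 ≤ w.re → (-2 - w).re ≤ -2 := by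
    intro w hw
    simp only [sub_re, neg_re, re_ofNat]
    linarith
  -- The a priori growth condition is needed only near infinity, where every ratio |z - ρ*|/|z - ρ|
  -- is at most 2.
  have hev : ∀ᶠ w in Bornology.cobounded ℂ, 0 ≤ w.re →
      ‖k (-2 - w)‖ ≤ 16 * 2 ^ (∑ ρ ∈ S, analyticOrderNatAt f ρ) := by
    have h1 : ∀ᶠ w in Bornology.cobounded ℂ, ∀ ρ ∈ S,
        ‖-2 - ρ‖ + ‖ρ - (-4 - (starRingEnd ℂ) ρ)‖ ≤ ‖w‖ :=
      (Finset.eventually_all S).2 fun ρ _ => tendsto_norm_cobounded_atTop.eventually_ge_atTop _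
    filter_upwards [h1] with w hw hw0
    have hfar : ∀ ρ ∈ S, ‖ρ - (-4 - (starRingEnd ℂ) ρ)‖ ≤ ‖-2 - w - ρ‖ := by
      intro ρ hρ
      have h2 := hw ρ hρ
      have h3 := norm_sub_le (-2 - ρ) (-2 - w - ρ)
      rw [show -2 - ρ - (-2 - w - ρ) = w by ring] at h3
      linarith
    refine hkey _ (hre w hw0) 2 zero_le_two fun ρ hρ => ?_
    have h4 := norm_sub_le_norm_sub_add_norm_sub (-2 - w) ρ (-4 - (starRingEnd ℂ) ρ)
    linarith [hfar ρ hρ]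
  have hPL := PhragmenLindelof.right_half_plane_of_bounded_on_real (f := fun w => k (-2 - w))
    (C := 16) (z := -2 - z₀) ?_ ?_ ?_ ?_ ?_
  · simp only [sub_sub_cancel] at hPL
    rw [hk] at hPL
    simp only [] at hPL
    have h1 : 0 < ‖z₀ - 1‖ := norm_pos_iff.2 (hne z₀ hz₀.le)
    rw [norm_div, norm_mul, norm_pow, div_le_iff₀ (by positivity), norm_prod] at hPL
    simp only [norm_pow] at hPL
    rw [hfg z₀, norm_mul, norm_prod]
    simp only [norm_pow]
    calc _ = (‖g z₀‖ * ∏ ρ ∈ S, ‖z₀ - (-4 - (starRingEnd ℂ) ρ)‖ ^ analyticOrderNatAt f ρ) *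
          ∏ ρ ∈ S, ‖z₀ - ρ‖ ^ analyticOrderNatAt f ρ := by ring
      _ ≤ _ := by gcongr
  · have h1 : DifferentiableOn ℂ (fun w => k (-2 - w)) (closure {z : ℂ | 0 < z.re}) := by
      intro w hw
      rw [closure_setOfPred_lt_re] at hw
      exact ((hkd _ (hre w hw)).comp w (by fun_prop)).differentiableWithinAt
    exact h1.diffContOnCl
  · refine ⟨1, by norm_num, 0, ?_⟩
    refine Asymptotics.IsBigO.of_bound (16 * 2 ^ (∑ ρ ∈ S, analyticOrderNatAt f ρ)) ?_
    rw [eventually_inf_principal]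
    filter_upwards [hev] with w hw hw0
    have := hw (le_of_lt hw0)
    simpa using this
  · refine ⟨16 * 2 ^ (∑ ρ ∈ S, analyticOrderNatAt f ρ), ?_⟩
    rw [eventually_map]
    have ht : Tendsto (fun x : ℝ => (x : ℂ)) atTop (Bornology.cobounded ℂ) := by
      rw [← tendsto_norm_atTop_iff_cobounded]
      simpa using tendsto_abs_atTop_atTop
    filter_upwards [ht.eventually hev, eventually_ge_atTop 0] with x hx hx0
    exact hx (by simpa using hx0)
  · intro x
    have h1 : (-2 - (x : ℂ) * I).re = -2 := by simp
    have := hkey (-2 - x * I) h1.le 1 zero_le_one fun ρ hρ => ?_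
    · simpa using this
    · rw [one_mul, ← abs_of_nonneg (norm_nonneg (_ - (_ - _))),
        ← abs_of_nonneg (norm_nonneg (_ - ρ)), ← sq_le_sq, normSq_sub_reflection, h1]
      simp
  · simp only [sub_re, neg_re, re_ofNat]
    linarith

/-- At a fixed z₀ with f(z₀) ≠ 0, |z₀ - ρ|² = (1 - t)|z₀ - ρ*|² with 1 - t ≤ e^(-t). The product
inequality therefore bounds ∑ m t(ρ) uniformly over finite sets of zeros, and t(ρ) dominates (-2 -
Re ρ)/|ρ - c|² up to a constant. -/
theorem summable_order_blaschke (hf : Differentiable ℂ f) (hc : f c ≠ 0)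
    (hb : ∀ z : ℂ, z.re ≤ -2 → ‖f z‖ ≤ 4 * (1 + ‖z‖) ^ 2) :
    Summable ({ρ : ℂ | ρ.re < -2}.indicator
      fun ρ => (analyticOrderNatAt f ρ : ℝ) * (-2 - ρ.re) / ‖ρ - c‖ ^ 2) := by
  obtain ⟨r, hr, hr0⟩ := exists_forall_norm_lt_order_eq_zero hf hc
  obtain ⟨z₀, hz₀, hfz₀⟩ : ∃ z₀ : ℂ, z₀.re < -2 ∧ f z₀ ≠ 0 := by
    by_contra! h
    refine analyticOrderAt_ne_top_of_entire hf hc (-3) (analyticOrderAt_eq_top.2 ?_)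
    have : IsOpen {z : ℂ | z.re < -2} := isOpen_lt continuous_re continuous_const
    filter_upwards [this.mem_nhds (x := (-3 : ℂ)) (by
      show re (-3) < -2
      rw [neg_re, re_ofNat]
      norm_num)] with z hz using h z hz
  have hfz : 0 < ‖f z₀‖ := norm_pos_iff.2 hfz₀
  set t : ℂ → ℝ := fun ρ => 4 * (-2 - z₀.re) * (-2 - ρ.re) / ‖z₀ - (-4 - (starRingEnd ℂ) ρ)‖ ^ 2
    with ht
  have hstar : ∀ ρ : ℂ, ρ.re < -2 → 0 < ‖z₀ - (-4 - (starRingEnd ℂ) ρ)‖ := by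
    intro ρ hρ
    refine norm_pos_iff.2 fun h => ?_
    have := congrArg re h
    simp at this
    linarith
  have hbl : ∀ S : Finset ℂ, (∀ ρ ∈ S, ρ.re < -2) →
      ∑ ρ ∈ S, (analyticOrderNatAt f ρ : ℝ) * t ρ ≤ 2 * Real.log (16 * ‖z₀ - 1‖ ^ 2 / ‖f z₀‖) := by
    intro S hS
    have h1 := norm_mul_prod_reflection_le hf hc hb (S := S) hz₀
    have hP : 0 < ∏ ρ ∈ S, ‖z₀ - (-4 - (starRingEnd ℂ) ρ)‖ ^ analyticOrderNatAt f ρ :=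
      Finset.prod_pos fun ρ hρ => pow_pos (hstar ρ (hS ρ hρ)) _
    have h2 : ∏ ρ ∈ S, ‖z₀ - ρ‖ ^ analyticOrderNatAt f ρ ≤
        Real.exp (-(∑ ρ ∈ S, (analyticOrderNatAt f ρ : ℝ) * t ρ) / 2) *
          ∏ ρ ∈ S, ‖z₀ - (-4 - (starRingEnd ℂ) ρ)‖ ^ analyticOrderNatAt f ρ := by
      rw [neg_div, Finset.sum_div, ← Finset.sum_neg_distrib, Real.exp_sum, ← Finset.prod_mul_distrib]
      refine Finset.prod_le_prod (fun _ _ => by positivity) fun ρ hρ => ?_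
      have h3 : Real.exp (-((analyticOrderNatAt f ρ : ℝ) * t ρ / 2)) =
          Real.exp (-(t ρ / 2)) ^ analyticOrderNatAt f ρ := by
        rw [← Real.exp_nat_mul]
        ring_nf
      rw [h3, ← mul_pow]
      refine pow_le_pow_left₀ (norm_nonneg _) ?_ _
      have hp := hstar ρ (hS ρ hρ)
      rw [← abs_of_nonneg (norm_nonneg (z₀ - ρ)), ← abs_of_nonneg
        (mul_nonneg (Real.exp_pos (-(t ρ / 2))).le hp.le), ← sq_le_sq, mul_pow, ← Real.exp_nat_mul]
      have h4 : ‖z₀ - ρ‖ ^ 2 = (1 - t ρ) * ‖z₀ - (-4 - (starRingEnd ℂ) ρ)‖ ^ 2 := by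
        rw [ht]
        simp only []
        rw [sub_mul, one_mul, div_mul_cancel₀ _ (by positivity), normSq_sub_reflection]
        ring
      rw [h4]
      refine mul_le_mul_of_nonneg_right ?_ (by positivity)
      have := Real.add_one_le_exp (-(t ρ))
      rw [show ((2 : ℕ) : ℝ) * -(t ρ / 2) = -t ρ by push_cast; ring]
      linarith
    have h5 : ‖f z₀‖ ≤ 16 * ‖z₀ - 1‖ ^ 2 *
        Real.exp (-(∑ ρ ∈ S, (analyticOrderNatAt f ρ : ℝ) * t ρ) / 2) := by
      refine le_of_mul_le_mul_right (h1.trans ?_) hP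
      rw [mul_assoc (16 * ‖z₀ - 1‖ ^ 2)]
      exact mul_le_mul_of_nonneg_left h2 (by positivity)
    have h6 : Real.exp ((∑ ρ ∈ S, (analyticOrderNatAt f ρ : ℝ) * t ρ) / 2) ≤
        16 * ‖z₀ - 1‖ ^ 2 / ‖f z₀‖ := by
      rw [le_div_iff₀ hfz]
      calc _ ≤ Real.exp ((∑ ρ ∈ S, (analyticOrderNatAt f ρ : ℝ) * t ρ) / 2) *
            (16 * ‖z₀ - 1‖ ^ 2 *
              Real.exp (-(∑ ρ ∈ S, (analyticOrderNatAt f ρ : ℝ) * t ρ) / 2)) := by gcongr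
        _ = 16 * ‖z₀ - 1‖ ^ 2 * (Real.exp ((∑ ρ ∈ S, (analyticOrderNatAt f ρ : ℝ) * t ρ) / 2) *
              Real.exp (-(∑ ρ ∈ S, (analyticOrderNatAt f ρ : ℝ) * t ρ) / 2)) := by ring
        _ = _ := by
          rw [← Real.exp_add, neg_div, add_neg_cancel, Real.exp_zero, mul_one]
    have h7 := Real.log_le_log (Real.exp_pos _) h6
    rw [Real.log_exp] at h7
    linarith
  have hsum : Summable ({ρ : ℂ | ρ.re < -2}.indicator
      fun ρ => (analyticOrderNatAt f ρ : ℝ) * t ρ) := by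
    refine summable_of_sum_le (c := 2 * Real.log (16 * ‖z₀ - 1‖ ^ 2 / ‖f z₀‖)) (fun ρ => ?_)
      fun S => ?_
    · refine indicator_nonneg (fun ρ hρ => ?_) ρ
      have hρ' : ρ.re < -2 := hρ
      have h1 : 0 ≤ -2 - ρ.re := by linarith
      have h2 : 0 ≤ -2 - z₀.re := by linarith
      simp only [ht]
      positivity
    · classical
      rw [Finset.sum_indicator_eq_sum_filter]
      exact hbl _ fun ρ hρ => (Finset.mem_filter.1 hρ).2
  have hz0' : 0 < 4 * (-2 - z₀.re) := by linarith
  -- Zeros keep a distance r from c, so |z₀ - ρ*| ≤ |z₀| + 4 + |c| + |ρ - c| ≤ Q|ρ - c|.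
  set Q : ℝ := (‖z₀‖ + 4 + ‖c‖) / r + 1
  have hQ : 0 < Q := by positivity
  refine Summable.of_nonneg_of_le (fun ρ => ?_) (fun ρ => ?_)
    (hsum.mul_left (Q ^ 2 / (4 * (-2 - z₀.re))))
  · refine indicator_nonneg (fun ρ hρ => ?_) ρ
    have hρ' : ρ.re < -2 := hρ
    have h1 : 0 ≤ -2 - ρ.re := by linarith
    positivity
  · by_cases hρ : ρ ∈ {ρ : ℂ | ρ.re < -2}
    · rw [indicator_of_mem hρ, indicator_of_mem hρ]
      have hρ' : ρ.re < -2 := hρ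
      have hp := hstar ρ hρ'
      rcases eq_or_ne (analyticOrderNatAt f ρ) 0 with h0 | h0
      · simp [h0]
      · have h1 := hr0 ρ h0
        have h1' : 0 < ‖ρ - c‖ := hr.trans_le h1
        have h2 : ‖z₀ - (-4 - (starRingEnd ℂ) ρ)‖ ≤ Q * ‖ρ - c‖ := by
          have e1 : ‖z₀ - (-4 - (starRingEnd ℂ) ρ)‖ ≤ ‖z₀‖ + (4 + ‖ρ‖) := by
            refine (norm_sub_le _ _).trans (add_le_add le_rfl ((norm_sub_le _ _).trans ?_))
            rw [norm_neg, RCLike.norm_conj]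
            norm_num
          have e2 : ‖ρ‖ ≤ ‖ρ - c‖ + ‖c‖ := by
            have := norm_add_le (ρ - c) c
            rwa [sub_add_cancel] at this
          have e3 : ‖z₀‖ + 4 + ‖c‖ ≤ (‖z₀‖ + 4 + ‖c‖) / r * ‖ρ - c‖ := by
            rw [div_mul_eq_mul_div, le_div_iff₀ hr]
            gcongr
          have e4 : Q * ‖ρ - c‖ = (‖z₀‖ + 4 + ‖c‖) / r * ‖ρ - c‖ + ‖ρ - c‖ := by ring
          linarith
        have h3 : ‖z₀ - (-4 - (starRingEnd ℂ) ρ)‖ ^ 2 ≤ Q ^ 2 * ‖ρ - c‖ ^ 2 := by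
          rw [← mul_pow]
          exact pow_le_pow_left₀ hp.le h2 2
        have h4 : 0 < -2 - ρ.re := by linarith
        have h5 : Q ^ 2 / (4 * (-2 - z₀.re)) * ((analyticOrderNatAt f ρ : ℝ) * t ρ) =
            (analyticOrderNatAt f ρ : ℝ) * (-2 - ρ.re) *
              (Q ^ 2 / ‖z₀ - (-4 - (starRingEnd ℂ) ρ)‖ ^ 2) := by
          have h6 : -2 - z₀.re ≠ 0 := by linarith
          simp only [ht]
          field_simp
        rw [h5, div_eq_mul_one_div]
        refine mul_le_mul_of_nonneg_left ?_ (by positivity)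
        rw [div_le_div_iff₀ (by positivity) (by positivity)]
        linarith
    · rw [indicator_of_notMem hρ, indicator_of_notMem hρ, mul_zero]

/-- Zeros with γ > 0 have β < σ. Those with β ≥ -2 lie in a vertical strip, where |β - 1/2| is
bounded and square summability suffices. For the others |β - 1/2| = (-2 - β) + 5/2, and the Blaschke
sum controls the unbounded part. -/
theorem summable_order_upper (hf : Differentiable ℂ f) (hc : f (1 / 2) ≠ 0)
    (hb : ∀ z : ℂ, z.re ≤ -2 → ‖f z‖ ≤ 4 * (1 + ‖z‖) ^ 2)
    (hsq : Summable fun ρ : ℂ => (analyticOrderNatAt f ρ : ℝ) / ‖ρ - 1 / 2‖ ^ 2)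
    {σ : ℝ} (hσ : ∀ s : ℂ, σ ≤ s.re → 0 ≤ s.im → f s ≠ 0) :
    Summable ({ρ : ℂ | 0 < ρ.im}.indicator
      fun ρ => (analyticOrderNatAt f ρ : ℝ) * |ρ.re - 1 / 2| / ‖ρ - 1 / 2‖ ^ 2) := by
  refine Summable.of_nonneg_of_le (fun ρ => indicator_nonneg (fun ρ _ => by positivity) ρ)
    (fun ρ => ?_) ((hsq.mul_left (|σ| + 3)).add (summable_order_blaschke hf hc hb))
  have hle : ∀ ρ : ℂ, 0 ≤ {ρ : ℂ | ρ.re < -2}.indicator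
      (fun ρ => (analyticOrderNatAt f ρ : ℝ) * (-2 - ρ.re) / ‖ρ - 1 / 2‖ ^ 2) ρ := by
    refine fun ρ => indicator_nonneg (fun ρ hρ => ?_) ρ
    have hρ' : ρ.re < -2 := hρ
    have h1 : 0 ≤ -2 - ρ.re := by linarith
    positivity
  have hnn : 0 ≤ (|σ| + 3) * ((analyticOrderNatAt f ρ : ℝ) / ‖ρ - 1 / 2‖ ^ 2) := by positivity
  by_cases hu : ρ ∈ {ρ : ℂ | 0 < ρ.im}
  · rw [indicator_of_mem hu]
    have hu' : 0 < ρ.im := hu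
    by_cases h0 : f ρ = 0
    · have hlt : ρ.re < σ := by
        by_contra! h
        exact hσ ρ h hu'.le h0
      have hlt' := hlt.trans_le (le_abs_self σ)
      by_cases hρ : ρ ∈ {ρ : ℂ | ρ.re < -2}
      · rw [indicator_of_mem hρ]
        have hρ' : ρ.re < -2 := hρ
        rw [abs_of_neg (by linarith), ← mul_div_assoc, ← add_div]
        gcongr
        have : (0 : ℝ) ≤ analyticOrderNatAt f ρ := by positivity
        nlinarith [abs_nonneg σ]
      · have hρ' : -2 ≤ ρ.re := not_lt.1 hρ
        have h1 : |ρ.re - 1 / 2| ≤ |σ| + 3 := by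
          rw [abs_le]
          constructor <;> linarith [abs_nonneg σ]
        refine le_add_of_le_of_nonneg ?_ (hle ρ)
        rw [← mul_div_assoc, mul_comm]
        gcongr
    · rw [(analyticOrderNatAt_eq_zero_iff hf hc).2 h0]
      have := hle ρ
      simp only [Nat.cast_zero, zero_mul, zero_div]
      positivity
  · rw [indicator_of_notMem hu]
    exact add_nonneg hnn (hle ρ)

end Entire

/-! ### Analytic phase of an entire function on the real line -/

theorem analyticAt_comp_ofReal {f : ℂ → ℂ} {t : ℝ} (hf : AnalyticAt ℂ f t) :
    AnalyticAt ℝ (fun x : ℝ => f x) t :=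
  AnalyticAt.fun_comp (g := f) (f := fun x : ℝ => (x : ℂ)) hf.restrictScalars (ofRealCLM.analyticAt t)

/-- The argument is lifted by integrating N'/N. It is analytic because near t₀ it differs by a
constant from Im log(N(t)/N(t₀)). -/
theorem exists_analytic_arg {N : ℝ → ℂ} (hN : AnalyticOnNhd ℝ N univ) (h1 : ∀ t, ‖N t‖ = 1)
    {a : ℝ} (h0 : N 0 = exp (a * I)) :
    ∃ φ : ℝ → ℝ, AnalyticOnNhd ℝ φ univ ∧ φ 0 = a ∧ ∀ t, N t = exp (φ t * I) := by
  have hN0 : ∀ t, N t ≠ 0 := fun t => norm_ne_zero_iff.1 (by rw [h1]; exact one_ne_zero)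
  have hcd : Continuous fun t => deriv N t / N t := by
    rw [continuous_iff_continuousAt]
    exact fun t => ((hN t trivial).deriv.continuousAt).div (hN t trivial).continuousAt (hN0 t)
  set W : ℝ → ℂ := fun t => ∫ x in (0 : ℝ)..t, deriv N x / N x with hW
  have hWd : ∀ t, HasDerivAt W (deriv N t / N t) t := fun t =>
    intervalIntegral.integral_hasDerivAt_right (hcd.intervalIntegrable 0 t)
      (hcd.stronglyMeasurableAtFilter _ _) hcd.continuousAt
  have hW0 : W 0 = 0 := by simp [hW]
  have hconst : ∀ t, N t * exp (-W t) = N 0 := by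
    intro t
    have hd : ∀ t, HasDerivAt (fun t => N t * exp (-W t)) 0 t := by
      intro t
      refine ((hN t trivial).differentiableAt.hasDerivAt.mul (hWd t).neg.cexp).congr_deriv ?_
      field_simp [hN0 t]
      ring
    have := is_const_of_deriv_eq_zero (fun t => (hd t).differentiableAt) (fun t => (hd t).deriv) t 0
    simpa [hW0] using this
  have hNW : ∀ t, N t = exp (a * I) * exp (W t) := by
    intro t
    rw [← h0, ← hconst t, mul_assoc, ← exp_add, neg_add_cancel, exp_zero, mul_one]
  have hre : ∀ t, (W t).re = 0 := by
    intro t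
    have := congrArg norm (hNW t)
    rwa [norm_mul, norm_exp_ofReal_mul_I, one_mul, norm_exp, h1, eq_comm,
      Real.exp_eq_one_iff] at this
  have hWI : ∀ t, W t = (W t).im * I := fun t => by
    conv_lhs => rw [← re_add_im (W t), hre t, ofReal_zero, zero_add]
  refine ⟨fun t => a + (W t).im, ?_, by simp [hW0], fun t => ?_⟩
  · intro t₀ _
    have hWc : Continuous W := continuous_iff_continuousAt.2 fun t => (hWd t).continuousAt
    have hloc : ∀ᶠ t in 𝓝 t₀, a + (W t).im = a + (W t₀).im + (log (N t / N t₀)).im := by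
      have hlim : Tendsto (fun t => (W t - W t₀).im) (𝓝 t₀) (𝓝 0) := by
        have : Continuous fun t => (W t - W t₀).im := by fun_prop
        exact this.tendsto' _ _ (by simp)
      filter_upwards [hlim.eventually (Ioo_mem_nhds (neg_lt_zero.2 Real.pi_pos) Real.pi_pos)] with t ht
      have e : N t / N t₀ = exp (W t - W t₀) := by
        rw [hNW t, hNW t₀, mul_div_mul_left _ _ (exp_ne_zero _), exp_sub]
      rw [e, log_exp ht.1 ht.2.le, sub_im]
      ring
    have han : AnalyticAt ℝ (fun t => log (N t / N t₀)) t₀ := by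
      refine AnalyticAt.fun_comp (g := log) (f := fun t => N t / N t₀) ?_ ((hN t₀ trivial).div_const)
      rw [div_self (hN0 t₀)]
      exact (analyticAt_clog (by simp)).restrictScalars
    have hana : AnalyticAt ℝ (fun t => a + (W t₀).im + (log (N t / N t₀)).im) t₀ :=
      analyticAt_const.add (AnalyticAt.fun_comp (g := fun z : ℂ => z.im) (imCLM.analyticAt _) han)
    exact hana.congr (hloc.mono fun t ht => ht.symm)
  · rw [hNW t, hWI t, ← exp_add]
    congr 1
    push_cast
    ring

/-- The unimodular function A / conj A extends analytically across real zeros, because the factor (s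
- t)^k is real and cancels. Half its analytic argument is a phase of A. The start value 2 arg A(0)
gives the required normalization. -/
theorem exists_phase {A : ℂ → ℂ} (hA : Differentiable ℂ A) (hA0 : A 0 ≠ 0) :
    ∃ ω : ℝ → ℝ, AnalyticOnNhd ℝ ω univ ∧ ω 0 = -arg (A 0) ∧
      ∃ g : ℝ → ℝ, AnalyticOnNhd ℝ g univ ∧ ∀ t : ℝ, A t = exp (-(I * ω t)) * g t := by
  have hq : ∀ t : ℝ, ∃ B : ℂ → ℂ, ∃ k : ℕ, Differentiable ℂ B ∧ B t ≠ 0 ∧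
      ∀ z, A z = (z - t) ^ k * B z := by
    intro t
    obtain ⟨k, hk⟩ := ENat.ne_top_iff_exists.1 (analyticOrderAt_ne_top_of_entire hA hA0 t)
    obtain ⟨B, h1, h2, h3⟩ := exists_entire_quotient hA hk.symm
    exact ⟨B, k, h1, h2, h3⟩
  choose B k hB hBt hAB using hq
  set N : ℝ → ℂ := fun t => B t t / (starRingEnd ℂ) (B t t) with hNdef
  have hconj : ∀ (t s : ℝ), ((s : ℂ) - t) ^ k t = (starRingEnd ℂ) (((s : ℂ) - t) ^ k t) := by
    intro t s
    simp
  have hNA : ∀ (t s : ℝ), B t s ≠ 0 → N s = B t s / (starRingEnd ℂ) (B t s) := by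
    intro t s hs
    rcases eq_or_ne s t with rfl | hst
    · rfl
    · have hst' : ((s : ℂ) - t) ^ k t ≠ 0 := pow_ne_zero _ (sub_ne_zero.2 (by exact_mod_cast hst))
      have hAs : A s ≠ 0 := by
        rw [hAB t]
        exact mul_ne_zero hst' hs
      have hks : k s = 0 := by
        by_contra h
        exact hAs (by rw [hAB s, sub_self, zero_pow h, zero_mul])
      have h1 : A s = B s s := by rw [hAB s, hks, pow_zero, one_mul]
      rw [hNdef]
      simp only []
      rw [← h1, hAB t, map_mul, ← hconj, mul_div_mul_left _ _ hst']
  have hBan : ∀ t s : ℝ, AnalyticAt ℝ (fun x : ℝ => B t x) s := fun t s =>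
    analyticAt_comp_ofReal ((hB t).analyticAt _)
  have hcan : ∀ t s : ℝ, AnalyticAt ℝ (fun x : ℝ => (starRingEnd ℂ) (B t x)) s := fun t s =>
    AnalyticAt.fun_comp (g := fun z => (starRingEnd ℂ) z)
      ((conjCLE : ℂ →L[ℝ] ℂ).analyticAt _) (hBan t s)
  have hN : AnalyticOnNhd ℝ N univ := by
    intro t _
    refine ((hBan t t).div (hcan t t) (by simpa using hBt t)).congr ?_
    have hev : ∀ᶠ s : ℝ in 𝓝 t, B t s ≠ 0 := (hBan t t).continuousAt.eventually_ne (hBt t)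
    filter_upwards [hev] with s hs using (hNA t s hs).symm
  have hN1 : ∀ t, ‖N t‖ = 1 := fun t => by
    rw [hNdef]
    simp only []
    rw [norm_div, RCLike.norm_conj, div_self (norm_ne_zero_iff.2 (hBt t))]
  have hNA' : ∀ t : ℝ, A t = N t * (starRingEnd ℂ) (A t) := by
    intro t
    rw [hAB t t, map_mul, ← hconj, hNdef]
    have : (starRingEnd ℂ) (B t t) ≠ 0 := by simpa using hBt t
    field_simp
  have hN0 : N 0 = exp ((2 * arg (A 0) : ℝ) * I) := by
    have h := hNA' 0
    rw [ofReal_zero] at h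
    have hc : (starRingEnd ℂ) (A 0) ≠ 0 := by simpa using hA0
    refine mul_right_cancel₀ hc ?_
    have hcp : (starRingEnd ℂ) (A 0) = ‖A 0‖ * exp (arg (A 0) * -I) := by
      conv_lhs => rw [← norm_mul_exp_arg_mul_I (A 0)]
      rw [map_mul, conj_ofReal, ← exp_conj, map_mul, conj_ofReal, conj_I]
    rw [← h, hcp, mul_left_comm, ← exp_add]
    conv_lhs => rw [← norm_mul_exp_arg_mul_I (A 0)]
    congr 2
    push_cast
    ring
  obtain ⟨φ, hφ, hφ0, hNφ⟩ := exists_analytic_arg hN hN1 hN0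
  have hreal : ∀ t : ℝ, (exp (I * (-(φ t / 2) : ℝ)) * A t).im = 0 := by
    intro t
    rw [← conj_eq_iff_im, map_mul, ← exp_conj, map_mul, conj_I, conj_ofReal]
    conv_rhs => rw [hNA' t, hNφ t, ← mul_assoc, ← exp_add]
    congr 2
    push_cast
    ring
  have hexp : ∀ t, AnalyticAt ℝ (fun t : ℝ => exp (I * (-(φ t / 2) : ℝ)) * A t) t := by
    intro t
    refine AnalyticAt.mul ?_ (analyticAt_comp_ofReal (hA.analyticAt _))
    refine AnalyticAt.fun_comp (g := exp) (analyticAt_cexp.restrictScalars) ?_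
    refine analyticAt_const.mul (AnalyticAt.fun_comp (g := fun x : ℝ => (x : ℂ)) (ofRealCLM.analyticAt _) ?_)
    exact ((hφ t trivial).div_const).neg
  refine ⟨fun t => -(φ t / 2), fun t ht => ((hφ t ht).div_const).neg, by simp [hφ0],
    fun t => (exp (I * (-(φ t / 2) : ℝ)) * A t).re, fun t _ =>
      AnalyticAt.fun_comp (g := fun z : ℂ => z.re) (reCLM.analyticAt _) (hexp t), fun t => ?_⟩
  have h : (((exp (I * (-(φ t / 2) : ℝ)) * A t).re : ℝ) : ℂ) = exp (I * (-(φ t / 2) : ℝ)) * A t := by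
    apply Complex.ext
    · simp
    · rw [hreal t]
      simp
  rw [h, ← mul_assoc, ← exp_add, neg_add_cancel, exp_zero, one_mul]

/-- Off its zeros, the phase of an entire function on the real axis has the derivative
`-Im (A' / A)`. -/
theorem deriv_phase {A : ℂ → ℂ} (hA : Differentiable ℂ A) {ω g : ℝ → ℝ}
    (hω : AnalyticOnNhd ℝ ω univ) (hg : AnalyticOnNhd ℝ g univ)
    (hAg : ∀ t : ℝ, A t = exp (-(I * ω t)) * g t) {t : ℝ} (ht : A t ≠ 0) :
    deriv ω t = -(logDeriv A t).im := by
  have h1 : HasDerivAt (fun t : ℝ => A t) (deriv A t) t := (hA t).hasDerivAt.comp_ofReal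
  have h2 : HasDerivAt (fun t : ℝ => exp (-(I * ω t)) * (g t : ℂ))
      (exp (-(I * ω t)) * -(I * (deriv ω t : ℝ)) * g t + exp (-(I * ω t)) * (deriv g t : ℝ)) t :=
    (((hω t trivial).differentiableAt.hasDerivAt.ofReal_comp.const_mul I).neg.cexp).mul
      (hg t trivial).differentiableAt.hasDerivAt.ofReal_comp
  rw [← funext hAg] at h2
  have h3 := h1.unique h2
  have hgt : (g t : ℂ) ≠ 0 := fun h => ht (by rw [hAg, h, mul_zero])
  rw [logDeriv_apply, h3, hAg t]
  have h4 : (exp (-(I * ω t)) * -(I * (deriv ω t : ℝ)) * g t + exp (-(I * ω t)) * (deriv g t : ℝ)) /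
      (exp (-(I * ω t)) * g t) = -(I * (deriv ω t : ℝ)) + ((deriv g t / g t : ℝ) : ℂ) := by
    have := exp_ne_zero (-(I * ω t))
    push_cast
    field_simp
  rw [h4]
  simp

/-! ### Nontrivial zeros of R as zeros of G, and the logarithmic derivative of R -/

theorem ofReal_pi_ne_zero : (Real.pi : ℂ) ≠ 0 := ofReal_ne_zero.2 Real.pi_ne_zero

theorem mul_auxR_mul_Gamma {s : ℂ} (h : ∀ m : ℕ, s / 2 ≠ -m) :
    s * auxR s * Gamma (s / 2) = (Real.pi : ℂ) ^ (s / 2) * (exp (I * Real.pi * s / 4) * auxG s) := by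
  rw [mul_auxR_eq]
  field_simp [Gamma_ne_zero h]

theorem auxF_eq {s : ℂ} (h : ∀ m : ℕ, s / 2 ≠ -m) :
    auxF s = exp (I * Real.pi * s / 4) * auxG s := by
  rw [auxF, neg_div, cpow_neg]
  have h1 : (Real.pi : ℂ) ^ (s / 2) ≠ 0 := by simp [cpow_eq_zero_iff]
  rw [show s * ((Real.pi : ℂ) ^ (s / 2))⁻¹ * Gamma (s / 2) * auxR s =
    ((Real.pi : ℂ) ^ (s / 2))⁻¹ * (s * auxR s * Gamma (s / 2)) by ring, mul_auxR_mul_Gamma h,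
    inv_mul_cancel_left₀ h1]

theorem eventually_half_ne_neg_nat (ρ : ℂ) : ∀ᶠ s : ℂ in 𝓝[≠] ρ, ∀ m : ℕ, s / 2 ≠ -m := by
  have hd : Differentiable ℂ fun s : ℂ => (Gamma (s / 2))⁻¹ :=
    differentiable_one_div_Gamma.comp (by fun_prop : Differentiable ℂ fun s : ℂ => s / 2)
  have h2 : (Gamma ((2 : ℂ) / 2))⁻¹ ≠ 0 := by simp
  have hne := analyticOrderAt_ne_top_of_entire (c := 2) hd h2 ρ
  rcases (hd.analyticAt ρ).eventually_eq_zero_or_eventually_ne_zero with h | h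
  · exact absurd (analyticOrderAt_eq_top.2 h) hne
  · filter_upwards [h] with s hs m hm
    exact hs (by rw [hm, Gamma_neg_nat_eq_zero, inv_zero])

/-- The meromorphic order ignores values at isolated points, hence also the conventional values of Γ
at its poles. The remaining factor e^(πis/4) has no zeros. -/
theorem mult_eq (ρ : ℂ) : mult ρ = analyticOrderNatAt auxG ρ := by
  have hev : auxF =ᶠ[𝓝[≠] ρ] fun s => exp (I * Real.pi * s / 4) * auxG s := by
    filter_upwards [eventually_half_ne_neg_nat ρ] with s hs using auxF_eq hs
  have he : AnalyticAt ℂ (fun s => exp (I * Real.pi * s / 4)) ρ :=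
    Differentiable.analyticAt (by fun_prop) ρ
  have hG := differentiable_auxG.analyticAt ρ
  rw [mult, meromorphicOrderAt_congr hev]
  have : AnalyticAt ℂ (fun s => exp (I * Real.pi * s / 4) * auxG s) ρ := he.mul hG
  rw [this.meromorphicOrderAt_eq]
  have h2 : analyticOrderAt (fun s => exp (I * Real.pi * s / 4) * auxG s) ρ =
      analyticOrderAt auxG ρ := by
    refine (analyticOrderAt_mul he hG).trans ?_
    rw [he.analyticOrderAt_eq_zero.2 (exp_ne_zero _), zero_add]
  rw [h2]
  obtain ⟨k, hk⟩ := ENat.ne_top_iff_exists.1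
    (analyticOrderAt_ne_top_of_entire differentiable_auxG auxG_half_ne_zero ρ)
  rw [analyticOrderNatAt, ← hk]
  rfl

theorem cast_mult (ρ : ℂ) : (mult ρ : ℝ) = analyticOrderNatAt auxG ρ := by
  rw [mult_eq, Int.cast_natCast]

theorem mult_nonneg (ρ : ℂ) : 0 ≤ mult ρ := by
  rw [mult_eq]
  positivity

theorem mult_eq_zero_iff {ρ : ℂ} : mult ρ = 0 ↔ auxG ρ ≠ 0 := by
  rw [mult_eq, Nat.cast_eq_zero, analyticOrderNatAt_eq_zero_iff differentiable_auxG auxG_half_ne_zero]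

theorem norm_auxG_le_center (z : ℂ) :
    ‖auxG z‖ ≤ Real.exp (48 * (‖z - 1 / 2‖ + 1) * √(‖z - 1 / 2‖ + 1)) := by
  refine (norm_auxG_le z).trans (Real.exp_le_exp.2 ?_)
  have h1 : ‖z‖ ≤ ‖z - 1 / 2‖ + 1 / 2 := by
    have := norm_add_le (z - 1 / 2) (1 / 2)
    rw [sub_add_cancel] at this
    refine this.trans (by norm_num)
  have h0 := norm_nonneg (z - 1 / 2)
  have h2 : √(‖z‖ + 2) ≤ 2 * √(‖z - 1 / 2‖ + 1) := by
    rw [show (2 : ℝ) = √4 by rw [show (4 : ℝ) = 2 ^ 2 by norm_num]; simp, ← Real.sqrt_mul (by norm_num)]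
    refine Real.sqrt_le_sqrt ?_
    rw [show √4 = (2 : ℝ) by rw [show (4 : ℝ) = 2 ^ 2 by norm_num]; simp]
    linarith
  calc 8 * (‖z‖ + 2) * √(‖z‖ + 2)
      ≤ 8 * (3 * (‖z - 1 / 2‖ + 1)) * (2 * √(‖z - 1 / 2‖ + 1)) := by gcongr; linarith
    _ = _ := by ring

theorem summable_mult_div_sq : Summable fun ρ : ℂ => (mult ρ : ℝ) / ‖ρ - 1 / 2‖ ^ 2 := by
  simp only [cast_mult]
  exact summable_order_div_sq differentiable_auxG auxG_half_ne_zero (by norm_num) norm_auxG_le_center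

theorem summable_mult_upper : Summable ({ρ : ℂ | 0 < ρ.im}.indicator
    fun ρ => (mult ρ : ℝ) * |ρ.re - 1 / 2| / ‖ρ - 1 / 2‖ ^ 2) := by
  obtain ⟨σ, hσ⟩ := exists_auxG_ne_zero
  have h := summable_mult_div_sq
  simp only [cast_mult] at h ⊢
  exact summable_order_upper differentiable_auxG auxG_half_ne_zero
    (fun z hz => norm_auxG_le_of_re_le hz) h hσ

theorem summable_mult_mul_sub (s : ℂ) :
    Summable fun ρ : ℂ => (mult ρ : ℂ) * (1 / (s - ρ) - 1 / (1 / 2 - ρ)) := by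
  have h := summable_mult_div_sq
  simp only [mult_eq, Int.cast_natCast] at h ⊢
  exact summable_order_mul_sub differentiable_auxG auxG_half_ne_zero h s

theorem hasSum_logDeriv_auxG {s : ℂ} (hs : auxG s ≠ 0) :
    HasSum (fun ρ : ℂ => (mult ρ : ℂ) * (1 / (s - ρ) - 1 / (1 / 2 - ρ)))
      (logDeriv auxG s - logDeriv auxG (1 / 2)) := by
  rw [logDeriv_sub_eq_tsum differentiable_auxG auxG_half_ne_zero (by norm_num) norm_auxG_le_center hs]
  convert (summable_mult_mul_sub s).hasSum using 3 with ρ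
  rw [mult_eq, Int.cast_natCast]

theorem half_line_ne_neg_nat (t : ℝ) (m : ℕ) : (1 / 2 + t * I : ℂ) / 2 ≠ -m := by
  have := gamma_arg_ne t m
  rwa [show (1 / 2 + t * I : ℂ) / 2 = 1 / 4 + t / 2 * I by ring]

theorem half_line_ne_zero (t : ℝ) : (1 / 2 + t * I : ℂ) ≠ 0 := by
  intro h
  have := congrArg re h
  simp at this

theorem auxR_half_line_eq_zero_iff (t : ℝ) : auxR (1 / 2 + t * I) = 0 ↔ auxG (1 / 2 + t * I) = 0 := by
  have h := mul_auxR_mul_Gamma (half_line_ne_neg_nat t)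
  have h1 := Gamma_ne_zero (half_line_ne_neg_nat t)
  have h2 := half_line_ne_zero t
  have h3 : (Real.pi : ℂ) ^ ((1 / 2 + t * I : ℂ) / 2) ≠ 0 := by
    simp [cpow_eq_zero_iff]
  have h4 := exp_ne_zero (I * Real.pi * (1 / 2 + t * I) / 4)
  constructor
  · intro h0
    rw [h0, mul_zero, zero_mul, eq_comm] at h
    simpa only [mul_eq_zero, h3, h4, false_or] using h
  · intro h0
    rw [h0, mul_zero, mul_zero] at h
    simpa only [mul_eq_zero, h1, h2, false_or, or_false] using h

/-- Logarithmic derivative of s R(s) Γ(s/2) = π^(s/2) e^(πis/4) G(s). Each summand will account for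
one term of the final formula, and iπ/4 drops out of the real part. -/
theorem logDeriv_auxR_half_line {t : ℝ} (ht : auxG (1 / 2 + t * I) ≠ 0) :
    logDeriv auxR (1 / 2 + t * I) = Real.log Real.pi / 2 + I * Real.pi / 4 +
      logDeriv auxG (1 / 2 + t * I) - digamma (1 / 4 + t / 2 * I) / 2 - 1 / (1 / 2 + t * I) := by
  have hR : auxR (1 / 2 + t * I) ≠ 0 := fun h => ht ((auxR_half_line_eq_zero_iff t).1 h)
  have hΓ := Gamma_ne_zero (half_line_ne_neg_nat t)
  have hdΓ := differentiableAt_Gamma _ (half_line_ne_neg_nat t)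
  have hs := half_line_ne_zero t
  have harg : (1 / 2 + t * I : ℂ) / 2 = 1 / 4 + t / 2 * I := by ring
  rw [← harg]
  set s : ℂ := 1 / 2 + t * I
  have hpi : (Real.pi : ℂ) ^ (s / 2) ≠ 0 := by simp [cpow_eq_zero_iff]
  have hdh : HasDerivAt (fun z : ℂ => z / 2) (1 / 2) s := (hasDerivAt_id s).div_const 2
  have hdg : HasDerivAt (fun z : ℂ => Gamma (z / 2)) (deriv Gamma (s / 2) * (1 / 2)) s :=
    HasDerivAt.comp s hdΓ.hasDerivAt hdh
  have hdp : HasDerivAt (fun z : ℂ => (Real.pi : ℂ) ^ (z / 2))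
      ((Real.pi : ℂ) ^ (s / 2) * log Real.pi * (1 / 2)) s :=
    hdh.const_cpow (Or.inl ofReal_pi_ne_zero)
  have hde : HasDerivAt (fun z : ℂ => exp (I * Real.pi * z / 4))
      (exp (I * Real.pi * s / 4) * (I * Real.pi / 4)) s := by
    have h1 : HasDerivAt (fun z : ℂ => I * Real.pi * z / 4) (I * Real.pi / 4) s := by
      simpa using ((hasDerivAt_id s).const_mul (I * Real.pi)).div_const 4
    exact h1.cexp
  have hev : (fun z => z * auxR z * Gamma (z / 2)) =ᶠ[𝓝 s]
      fun z => (Real.pi : ℂ) ^ (z / 2) * (exp (I * Real.pi * z / 4) * auxG z) := by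
    have hc : ∀ᶠ z in 𝓝 s, Gamma (z / 2) ≠ 0 := hdg.continuousAt.eventually_ne hΓ
    filter_upwards [hc] with z hz
    refine mul_auxR_mul_Gamma fun m hm => hz ?_
    rw [hm, Gamma_neg_nat_eq_zero]
  have hl : logDeriv (fun z => z * auxR z * Gamma (z / 2)) s =
      logDeriv (fun z => (Real.pi : ℂ) ^ (z / 2) * (exp (I * Real.pi * z / 4) * auxG z)) s := by
    simp only [logDeriv_apply]
    rw [hev.deriv_eq, mul_auxR_mul_Gamma (half_line_ne_neg_nat t)]
  have hdR := differentiable_auxR s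
  rw [logDeriv_mul (f := fun z => z * auxR z) s (mul_ne_zero hs hR) hΓ (differentiableAt_id.mul hdR)
      hdg.differentiableAt,
    logDeriv_mul (f := fun z => z) s hs hR differentiableAt_id hdR,
    logDeriv_mul (g := fun z => exp (I * Real.pi * z / 4) * auxG z) s hpi (mul_ne_zero (exp_ne_zero _) ht) hdp.differentiableAt
      (hde.differentiableAt.mul (differentiable_auxG s)),
    logDeriv_mul (f := fun z => exp (I * Real.pi * z / 4)) (g := auxG) s (exp_ne_zero _) ht hde.differentiableAt (differentiable_auxG s)] at hl
  have e1 : logDeriv (fun z : ℂ => z) s = 1 / s := by simp [logDeriv_apply]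
  have e2 : logDeriv (fun z : ℂ => Gamma (z / 2)) s = digamma (s / 2) / 2 := by
    rw [logDeriv_apply, hdg.deriv, digamma_def, logDeriv_apply]
    ring
  have e3 : logDeriv (fun z : ℂ => (Real.pi : ℂ) ^ (z / 2)) s = Real.log Real.pi / 2 := by
    rw [logDeriv_apply, hdp.deriv, ofReal_log Real.pi_pos.le]
    field_simp
  have e4 : logDeriv (fun z : ℂ => exp (I * Real.pi * z / 4)) s = I * Real.pi / 4 := by
    rw [logDeriv_apply, hde.deriv]
    field_simp
  rw [e1, e2, e3, e4] at hl
  linear_combination hl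

theorem eventually_auxG_half_line_ne_zero (t₀ : ℝ) :
    ∀ᶠ t : ℝ in 𝓝[≠] t₀, auxG (1 / 2 + t * I) ≠ 0 := by
  have hG := differentiable_auxG.analyticAt (1 / 2 + t₀ * I)
  have h : ∀ᶠ z in 𝓝[≠] (1 / 2 + t₀ * I : ℂ), auxG z ≠ 0 := by
    rcases hG.eventually_eq_zero_or_eventually_ne_zero with h | h
    · exact absurd (analyticOrderAt_eq_top.2 h)
        (analyticOrderAt_ne_top_of_entire differentiable_auxG auxG_half_ne_zero _)
    · exact h
  have ht : Tendsto (fun t : ℝ => (1 / 2 + t * I : ℂ)) (𝓝[≠] t₀) (𝓝[≠] (1 / 2 + t₀ * I : ℂ)) := by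
    refine tendsto_nhdsWithin_of_tendsto_nhds_of_eventually_within _ ?_ ?_
    · have : Continuous fun t : ℝ => (1 / 2 + t * I : ℂ) := by fun_prop
      exact this.continuousAt.mono_left nhdsWithin_le_nhds
    · filter_upwards [self_mem_nhdsWithin] with t ht h
      refine ht ?_
      have := congrArg im h
      simpa using this
  exact ht.eventually h

/-- Zeros on the critical line are isolated, so identities of continuous functions proved off them
hold everywhere. -/
theorem eq_of_forall_auxG_half_line_ne_zero {f g : ℝ → ℝ} (hf : Continuous f) (hg : Continuous g)
    (h : ∀ t : ℝ, auxG (1 / 2 + t * I) ≠ 0 → f t = g t) (t : ℝ) : f t = g t := by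
  refine tendsto_nhds_unique_of_eventuallyEq (l := 𝓝[≠] t)
    (hf.continuousAt.mono_left nhdsWithin_le_nhds) (hg.continuousAt.mono_left nhdsWithin_le_nhds) ?_
  filter_upwards [eventually_auxG_half_line_ne_zero t] with x hx using h x hx

/-- The derivative of a phase off the zeros on the critical line. -/
theorem IsPhase.deriv_eq {ω : ℝ → ℝ} (hω : IsPhase ω) {t : ℝ} (ht : auxG (1 / 2 + t * I) ≠ 0) :
    deriv ω t = -(logDeriv auxR (1 / 2 + t * I)).re := by
  obtain ⟨h1, -, g, hg, hAg⟩ := hω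
  have hA : Differentiable ℂ fun z : ℂ => auxR (1 / 2 + z * I) :=
    differentiable_auxR.comp (by fun_prop : Differentiable ℂ fun z : ℂ => (1 / 2 + z * I : ℂ))
  rw [deriv_phase hA h1 hg hAg (fun h => ht ((auxR_half_line_eq_zero_iff t).1 h))]
  have hd : HasDerivAt (fun z : ℂ => (1 / 2 + z * I : ℂ)) I t := by
    simpa using ((hasDerivAt_id (t : ℂ)).mul_const I).const_add (1 / 2)
  have h2 := HasDerivAt.comp (t : ℂ) (differentiable_auxR (1 / 2 + t * I)).hasDerivAt hd
  have h3 : logDeriv (fun z : ℂ => auxR (1 / 2 + z * I)) t = logDeriv auxR (1 / 2 + t * I) * I := by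
    rw [logDeriv_apply, logDeriv_apply]
    rw [show deriv (fun z : ℂ => auxR (1 / 2 + z * I)) t = _ from h2.deriv]
    ring
  rw [h3]
  simp

/-- For uniqueness, off the zeros the derivative of any phase is -Re R'/R(1/2 + it), hence it is
determined everywhere by continuity, and the value at 0 is prescribed. -/
theorem existsUnique_isPhase : ∃! ω : ℝ → ℝ, IsPhase ω := by
  have hA : Differentiable ℂ fun z : ℂ => auxR (1 / 2 + z * I) :=
    differentiable_auxR.comp (by fun_prop : Differentiable ℂ fun z : ℂ => (1 / 2 + z * I : ℂ))
  have hA0 : auxR (1 / 2 + 0 * I) ≠ 0 := by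
    intro h
    have := (auxR_half_line_eq_zero_iff 0).1 (by simpa using h)
    exact auxG_half_ne_zero (by simpa using this)
  obtain ⟨ω, h1, h2, h3⟩ := exists_phase hA hA0
  have hω : IsPhase ω := ⟨h1, by simpa using h2, h3⟩
  refine ⟨ω, hω, fun ω' hω' => ?_⟩
  have hcont : ∀ {φ : ℝ → ℝ}, AnalyticOnNhd ℝ φ univ → Continuous (deriv φ) := fun hφ =>
    continuous_iff_continuousAt.2 fun t => (hφ t trivial).deriv.continuousAt
  have hd := eq_of_forall_auxG_half_line_ne_zero (hcont hω'.1) (hcont hω.1)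
    fun t ht => by rw [hω'.deriv_eq ht, hω.deriv_eq ht]
  have hdiff : ∀ {φ : ℝ → ℝ}, AnalyticOnNhd ℝ φ univ → Differentiable ℝ φ := fun hφ t =>
    (hφ t trivial).differentiableAt
  exact eq_of_fderiv_eq (hdiff hω'.1) (hdiff hω.1)
    (fun t => by ext; simpa using hd t) 0 (by rw [hω'.2.1, hω.2.1])

/-! ### Sums over the zeros on the critical line -/

/-- This turns the partial fractions of G'/G into the kernel of u and d. It also holds when the
point equals ρ, both sides then being 0. -/
theorem re_one_div_sub (ρ : ℂ) (x : ℝ) : (1 / (1 / 2 + x * I - ρ)).re = -kern ρ x := by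
  rw [one_div, inv_re, normSq_apply, kern, ← neg_div]
  simp
  congr 1
  ring

theorem kern_zero (ρ : ℂ) : kern ρ 0 = (ρ.re - 1 / 2) / ‖ρ - 1 / 2‖ ^ 2 := by
  rw [kern, ← normSq_eq_norm_sq, normSq_apply]
  simp
  ring

theorem continuous_kern (ρ : ℂ) : Continuous (kern ρ) := by
  rcases eq_or_ne (ρ.re - 1 / 2) 0 with h | h
  · have : kern ρ = fun _ => 0 := by
      ext x
      rw [kern, h, zero_div]
    rw [this]
    exact continuous_const
  · unfold kern
    refine continuous_const.div (by fun_prop) fun x => ?_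
    positivity

theorem abs_kern_le (ρ : ℂ) (x : ℝ) : |kern ρ x| ≤ 1 / |ρ.re - 1 / 2| := by
  rw [kern, abs_div, abs_of_nonneg (a := _ + _) (by positivity)]
  rcases eq_or_ne (ρ.re - 1 / 2) 0 with h | h
  · rw [h, abs_zero, zero_div, div_zero]
  · have h0 : 0 < |ρ.re - 1 / 2| := abs_pos.2 h
    have h1 : 0 < (ρ.re - 1 / 2) ^ 2 := by positivity
    rw [div_le_div_iff₀ (by positivity) h0, ← sq, sq_abs]
    nlinarith [sq_nonneg (ρ.im - x)]

theorem abs_kern_sub_le {ρ : ℂ} {x X : ℝ} (hx : |x| ≤ X) (hρ : 2 * X < ‖ρ - 1 / 2‖) :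
    |kern ρ x - kern ρ 0| ≤ 2 * X / ‖ρ - 1 / 2‖ ^ 2 := by
  have hX : 0 ≤ X := (abs_nonneg x).trans hx
  have h0 := re_one_div_sub ρ 0
  rw [ofReal_zero, zero_mul, add_zero] at h0
  have h : kern ρ x - kern ρ 0 = -(1 / (1 / 2 + x * I - ρ) - 1 / (1 / 2 - ρ)).re := by
    rw [sub_re, re_one_div_sub, h0]
    ring
  rw [h, abs_neg]
  refine (abs_re_le_norm _).trans ?_
  have hρ0 : 0 < ‖ρ - 1 / 2‖ := by linarith
  have hxI : ‖(x : ℂ) * I‖ = |x| := by simp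
  have hge : ‖ρ - 1 / 2‖ / 2 ≤ ‖1 / 2 + x * I - ρ‖ := by
    have := norm_sub_le ((x : ℂ) * I) (1 / 2 + x * I - ρ)
    rw [show (x : ℂ) * I - (1 / 2 + x * I - ρ) = ρ - 1 / 2 by ring, hxI] at this
    linarith
  have h1 : 1 / 2 + x * I - ρ ≠ 0 := norm_pos_iff.1 (by linarith)
  have h2 : 1 / 2 - ρ ≠ 0 := norm_pos_iff.1 (by rwa [norm_sub_rev])
  rw [div_sub_div _ _ h1 h2, norm_div, norm_mul,
    show 1 * (1 / 2 - ρ) - (1 / 2 + x * I - ρ) * 1 = -(x * I) by ring, norm_neg, hxI,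
    norm_sub_rev (1 / 2) ρ]
  calc |x| / (‖1 / 2 + x * I - ρ‖ * ‖ρ - 1 / 2‖) ≤ X / (‖ρ - 1 / 2‖ / 2 * ‖ρ - 1 / 2‖) := by gcongr
    _ = _ := by field_simp

theorem summable_mult_mul_kern_sub (x : ℝ) :
    Summable fun ρ : ℂ => (mult ρ : ℝ) * (kern ρ x - kern ρ 0) := by
  have h := (reCLM.summable (summable_mult_mul_sub (1 / 2 + x * I))).neg
  refine h.congr fun ρ => ?_
  have h0 := re_one_div_sub ρ 0
  rw [ofReal_zero, zero_mul, add_zero] at h0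
  rw [reCLM_apply, show (mult ρ : ℂ) = ((mult ρ : ℝ) : ℂ) by push_cast; rfl, re_ofReal_mul, sub_re,
    re_one_div_sub, h0]
  ring

theorem hasSum_mult_mul_kern_sub {x : ℝ} (hx : auxG (1 / 2 + x * I) ≠ 0) :
    HasSum (fun ρ : ℂ => (mult ρ : ℝ) * (kern ρ x - kern ρ 0))
      ((logDeriv auxG (1 / 2)).re - (logDeriv auxG (1 / 2 + x * I)).re) := by
  have h := (reCLM.hasSum (hasSum_logDeriv_auxG hx)).neg
  rw [reCLM_apply, sub_re, neg_sub] at h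
  have hfun : (fun ρ : ℂ => (mult ρ : ℝ) * (kern ρ x - kern ρ 0)) = fun ρ =>
      -reCLM ((mult ρ : ℂ) * (1 / (1 / 2 + x * I - ρ) - 1 / (1 / 2 - ρ))) := by
    funext ρ
    rw [show (mult ρ : ℂ) = ((mult ρ : ℝ) : ℂ) by push_cast; rfl, reCLM_apply, re_ofReal_mul,
      sub_re, re_one_div_sub, show (1 / (1 / 2 - ρ)).re = -kern ρ 0 by
        simpa using re_one_div_sub ρ 0]
    ring
  rw [hfun]
  exact h

/-- Locally uniform convergence: for |x| < X, zeros with |ρ - 1/2| > 2X contribute O(m/|ρ - 1/2|²),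
and the finitely many others are bounded by 2m/|β - 1/2|. Zeros with β = 1/2 contribute 0, in
accordance with 2/0 = 0. -/
theorem continuous_tsum_mult_mul_kern_sub (Z : Set ℂ) :
    Continuous fun x : ℝ => ∑' ρ : Z, (mult ρ : ℝ) * (kern ρ x - kern ρ 0) := by
  rw [continuous_iff_continuousAt]
  intro x₀
  set X := |x₀| + 1 with hX
  have hmem : Ioo (-X) X ∈ 𝓝 x₀ := Ioo_mem_nhds (by linarith [neg_abs_le x₀]) (by linarith [le_abs_self x₀])
  have hX0 : 0 < X := by positivity
  have hfin := finite_zeros_of_isCompact differentiable_auxG auxG_half_ne_zero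
    (isCompact_closedBall (1 / 2 : ℂ) (2 * X))
  set F := hfin.toFinset
  set v : ℂ → ℝ := fun ρ => 2 * X * ((mult ρ : ℝ) / ‖ρ - 1 / 2‖ ^ 2) +
    (F : Set ℂ).indicator (fun ρ => (mult ρ : ℝ) * (2 / |ρ.re - 1 / 2|)) ρ with hv
  have hm0 : ∀ ρ, (0 : ℝ) ≤ mult ρ := fun ρ => by exact_mod_cast mult_nonneg ρ
  have hvs : Summable v := by
    refine (summable_mult_div_sq.mul_left _).add ?_
    exact summable_of_ne_finset_zero (s := F) fun ρ hρ => indicator_of_notMem hρ _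
  have hle : ∀ ρ : ℂ, ∀ x ∈ Ioo (-X) X, ‖(mult ρ : ℝ) * (kern ρ x - kern ρ 0)‖ ≤ v ρ := by
    intro ρ x hx
    rw [norm_mul, Real.norm_of_nonneg (hm0 ρ), Real.norm_eq_abs]
    have h1 : 0 ≤ 2 * X * ((mult ρ : ℝ) / ‖ρ - 1 / 2‖ ^ 2) := by
      have := hm0 ρ
      positivity
    have h2 : 0 ≤ (F : Set ℂ).indicator (fun ρ => (mult ρ : ℝ) * (2 / |ρ.re - 1 / 2|)) ρ :=
      indicator_nonneg (fun ρ _ => mul_nonneg (hm0 ρ) (by positivity)) ρ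
    by_cases hG : auxG ρ = 0
    · by_cases hb : ‖ρ - 1 / 2‖ ≤ 2 * X
      · have hF : ρ ∈ (F : Set ℂ) := by
          rw [Finset.mem_coe, Set.Finite.mem_toFinset]
          exact ⟨by rwa [mem_closedBall_iff_norm], hG⟩
        refine le_add_of_nonneg_of_le h1 ?_
        rw [indicator_of_mem hF]
        refine mul_le_mul_of_nonneg_left ((abs_sub _ _).trans ?_) (hm0 ρ)
        calc _ ≤ 1 / |ρ.re - 1 / 2| + 1 / |ρ.re - 1 / 2| :=
              add_le_add (abs_kern_le ρ x) (abs_kern_le ρ 0)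
          _ = _ := by ring
      · refine le_add_of_le_of_nonneg ?_ h2
        calc _ ≤ (mult ρ : ℝ) * (2 * X / ‖ρ - 1 / 2‖ ^ 2) :=
              mul_le_mul_of_nonneg_left (abs_kern_sub_le (abs_le.2 ⟨hx.1.le, hx.2.le⟩)
                (not_le.1 hb)) (hm0 ρ)
          _ = _ := by ring
    · rw [mult_eq_zero_iff.2 hG, Int.cast_zero, zero_mul]
      exact add_nonneg h1 h2
  refine (continuousOn_tsum (u := fun ρ : Z => v ρ) (fun ρ => Continuous.continuousOn ?_)
    (hvs.subtype Z) fun ρ x hx => hle ρ x hx).continuousAt hmem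
  exact continuous_const.mul ((continuous_kern _).sub continuous_const)

theorem summable_downTerm (x : ℝ) : Summable (downTerm x) :=
  (summable_mult_mul_kern_sub x).subtype lowerZeros

/-- The counterterms at x = 0 are summable by themselves over γ > 0. This allows u to be defined
without them. -/
theorem summable_upper_kern_zero : Summable fun ρ : upperZeros => (mult ρ : ℝ) * kern ρ 0 := by
  have h : Summable fun ρ : upperZeros => {ρ : ℂ | 0 < ρ.im}.indicator
      (fun ρ => (mult ρ : ℝ) * |ρ.re - 1 / 2| / ‖ρ - 1 / 2‖ ^ 2) ρ :=
    summable_mult_upper.subtype upperZeros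
  refine Summable.of_norm_bounded h fun ρ => ?_
  have hm : (ρ : ℂ) ∈ {ρ : ℂ | 0 < ρ.im} := ρ.2.2
  have hm0 : (0 : ℝ) ≤ mult ρ := by exact_mod_cast mult_nonneg ρ
  rw [indicator_of_mem hm, kern_zero, norm_mul, norm_div, Real.norm_of_nonneg hm0,
    Real.norm_eq_abs, Real.norm_of_nonneg (by positivity : (0 : ℝ) ≤ ‖(ρ : ℂ) - 1 / 2‖ ^ 2),
    mul_div_assoc]

theorem upTerm_eq (x : ℝ) (ρ : upperZeros) :
    upTerm x ρ = (mult ρ : ℝ) * (kern ρ x - kern ρ 0) + (mult ρ : ℝ) * kern ρ 0 := by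
  rw [upTerm]
  ring

theorem summable_upTerm (x : ℝ) : Summable (upTerm x) := by
  refine (((summable_mult_mul_kern_sub x).subtype upperZeros).add
    summable_upper_kern_zero).congr fun ρ => ?_
  rw [upTerm_eq]
  rfl

theorem tsum_upTerm (x : ℝ) : ∑' ρ, upTerm x ρ =
    ∑' ρ : upperZeros, (mult ρ : ℝ) * (kern ρ x - kern ρ 0) +
      ∑' ρ : upperZeros, (mult ρ : ℝ) * kern ρ 0 := by
  simp only [upTerm_eq]
  exact ((summable_mult_mul_kern_sub x).subtype upperZeros).tsum_add summable_upper_kern_zero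

theorem continuous_tsum_upTerm : Continuous fun x : ℝ => ∑' ρ, upTerm x ρ := by
  simp only [tsum_upTerm]
  exact (continuous_tsum_mult_mul_kern_sub upperZeros).add continuous_const

theorem continuous_tsum_downTerm : Continuous fun x : ℝ => ∑' ρ, downTerm x ρ :=
  continuous_tsum_mult_mul_kern_sub lowerZeros

/-- The subtracted sum over all zeros is minus the increment of Re G'/G from 1/2. Removing the
subtraction from the upper half adds only a constant. -/
theorem tsum_upper_add_lower {x : ℝ} (hx : auxG (1 / 2 + x * I) ≠ 0) :
    ∑' ρ, upTerm x ρ + ∑' ρ, downTerm x ρ = ∑' ρ : upperZeros, (mult ρ : ℝ) * kern ρ 0 +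
      ((logDeriv auxG (1 / 2)).re - (logDeriv auxG (1 / 2 + x * I)).re) := by
  set f : ℂ → ℝ := fun ρ => (mult ρ : ℝ) * (kern ρ x - kern ρ 0) with hf
  have hs : Summable f := summable_mult_mul_kern_sub x
  have hdisj : Disjoint upperZeros lowerZeros := by
    rw [Set.disjoint_left]
    intro ρ h1 h2
    exact absurd h1.2 (not_lt.2 h2.2)
  have hsupp : Function.support f ⊆ upperZeros ∪ lowerZeros := by
    intro ρ hρ
    have hm : 0 < mult ρ := (mult_nonneg ρ).lt_of_ne' fun h => hρ (by simp [hf, h])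
    rcases lt_or_ge 0 ρ.im with h | h
    · exact Or.inl ⟨hm, h⟩
    · exact Or.inr ⟨hm, h⟩
  have h1 : ∑' ρ : ↥(upperZeros ∪ lowerZeros), f ρ = ∑' ρ, f ρ :=
    tsum_subtype_eq_of_support_subset hsupp
  rw [(hs.subtype upperZeros).tsum_union_disjoint hdisj (hs.subtype lowerZeros),
    (hasSum_mult_mul_kern_sub hx).tsum_eq] at h1
  rw [tsum_upTerm, ← h1]
  simp only [hf, downTerm]
  ring

/-! ### Assembling the formula for the phase -/

theorem hasDerivAt_theta (t : ℝ) : HasDerivAt theta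
    ((digamma (1 / 4 + t / 2 * I)).re / 2 - 1 / 2 * Real.log Real.pi) t := by
  have hc := continuous_digamma_line
  have hre : Continuous fun x : ℝ => (digamma (1 / 4 + x / 2 * I)).re / 2 := by fun_prop
  exact (intervalIntegral.integral_hasDerivAt_right (hre.intervalIntegrable 0 t)
    (hre.stronglyMeasurableAtFilter _ _) hre.continuousAt).sub
    (((hasDerivAt_id t).div_const 2).mul_const (Real.log Real.pi))

theorem IsPhase.deriv_eq_sum {ω : ℝ → ℝ} (hω : IsPhase ω) {t : ℝ} (ht : auxG (1 / 2 + t * I) ≠ 0) :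
    deriv ω t = (digamma (1 / 4 + t / 2 * I)).re / 2 - 1 / 2 * Real.log Real.pi +
      ∑' ρ, upTerm t ρ + ∑' ρ, downTerm t ρ -
      ((logDeriv auxG (1 / 2)).re + ∑' ρ : upperZeros, (mult ρ : ℝ) * kern ρ 0) +
      1 / (1 + (2 * t) ^ 2) * 2 := by
  rw [hω.deriv_eq ht, logDeriv_auxR_half_line ht]
  have h := tsum_upper_add_lower ht
  have e1 : (1 / (1 / 2 + t * I) : ℂ).re = 1 / (1 + (2 * t) ^ 2) * 2 := by
    rw [one_div, inv_re, normSq_apply]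
    simp
    field_simp
  have e2 : (I * Real.pi / 4 : ℂ).re = 0 := by
    rw [show (I * Real.pi / 4 : ℂ) = ((Real.pi / 4 : ℝ) : ℂ) * I by push_cast; ring]
    simp
  have e3 : ((Real.log Real.pi : ℂ) / 2).re = Real.log Real.pi / 2 := by
    rw [show ((Real.log Real.pi : ℂ) / 2) = ((Real.log Real.pi / 2 : ℝ) : ℂ) by push_cast; ring,
      ofReal_re]
  have e4 : ∀ z : ℂ, (z / 2).re = z.re / 2 := fun z => by simp
  rw [sub_re, sub_re, add_re, add_re, e1, e2, e3, e4]
  linarith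

/-- The integrands of u and d are continuous, so both sides are differentiable everywhere. Their
derivatives agree off the zeros on the critical line, hence everywhere, and at t = 0 both sides
equal ω(0). The constant B does not depend on ω. -/
theorem IsPhase.eq_sum {ω : ℝ → ℝ} (hω : IsPhase ω) (t : ℝ) :
    ω t = theta t + u t + d t -
      ((logDeriv auxG (1 / 2)).re + ∑' ρ : upperZeros, (mult ρ : ℝ) * kern ρ 0) * t +
      Real.arctan (2 * t) + ω 0 := by
  set B := (logDeriv auxG (1 / 2)).re + ∑' ρ : upperZeros, (mult ρ : ℝ) * kern ρ 0 with hB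
  have hu : ∀ t, HasDerivAt u (∑' ρ, upTerm t ρ) t := fun t =>
    intervalIntegral.integral_hasDerivAt_right (continuous_tsum_upTerm.intervalIntegrable 0 t)
      (continuous_tsum_upTerm.stronglyMeasurableAtFilter _ _) continuous_tsum_upTerm.continuousAt
  have hd : ∀ t, HasDerivAt d (∑' ρ, downTerm t ρ) t := fun t =>
    intervalIntegral.integral_hasDerivAt_right (continuous_tsum_downTerm.intervalIntegrable 0 t)
      (continuous_tsum_downTerm.stronglyMeasurableAtFilter _ _) continuous_tsum_downTerm.continuousAt
  have hΦ : ∀ t : ℝ, HasDerivAt (fun t : ℝ => theta t + u t + d t - B * t + Real.arctan (2 * t) + ω 0)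
      ((digamma (1 / 4 + t / 2 * I)).re / 2 - 1 / 2 * Real.log Real.pi +
        ∑' ρ, upTerm t ρ + ∑' ρ, downTerm t ρ - B + 1 / (1 + (2 * t) ^ 2) * 2) t := by
    intro t
    have h1 : HasDerivAt (fun t : ℝ => B * t) B t := by
      simpa using (hasDerivAt_id t).const_mul B
    have h2 : HasDerivAt (fun t : ℝ => 2 * t) 2 t := by
      simpa using (hasDerivAt_id t).const_mul 2
    exact (((((hasDerivAt_theta t).add (hu t)).add (hd t)).sub h1).add h2.arctan).add_const _
  have hcont : Continuous fun t : ℝ => (digamma (1 / 4 + t / 2 * I)).re / 2 -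
      1 / 2 * Real.log Real.pi + ∑' ρ, upTerm t ρ + ∑' ρ, downTerm t ρ - B +
      1 / (1 + (2 * t) ^ 2) * 2 := by
    have h1 := continuous_digamma_line
    have h2 := continuous_tsum_upTerm
    have h3 := continuous_tsum_downTerm
    have h4 : Continuous fun t : ℝ => 1 / (1 + (2 * t) ^ 2) :=
      continuous_const.div (by fun_prop) fun t => by positivity
    fun_prop
  have hdω : Continuous (deriv ω) :=
    continuous_iff_continuousAt.2 fun t => (hω.1 t trivial).deriv.continuousAt
  have hder := eq_of_forall_auxG_half_line_ne_zero hdω hcont fun t ht => hω.deriv_eq_sum ht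
  refine congrFun (eq_of_fderiv_eq (fun t => (hω.1 t trivial).differentiableAt)
    (fun t => (hΦ t).differentiableAt) (fun t => ?_) 0 ?_) t
  · rw [(hω.1 t trivial).differentiableAt.hasDerivAt.hasFDerivAt.fderiv, hder t,
      (hΦ t).hasFDerivAt.fderiv]
  · simp [theta, u, d]

end
end RiemannAux

theorem mainTheorem5 :
    (∃! ω : ℝ → ℝ, RiemannAux.IsPhase ω) ∧
    (∀ x : ℝ, Summable (RiemannAux.upTerm x)) ∧
    (∀ x : ℝ, Summable (RiemannAux.downTerm x)) ∧
    (∀ t : ℝ, IntervalIntegrable (fun x : ℝ => ∑' ρ, RiemannAux.upTerm x ρ)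
      MeasureTheory.volume 0 t) ∧
    (∀ t : ℝ, IntervalIntegrable (fun x : ℝ => ∑' ρ, RiemannAux.downTerm x ρ)
      MeasureTheory.volume 0 t) ∧
    ∃ B : ℝ, ∀ ω : ℝ → ℝ, RiemannAux.IsPhase ω → ∀ t : ℝ,
      ω t = RiemannAux.theta t + RiemannAux.u t + RiemannAux.d t - B * t
        + Real.arctan (2 * t) + ω 0 :=
  ⟨RiemannAux.existsUnique_isPhase, RiemannAux.summable_upTerm, RiemannAux.summable_downTerm,
    fun t => RiemannAux.continuous_tsum_upTerm.intervalIntegrable 0 t,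
    fun t => RiemannAux.continuous_tsum_downTerm.intervalIntegrable 0 t,
    _, fun _ hω t => hω.eq_sum t⟩
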